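/- **Theorem 1.** Let $\{X_t\}_{t\in\mathbb Z}$ be a real-valued strictly stationary process with finite variance, $r(k)=\mathrm{Cov}(X_0,X_k)$, $f(\omega)=(2\pi)^{-1}\sum_{k\in\mathbb Z} r(k)e^{-ik\omega}$, $\bar X_n=n^{-1}\sum_{t=1}^n X_t$ and $\sigma_n^2=n\,\mathrm{Var}(\bar X_n)$. *Estimators.* For $\ell>1$, $p=\ell^{-1}$, let, independently of the data, $J_1,\dots,J_n$ be i.i.d. with $P(J_1=k)=p(1-p)^{k-1}$, $k\ge 1$, and let $I_1,\dots,I_n$ be i.i.d. uniform on $\{1,\dots,n\}$ and independent of the $J_i$. The stationary bootstrap (SB) sample $X_1^*,\dots,X_n^*$ consists of the first $n$ entries of the concatenated blocks $(X_{I_i},\dots,X_{I_i+J_i-1})$, $i=1,2,\dots$, where the data are extended periodically by $X_i=X_{i-n}$ for $i>n$. The SB estimator is $\hat\sigma^2_{\ell,SB}=n\,\mathrm{Var}_*\big(n^{-1}\sum_{t=1}^n X_t^*\,\big|\,X_1,\dots,X_n\big)$. For an integer $\ell\ge1$ and $b=\lfloor n/\ell\rfloor$, the nonoverlapping block bootstrap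 (NBB) estimator is $\hat\sigma^2_{\ell,NBB}=b\ell\,\mathrm{Var}_*(\bar X^*_{n,NBB}\mid X_1,\dots,X_n)$, where $\bar X^*_{n,NBB}$ is the mean of $b$ blocks drawn independently and uniformly from the disjoint blocks $(X_{\ell(i-1)+1},\dots,X_{\ell i})$, $i=1,\dots,b$. *Assumptions* (block sizes $\ell=\ell_n$ may depend on $n$): A.1: $|r(0)|+\sum_{k\ge1}k|r(k)|<\infty$. A.2: $E X_0^4<\infty$ and $\sum_{t_1,t_2,t_3\in\mathbb Z}|\mathrm{cu}(X_0,X_{t_1},X_{t_2},X_{t_3})|<\infty$, where $\mathrm{cu}$ is the joint cumulant. A.3: $\ell\to\infty$ and $\ell\log n/n\to0$ as $n\to\infty$. *Claims.* (a) Under A.1–A.3, as $n\to\infty$, $$\mathrm{Var}(\hat\sigma^2_{\ell,SB})=\frac{\ell}{n}\,2\{2\pi f(0)\}^2+o(\ell/n).$$ This is the same first-order variance as for the NBB: for integer block lengths $\ell$, A.1–A.3 also give $$\mathrm{Var}(\hat\sigma^2_{\ell,NBB})=\frac{\ell}{n}\,2\{2\pi f(0)\}^2+o(\ell/n).$$ (b)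 Under A.1 and $\ell^{-1}+\ell^2/n\to0$ as $n\to\infty$ (with $\ell>1$), $$E(\hat\sigma^2_{\ell,SB})-\sigma_n^2=-\frac{G}{\ell}+o(1/\ell),\qquad G=\sum_{k\in\mathbb Z}|k|\,r(k).$$ -/

import Mathlib

open MeasureTheory ProbabilityTheory Filter Asymptotics Topology

namespace StationaryBootstrap

noncomputable section

/-! ### The time series -/

/-- Strict stationarity of a real process indexed by `ℤ`: the law of the whole path (on the product
σ-algebra, so equivalently all finite-dimensional laws) is invariant under time shifts. -/
def IsStrictlyStationary {Ω : Type*} [MeasurableSpace Ω] (X : ℤ → Ω → ℝ) (μ : Measure Ω) : Prop :=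
  ∀ h : ℤ, IdentDistrib (fun ω (t : ℤ) => X t ω) (fun ω (t : ℤ) => X (t + h) ω) μ μ

/-- The autocovariance `r(k) = Cov(X_0, X_k)`. -/
def autocov {Ω : Type*} [MeasurableSpace Ω] (X : ℤ → Ω → ℝ) (μ : Measure Ω) (k : ℤ) : ℝ :=
  cov[X 0, X k; μ]

/-- The spectral density `f(ω) = (2π)⁻¹ ∑_{k ∈ ℤ} r(k) e^{-ikω}`. The sum is a real number, because
`r` is even; it is formed in `ℂ` and read off as a real part. -/
def spectralDensity {Ω : Type*} [MeasurableSpace Ω] (X : ℤ → Ω → ℝ) (μ : Measure Ω) (w : ℝ) : ℝ :=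
  ((2 * (Real.pi : ℂ))⁻¹ *
    ∑' k : ℤ, (autocov X μ k : ℂ) * Complex.exp (-(Complex.I * (k : ℂ) * (w : ℂ)))).re

/-- The joint cumulant of `Y_1, …, Y_m` (for `m ≥ 1`), as the sum over all set partitions `π`
of the index set of `(-1)^{|π|-1} (|π|-1)! ∏_{B ∈ π} E ∏_{i ∈ B} Y_i`. -/
def jointCumulant {Ω : Type*} [MeasurableSpace Ω] {m : ℕ} (Y : Fin m → Ω → ℝ) (μ : Measure Ω) : ℝ :=
  ∑ π : Finpartition (Finset.univ : Finset (Fin m)),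
    (-1 : ℝ) ^ (π.parts.card - 1) * ((π.parts.card - 1).factorial : ℝ) *
      ∏ B ∈ π.parts, ∫ ω, ∏ i ∈ B, Y i ω ∂μ

/-- Condition A.1: finite variance and `∑_{k ≥ 1} k |r(k)| < ∞`. -/
def CondA1 {Ω : Type*} [MeasurableSpace Ω] (X : ℤ → Ω → ℝ) (μ : Measure Ω) : Prop :=
  MemLp (X 0) 2 μ ∧ Summable (fun k : ℕ => (k : ℝ) * |autocov X μ k|)

/-- Condition A.2: finite fourth moments (so that the cumulants exist) and absolutely summable
fourth-order cumulants `cu(X_0, X_{t₁}, X_{t₂}, X_{t₃})` over `(t₁, t₂, t₃) ∈ ℤ³`. -/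
def CondA2 {Ω : Type*} [MeasurableSpace Ω] (X : ℤ → Ω → ℝ) (μ : Measure Ω) : Prop :=
  MemLp (X 0) 4 μ ∧
    Summable (fun t : ℤ × ℤ × ℤ => |jointCumulant ![X 0, X t.1, X t.2.1, X t.2.2] μ|)

/-- Condition A.3: `ℓ → ∞` and `ℓ log n / n → 0`. -/
def CondA3 (ℓ : ℕ → ℝ) : Prop :=
  Tendsto ℓ atTop atTop ∧ Tendsto (fun n : ℕ => ℓ n * Real.log n / n) atTop (𝓝 0)

/-- The target `σ_n² = n Var(X̄_n)` with `X̄_n = n⁻¹ ∑_{t=1}^n X_t`. -/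
def sigmaSq {Ω : Type*} [MeasurableSpace Ω] (X : ℤ → Ω → ℝ) (μ : Measure Ω) (n : ℕ) : ℝ :=
  n * Var[fun ω => (n : ℝ)⁻¹ * ∑ t ∈ Finset.Icc 1 n, X (t : ℤ) ω; μ]

/-- The observed data `X_1(ω), X_2(ω), …` (the estimators below use the first `n` of them). -/
def data {Ω : Type*} (X : ℤ → Ω → ℝ) (ω : Ω) (t : ℕ) : ℝ := X (t : ℤ) ω

/-! ### The stationary bootstrap -/

/-- The periodic extension of `x_1, …, x_n`: `x_i = x_{i-n}` for `i > n` (used for `i ≥ 1`). -/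
def periodicExt (n : ℕ) (x : ℕ → ℝ) (i : ℕ) : ℝ := x ((i - 1) % n + 1)

/-- The number of entries of the concatenated blocks that precede the block number `i`. -/
def blockStart {n : ℕ} (J : Fin n → ℕ) (i : Fin n) : ℕ := ∑ j ∈ Finset.Iio i, J j

/-- The bootstrap observation `X*_t`, `1 ≤ t ≤ n`: the entry number `t` of the concatenation of
the blocks `B(I_i, J_i) = (x_{I_i}, …, x_{I_i + J_i - 1})`. If entry `t` lies in the block `i`, which
occupies the places `blockStart J i + 1, …, blockStart J i + J i`, it is the entry number
`t - blockStart J i` of that block. As all `J_i ≥ 1` almost surely, exactly one summand is switched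
on, and only the blocks up to `K = min {k : J_1 + ⋯ + J_k ≥ n} ≤ n` are used. -/
def sbObs (n : ℕ) (x : ℕ → ℝ) (J I : Fin n → ℕ) (t : ℕ) : ℝ :=
  ∑ i : Fin n, if blockStart J i < t ∧ t ≤ blockStart J i + J i then
    periodicExt n x (I i + (t - blockStart J i - 1)) else 0

/-- The bootstrap mean `X̄*_n = n⁻¹ ∑_{t=1}^n X*_t`. -/
def sbMean (n : ℕ) (x : ℕ → ℝ) (J I : Fin n → ℕ) : ℝ :=
  (n : ℝ)⁻¹ * ∑ t ∈ Finset.Icc 1 n, sbObs n x J I t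

/-- The geometric law of a block length: `P(J = k) = p (1 - p)^{k-1}`, `k ≥ 1`, where `p = ℓ⁻¹`
(for `ℓ ≥ 1`; `projIcc` only serves to place `ℓ⁻¹` in the unit interval). -/
def blockLengthLaw (ℓ : ℝ) : Measure ℕ :=
  (geometricMeasure (Set.projIcc (0 : ℝ) 1 zero_le_one ℓ⁻¹)).map (fun k => k + 1)

/-- The resampling law of `(J, I)`: `J_1, …, J_n` i.i.d. geometric, `I_1, …, I_n` i.i.d. uniform on
`{1, …, n}`, all independent (and independent of the data). -/
def sbLaw (n : ℕ) (ℓ : ℝ) : Measure ((Fin n → ℕ) × (Fin n → ℕ)) :=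
  (Measure.pi fun _ : Fin n => blockLengthLaw ℓ).prod
    (Measure.pi fun _ : Fin n => uniformOn (Set.Icc 1 n))

/-- The stationary bootstrap estimator `n Var_*(X̄*_n | X_1 = x_1, …, X_n = x_n)`. -/
def sbEstimator (n : ℕ) (ℓ : ℝ) (x : ℕ → ℝ) : ℝ :=
  n * Var[fun w => sbMean n x w.1 w.2; sbLaw n ℓ]

/-! ### The nonoverlapping block bootstrap -/

/-- The bootstrap mean `(bℓ)⁻¹ ∑ X*_t` over the concatenation of the `b` blocks of length `ℓ`
with numbers `I_1, …, I_b ∈ {1, …, b}`, the block number `j` being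
`B(ℓ(j-1)+1, ℓ) = (x_{ℓ(j-1)+1}, …, x_{ℓj})`. -/
def nbbMean (ℓ b : ℕ) (x : ℕ → ℝ) (I : Fin b → ℕ) : ℝ :=
  ((b * ℓ : ℕ) : ℝ)⁻¹ * ∑ i : Fin b, ∑ k ∈ Finset.Icc 1 ℓ, x (ℓ * (I i - 1) + k)

/-- The nonoverlapping block bootstrap estimator `bℓ Var_*(X̄*_{n,NBB} | X_1 = x_1, …, X_n = x_n)`,
where `b = ⌊n/ℓ⌋` blocks are drawn independently and uniformly from the `b` disjoint blocks. -/
def nbbEstimator (n ℓ : ℕ) (x : ℕ → ℝ) : ℝ :=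
  ((n / ℓ * ℓ : ℕ) : ℝ) * Var[fun I => nbbMean ℓ (n / ℓ) x I;
    Measure.pi fun _ : Fin (n / ℓ) => uniformOn (Set.Icc 1 (n / ℓ))]

end

end StationaryBootstrap

namespace StationaryBootstrap

/-! ### Block lengths and coverage -/

/-! Put `q = 1 - ℓ⁻¹`. Given the data, let `s ≤ t` be two places of the bootstrap sample. If they
lie in different blocks, the two uniform starting points are independent, and for data with sample
mean zero the product has mean zero. If they lie in one block, the product averages to the circular
second moment at lag `t - s`. Because the block length is memoryless, the second case has
probability exactly `q ^ (t - s)` (`sum_pi_blockLengthLaw_cover`). The estimator is therefore an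
explicit quadratic form in the data (`sbEstimator_eq`): unfolding the circle gives lag weights `(1 -
k/n) q^k + (k/n) q^(n-k)`, and removing the sample mean subtracts a constant. The NBB estimator is
the quadratic form of the common-block indicator, again minus a constant (`nbbEstimator_eq`).

Both variances come from one theorem, `tendsto_variance_quadForm`. The covariance of two products of
centred variables is a fourth cumulant plus two products of autocovariances (`cov_mul_mul`). If the
coefficients are at most `M` on a box of side `N`, the cumulants contribute at most a constant times
`M² N`. The rest is `2 ∑_w ρ(w) ∑_x a(x) a(x + w)` with `ρ = r ⊗ r` summable on `ℤ²`. If the array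
is asymptotically shift invariant in `ℓ²`, each inner sum is asymptotic to `‖a‖²`, and dominated
convergence gives `2 ‖a‖² (∑ r)² = 2 ‖a‖² (2π f(0))²`. Only `‖a‖²` distinguishes the methods, and it
is asymptotic to `ℓ/n` for both: the NBB indicator array has squared norm `1/b`, and the array `n⁻¹
q^|i-j|` has squared norm close to `(nℓ⁻¹)⁻¹ (1 + q²)/(1 + q)`. The remaining parts of the
coefficients are negligible in `ℓ²`.

For the bias, the expectation of the form minus `σ_n²` is a sum over lags of `(weight - 1) r(k)` and
a sample-mean correction. Multiplied by `ℓ`, the weight error at lag `k` tends to `-k` and is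
bounded by `2k`, so A.1 and dominated convergence produce `-G`; the correction becomes `O(ℓ²/n)`. -/

lemma projIcc_inv {ℓ : ℝ} (hℓ : 1 < ℓ) :
    ((Set.projIcc (0 : ℝ) 1 zero_le_one ℓ⁻¹ : unitInterval) : ℝ) = ℓ⁻¹ := by
  rw [Set.projIcc_of_mem zero_le_one ⟨by positivity, inv_le_one_of_one_le₀ hℓ.le⟩]

instance isProbabilityMeasure_blockLengthLaw (ℓ : ℝ) :
    IsProbabilityMeasure (blockLengthLaw ℓ) :=
  Measure.isProbabilityMeasure_map (by fun_prop)

lemma geometricMeasure_real_Ici {p : unitInterval} (hp : p ≠ 0) (k : ℕ) :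
    (geometricMeasure p).real (Set.Ici k) = (1 - p : ℝ) ^ k := by
  induction k with
  | zero =>
    have : Set.Ici 0 = (Set.univ : Set ℕ) := by ext; simp
    simp [this]
  | succ k ih =>
    have h : Set.Ici k = {k} ∪ Set.Ici (k + 1) := by
      ext m; simp only [Set.mem_Ici, Set.mem_union, Set.mem_singleton_iff]; omega
    rw [h, measureReal_union (by simp) (by measurability),
      geometricMeasure_real_singleton hp] at ih
    rw [pow_succ]; linarith

lemma blockLengthLaw_real_Ici {ℓ : ℝ} (hℓ : 1 < ℓ) (k : ℕ) :
    (blockLengthLaw ℓ).real (Set.Ici (k + 1)) = (1 - ℓ⁻¹) ^ k := by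
  have hp : Set.projIcc (0 : ℝ) 1 zero_le_one ℓ⁻¹ ≠ 0 := fun h => by
    have := projIcc_inv hℓ
    rw [h] at this
    have h2 : 0 < ℓ⁻¹ := by positivity
    simp at this; linarith
  rw [blockLengthLaw, map_measureReal_apply (by fun_prop) (by measurability)]
  have : (fun k : ℕ => k + 1) ⁻¹' Set.Ici (k + 1) = Set.Ici k := by ext; simp
  rw [this, geometricMeasure_real_Ici hp, projIcc_inv hℓ]

/-- The indicator of block `i` is `g i - g (i + 1)`, where `g m` says that the first `m` blocks end
before place `t`; the sum telescopes. Lengths at least one make all `n` blocks together reach place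
`n`. -/
lemma sum_ite_blockStart {n : ℕ} (J : Fin n → ℕ) (hJ : ∀ i, 1 ≤ J i) {t : ℕ} (h1 : 1 ≤ t)
    (ht : t ≤ n) :
    ∑ i, (if blockStart J i < t ∧ t ≤ blockStart J i + J i then (1 : ℝ) else 0) = 1 := by
  set f : ℕ → ℕ := fun m => ∑ j : Fin n with j.val < m, J j with hf
  have hS : ∀ i : Fin n, blockStart J i = f i := fun i => by
    rw [blockStart, hf]; congr 1; ext j; simp
  have hS' : ∀ i : Fin n, f i + J i = f (i + 1) := fun i => by
    have : (Finset.univ.filter fun j : Fin n => j.val < i.val + 1) =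
        insert i (Finset.univ.filter fun j : Fin n => j.val < i.val) := by
      ext j; simp [Fin.ext_iff]; omega
    simp only [hf]
    rw [this, Finset.sum_insert (by simp), add_comm]
  have hn : n ≤ f n := by
    have : f n = ∑ j, J j := by simp [hf]
    rw [this]
    calc n = ∑ _j : Fin n, 1 := by simp
      _ ≤ _ := Finset.sum_le_sum fun i _ => hJ i
  have h0 : f 0 = 0 := by simp [hf]
  set g : ℕ → ℝ := fun m => if f m < t then 1 else 0 with hg
  have key : ∀ i : Fin n, (if blockStart J i < t ∧ t ≤ blockStart J i + J i then (1 : ℝ) else 0) =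
      g i - g (i + 1) := fun i => by
    have := hS' i
    simp only [hS, hS', hg]
    split_ifs <;> first | omega | simp
  simp_rw [key]
  rw [Fin.sum_univ_eq_sum_range (fun m => g m - g (m + 1)) n, Finset.sum_range_sub']
  have hn' : ¬ f n < t := by omega
  have h1' : f 0 < t := by omega
  simp only [hg, h1', hn', if_true, if_false, sub_zero]

lemma blockStart_indep {n : ℕ} (P : Measure ℕ) [IsProbabilityMeasure P] (i : Fin n) :
    IndepFun (fun J : Fin n → ℕ => blockStart J i) (fun J => J i) (Measure.pi fun _ => P) := by
  have h := iIndepFun_pi (μ := fun _ : Fin n => P) (X := fun _ x => x) (fun _ => by fun_prop)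
  have := h.indepFun_finsetSum_of_notMem (fun _ => by fun_prop) (s := Finset.Iio i) (i := i)
    (by simp)
  convert! this using 1
  ext J; simp [blockStart]

/-- Split by the value `m` of the block start. It depends only on earlier lengths, so it is
independent of `J i`, and the block reaches `t` exactly when `J i ≥ t - m`. -/
lemma pi_blockLengthLaw_cover {n : ℕ} {ℓ : ℝ} (hℓ : 1 < ℓ) (i : Fin n) {s t : ℕ} (hst : s ≤ t) :
    (Measure.pi fun _ : Fin n => blockLengthLaw ℓ).real
      {J | blockStart J i < s ∧ t ≤ blockStart J i + J i} =
    ∑ m ∈ Finset.range s, (Measure.pi fun _ : Fin n => blockLengthLaw ℓ).real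
      {J | blockStart J i = m} * (1 - ℓ⁻¹) ^ (t - m - 1) := by
  have hd : {J : Fin n → ℕ | blockStart J i < s ∧ t ≤ blockStart J i + J i} =
      ⋃ m ∈ Finset.range s, ((fun J => blockStart J i) ⁻¹' {m} ∩
        (fun J => J i) ⁻¹' Set.Ici (t - m)) := by
    ext J; simp; omega
  rw [hd, measureReal_biUnion_finset]
  · refine Finset.sum_congr rfl fun m hm => ?_
    rw [measureReal_def, (blockStart_indep _ i).measure_inter_preimage_eq_mul _ _ (by measurability)
      (by measurability), ENNReal.toReal_mul]
    congr 1
    rw [← measureReal_def, (measurePreserving_eval (fun _ => blockLengthLaw ℓ) i).measureReal_preimage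
      (by measurability)]
    have : t - m = t - m - 1 + 1 := by simp at hm; omega
    rw [this, blockLengthLaw_real_Ici hℓ, ← this]
  · intro a _ b _ hab
    refine Set.disjoint_left.2 fun J h1 h2 => hab ?_
    simp at h1 h2; omega
  · intro m _; exact MeasurableSet.of_discrete

lemma pi_blockLengthLaw_one_le {n : ℕ} {ℓ : ℝ} (hℓ : 1 < ℓ) :
    ∀ᵐ J ∂(Measure.pi fun _ : Fin n => blockLengthLaw ℓ), ∀ i, 1 ≤ J i := by
  rw [ae_all_iff]
  intro i
  have h : ∀ᵐ k ∂blockLengthLaw ℓ, 1 ≤ k := by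
    have := blockLengthLaw_real_Ici hℓ 0
    rw [pow_zero, measureReal_def, ENNReal.toReal_eq_one_iff] at this
    exact (prob_compl_eq_zero_iff (by measurability)).2 this
  exact (measurePreserving_eval (fun _ => blockLengthLaw ℓ) i).quasiMeasurePreserving.ae h

/-- Memorylessness: the exponent `t - m - 1` splits as `(t - s) + (s - m - 1)`, so a block covers
both places with `(1 - ℓ⁻¹) ^ (t - s)` times the probability of covering `s`. The latter
probabilities add up to one, since almost surely exactly one block covers `s`. -/
lemma sum_pi_blockLengthLaw_cover {n : ℕ} {ℓ : ℝ} (hℓ : 1 < ℓ) {s t : ℕ} (hs : 1 ≤ s)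
    (hst : s ≤ t) (ht : t ≤ n) :
    ∑ i, (Measure.pi fun _ : Fin n => blockLengthLaw ℓ).real
      {J | blockStart J i < s ∧ t ≤ blockStart J i + J i} = (1 - ℓ⁻¹) ^ (t - s) := by
  set P := Measure.pi fun _ : Fin n => blockLengthLaw ℓ
  have h1 : ∀ i : Fin n, P.real {J | blockStart J i < s ∧ t ≤ blockStart J i + J i} =
      (1 - ℓ⁻¹) ^ (t - s) * P.real {J | blockStart J i < s ∧ s ≤ blockStart J i + J i} := by
    intro i
    rw [pi_blockLengthLaw_cover hℓ i hst, pi_blockLengthLaw_cover hℓ i le_rfl, Finset.mul_sum]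
    refine Finset.sum_congr rfl fun m hm => ?_
    have : t - m - 1 = (t - s) + (s - m - 1) := by simp at hm; omega
    rw [this, pow_add]; ring
  have h2 : ∑ i, P.real {J | blockStart J i < s ∧ s ≤ blockStart J i + J i} = 1 := by
    have : ∀ i : Fin n, P.real {J | blockStart J i < s ∧ s ≤ blockStart J i + J i} =
        ∫ J, (if blockStart J i < s ∧ s ≤ blockStart J i + J i then (1 : ℝ) else 0) ∂P := by
      intro i
      rw [← integral_indicator_one MeasurableSet.of_discrete]
      congr 1
      ext J
      simp [Set.indicator_apply]
    simp_rw [this]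
    rw [← integral_finsetSum]
    · rw [integral_congr_ae (g := fun _ => 1)]
      · simp
      · filter_upwards [pi_blockLengthLaw_one_le hℓ] with J hJ
        exact sum_ite_blockStart J hJ hs (hst.trans ht)
    · intro i _
      refine Integrable.of_bound (Measurable.of_discrete.aestronglyMeasurable) 1 (ae_of_all _ ?_)
      intro J; split_ifs <;> simp
  simp_rw [h1, ← Finset.mul_sum, h2, mul_one]

end StationaryBootstrap

namespace StationaryBootstrap

/-! ### Uniform resampling -/

lemma isProbabilityMeasure_uniformOn_Icc {n : ℕ} (hn : 1 ≤ n) :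
    IsProbabilityMeasure (uniformOn (Set.Icc 1 n) : Measure ℕ) :=
  isProbabilityMeasure_uniformOn (Set.finite_Icc 1 n) ⟨1, by simp [hn]⟩

lemma integral_uniformOn_Icc (n : ℕ) (f : ℕ → ℝ) :
    ∫ k, f k ∂(uniformOn (Set.Icc 1 n)) = (n : ℝ)⁻¹ * ∑ i ∈ Finset.range n, f (i + 1) := by
  have h : (Set.Icc 1 n : Set ℕ) = ((Finset.Icc 1 n : Finset ℕ) : Set ℕ) := by simp
  rw [uniformOn, ProbabilityTheory.cond, integral_smul_measure, h, setIntegral_finset, Measure.count_apply_finset]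
  · have h2 : ∑ i ∈ Finset.range n, f (i + 1) = ∑ i ∈ Finset.Icc 1 n, f i := by
      rw [Finset.range_eq_Ico, Finset.sum_Ico_add' f 0 n 1]
      congr 1
    rw [h2]
    simp [Measure.real]
  · rw [← Set.biUnion_of_singleton ((Finset.Icc 1 n : Finset ℕ) : Set ℕ)]
    simp only [Finset.mem_coe]
    rw [integrableOn_finset_iUnion]
    intro i _
    rw [integrableOn_singleton_iff]
    simp

/-- Circular sample second moment at lag `k`. -/
noncomputable def circularMoment (n : ℕ) (z : ℕ → ℝ) (k : ℕ) : ℝ :=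
  (n : ℝ)⁻¹ * ∑ i ∈ Finset.range n, z (i + 1) * z ((i + k) % n + 1)

lemma sum_range_mod_add (n a : ℕ) (f : ℕ → ℝ) :
    ∑ i ∈ Finset.range n, f ((i + a) % n) = ∑ i ∈ Finset.range n, f i := by
  induction a with
  | zero =>
    refine Finset.sum_congr rfl fun i hi => ?_
    rw [add_zero, Nat.mod_eq_of_lt (Finset.mem_range.1 hi)]
  | succ a ih =>
    rw [← ih]
    -- Peel `n + 1` consecutive terms at either end: the first and the last agree modulo `n`.
    have h1 := Finset.sum_range_succ (fun i => f ((i + a) % n)) n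
    have h2 := Finset.sum_range_succ' (fun i => f ((i + a) % n)) n
    rw [h1] at h2
    simp only [Nat.add_mod_left, zero_add, add_left_inj] at h2
    rw [h2]
    refine Finset.sum_congr rfl fun i _ => ?_
    congr 2; ring

lemma integral_periodicExt (n : ℕ) (z : ℕ → ℝ) (a : ℕ) :
    ∫ k, periodicExt n z (k + a) ∂(uniformOn (Set.Icc 1 n)) =
      (n : ℝ)⁻¹ * ∑ i ∈ Finset.range n, z (i + 1) := by
  rw [integral_uniformOn_Icc, ← sum_range_mod_add n a (fun i => z (i + 1))]
  congr 1
  refine Finset.sum_congr rfl fun i _ => ?_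
  simp only [periodicExt]
  congr 3; omega

lemma integral_periodicExt_mul (n : ℕ) (z : ℕ → ℝ) (a k : ℕ) :
    ∫ i, periodicExt n z (i + a) * periodicExt n z (i + (a + k)) ∂(uniformOn (Set.Icc 1 n)) =
      circularMoment n z k := by
  rw [integral_uniformOn_Icc, circularMoment,
    ← sum_range_mod_add n a (fun i => z (i + 1) * z ((i + k) % n + 1))]
  congr 1
  refine Finset.sum_congr rfl fun i _ => ?_
  have h1 : i + 1 + a - 1 = i + a := by omega
  have h2 : i + 1 + (a + k) - 1 = i + a + k := by omega
  simp only [periodicExt, h1, h2, Nat.mod_add_mod]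

lemma integral_pi_comp {n : ℕ} (P : Measure ℕ) [IsProbabilityMeasure P] (i : Fin n) (f : ℕ → ℝ) :
    ∫ I, f (I i) ∂(Measure.pi fun _ : Fin n => P) = ∫ k, f k ∂P := by
  have h := (measurePreserving_eval (fun _ : Fin n => P) i).map_eq
  conv_rhs => rw [← h]
  rw [integral_map (measurable_pi_apply i).aemeasurable
    Measurable.of_discrete.aestronglyMeasurable]

lemma integral_pi_mul {n : ℕ} (P : Measure ℕ) [IsProbabilityMeasure P] {i j : Fin n} (hij : i ≠ j)
    (f g : ℕ → ℝ) :
    ∫ I, f (I i) * g (I j) ∂(Measure.pi fun _ : Fin n => P) =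
      (∫ k, f k ∂P) * ∫ k, g k ∂P := by
  have h := (iIndepFun_pi (μ := fun _ : Fin n => P) (X := fun _ x => x)
    (fun _ => by fun_prop)).indepFun hij
  have h2 := h.comp (φ := f) (ψ := g) Measurable.of_discrete Measurable.of_discrete
  rw [← integral_pi_comp P i, ← integral_pi_comp P j]
  exact h2.integral_fun_mul_eq_mul_integral Measurable.of_discrete.aestronglyMeasurable
    Measurable.of_discrete.aestronglyMeasurable

/-- Boundedness is the source of all integrability under the resampling law. -/
lemma exists_abs_periodicExt_le {n : ℕ} (hn : 1 ≤ n) (z : ℕ → ℝ) :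
    ∃ M, 0 ≤ M ∧ ∀ k, |periodicExt n z k| ≤ M := by
  refine ⟨∑ i ∈ Finset.range n, |z (i + 1)|, Finset.sum_nonneg fun _ _ => abs_nonneg _,
    fun k => ?_⟩
  exact Finset.single_le_sum (f := fun i => |z (i + 1)|) (fun _ _ => abs_nonneg _)
    (Finset.mem_range.2 (Nat.mod_lt _ hn))

lemma exists_abs_sbObs_le {n : ℕ} (hn : 1 ≤ n) (z : ℕ → ℝ) :
    ∃ M, 0 ≤ M ∧ ∀ J I t, |sbObs n z J I t| ≤ M := by
  obtain ⟨M, hM, h⟩ := exists_abs_periodicExt_le hn z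
  refine ⟨∑ _i : Fin n, M, Finset.sum_nonneg fun _ _ => hM, fun J I t => ?_⟩
  refine (Finset.abs_sum_le_sum_abs _ _).trans (Finset.sum_le_sum fun i _ => ?_)
  split_ifs
  · exact h _
  · simpa using hM

lemma isProbabilityMeasure_sbLaw {n : ℕ} (hn : 1 ≤ n) (ℓ : ℝ) :
    IsProbabilityMeasure (sbLaw n ℓ) := by
  have := isProbabilityMeasure_uniformOn_Icc hn
  unfold sbLaw; infer_instance

lemma integrable_sbObs {n : ℕ} (hn : 1 ≤ n) (ℓ : ℝ) (z : ℕ → ℝ) (t : ℕ) :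
    Integrable (fun w => sbObs n z w.1 w.2 t) (sbLaw n ℓ) := by
  have := isProbabilityMeasure_sbLaw hn ℓ
  obtain ⟨M, -, h⟩ := exists_abs_sbObs_le hn z
  exact Integrable.of_bound Measurable.of_discrete.aestronglyMeasurable M
    (ae_of_all _ fun w => h _ _ _)

lemma integrable_sbObs_mul {n : ℕ} (hn : 1 ≤ n) (ℓ : ℝ) (z : ℕ → ℝ) (s t : ℕ) :
    Integrable (fun w => sbObs n z w.1 w.2 s * sbObs n z w.1 w.2 t) (sbLaw n ℓ) := by
  have := isProbabilityMeasure_sbLaw hn ℓ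
  obtain ⟨M, hM, h⟩ := exists_abs_sbObs_le hn z
  refine Integrable.of_bound Measurable.of_discrete.aestronglyMeasurable (M * M)
    (ae_of_all _ fun w => ?_)
  rw [Real.norm_eq_abs, abs_mul]
  exact mul_le_mul (h _ _ _) (h _ _ _) (abs_nonneg _) hM

/-! ### Bootstrap moments of data with sample mean zero -/

section
variable {n : ℕ} (hn : 1 ≤ n) {ℓ : ℝ} (hℓ : 1 < ℓ) (z : ℕ → ℝ)
  (hz : ∑ i ∈ Finset.range n, z (i + 1) = 0)
include hn hz

lemma integral_sbObs_resampling (J : Fin n → ℕ) (t : ℕ) :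
    ∫ I, sbObs n z J I t ∂(Measure.pi fun _ : Fin n => uniformOn (Set.Icc 1 n)) = 0 := by
  have := isProbabilityMeasure_uniformOn_Icc hn
  unfold sbObs
  obtain ⟨M, hM, hb⟩ := exists_abs_periodicExt_le hn z
  rw [integral_finsetSum]
  · refine Finset.sum_eq_zero fun i _ => ?_
    split_ifs
    · have h := integral_pi_comp (uniformOn (Set.Icc 1 n)) i
        (fun k => periodicExt n z (k + (t - blockStart J i - 1)))
      rw [h, integral_periodicExt, hz, mul_zero]
    · simp
  · intro i _
    refine Integrable.of_bound Measurable.of_discrete.aestronglyMeasurable M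
      (ae_of_all _ fun w => ?_)
    split_ifs
    · exact hb _
    · simpa using hM

/-- For fixed lengths, expand both observations over blocks. Two distinct blocks have independent
starts and centred entries, so cross terms vanish; a block containing both places yields the
circular moment whatever its offset. -/
lemma integral_sbObs_mul_resampling (J : Fin n → ℕ) {s t : ℕ} (hst : s ≤ t) :
    ∫ I, sbObs n z J I s * sbObs n z J I t
        ∂(Measure.pi fun _ : Fin n => uniformOn (Set.Icc 1 n)) =
      ∑ i, (if blockStart J i < s ∧ t ≤ blockStart J i + J i then circularMoment n z (t - s)
        else 0) := by
  have := isProbabilityMeasure_uniformOn_Icc hn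
  obtain ⟨M, hM, hb⟩ := exists_abs_periodicExt_le hn z
  simp only [sbObs, Finset.sum_mul_sum]
  have hint : ∀ i j : Fin n, Integrable (fun I : Fin n → ℕ =>
      (if blockStart J i < s ∧ s ≤ blockStart J i + J i then
        periodicExt n z (I i + (s - blockStart J i - 1)) else 0) *
      (if blockStart J j < t ∧ t ≤ blockStart J j + J j then
        periodicExt n z (I j + (t - blockStart J j - 1)) else 0))
      (Measure.pi fun _ : Fin n => uniformOn (Set.Icc 1 n)) := by
    intro i j
    refine Integrable.of_bound Measurable.of_discrete.aestronglyMeasurable (M * M)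
      (ae_of_all _ fun w => ?_)
    rw [Real.norm_eq_abs, abs_mul]
    refine mul_le_mul ?_ ?_ (abs_nonneg _) hM
    · split_ifs
      · exact hb _
      · simpa using hM
    · split_ifs
      · exact hb _
      · simpa using hM
  rw [integral_finsetSum _ fun i _ => integrable_finsetSum _ fun j _ => hint i j]
  refine Finset.sum_congr rfl fun i _ => ?_
  rw [integral_finsetSum _ fun j _ => hint i j, Finset.sum_eq_single i]
  · by_cases h : blockStart J i < s ∧ t ≤ blockStart J i + J i
    · have h1 : blockStart J i < s ∧ s ≤ blockStart J i + J i := by omega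
      have h2 : blockStart J i < t ∧ t ≤ blockStart J i + J i := by omega
      simp only [h, h1, h2, and_self, if_true]
      have h3 : t - blockStart J i - 1 = s - blockStart J i - 1 + (t - s) := by omega
      rw [h3, ← integral_periodicExt_mul n z (s - blockStart J i - 1)]
      exact integral_pi_comp (uniformOn (Set.Icc 1 n)) i
        (fun k => periodicExt n z (k + (s - blockStart J i - 1)) *
          periodicExt n z (k + (s - blockStart J i - 1 + (t - s))))
    · rw [if_neg h]
      refine integral_eq_zero_of_ae (ae_of_all _ fun I => ?_)
      simp only [Pi.zero_apply]
      split_ifs <;> first | omega | simp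
  · intro j _ hj
    by_cases h1 : blockStart J i < s ∧ s ≤ blockStart J i + J i
    · by_cases h2 : blockStart J j < t ∧ t ≤ blockStart J j + J j
      · simp only [h1, h2, and_self, if_true]
        have h := integral_pi_mul (uniformOn (Set.Icc 1 n)) hj.symm
          (fun k => periodicExt n z (k + (s - blockStart J i - 1)))
          (fun k => periodicExt n z (k + (t - blockStart J j - 1)))
        rw [h, integral_periodicExt, hz]; simp
      · simp [h2]
    · simp [h1]
  · simp

lemma integral_sbObs (t : ℕ) : ∫ w, sbObs n z w.1 w.2 t ∂(sbLaw n ℓ) = 0 := by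
  have := isProbabilityMeasure_uniformOn_Icc hn
  have hi := integrable_sbObs hn ℓ z t
  rw [sbLaw] at hi ⊢
  rw [integral_prod _ hi]
  simp [integral_sbObs_resampling hn z hz]

include hℓ in
lemma integral_sbObs_mul {s t : ℕ} (hs : 1 ≤ s) (hst : s ≤ t) (ht : t ≤ n) :
    ∫ w, sbObs n z w.1 w.2 s * sbObs n z w.1 w.2 t ∂(sbLaw n ℓ) =
      (1 - ℓ⁻¹) ^ (t - s) * circularMoment n z (t - s) := by
  have := isProbabilityMeasure_uniformOn_Icc hn
  have hi := integrable_sbObs_mul hn ℓ z s t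
  rw [sbLaw] at hi ⊢
  rw [integral_prod _ hi]
  simp only [integral_sbObs_mul_resampling hn z hz _ hst]
  rw [integral_finsetSum]
  · rw [← sum_pi_blockLengthLaw_cover hℓ hs hst ht, Finset.sum_mul]
    refine Finset.sum_congr rfl fun i _ => ?_
    rw [← integral_indicator_one MeasurableSet.of_discrete, ← integral_mul_const]
    congr 1
    ext J
    simp [Set.indicator_apply]
  · intro i _
    refine Integrable.of_bound Measurable.of_discrete.aestronglyMeasurable
      |circularMoment n z (t - s)| (ae_of_all _ fun w => ?_)
    split_ifs <;> simp

include hℓ in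
lemma variance_sbMean_of_sum_eq_zero :
    Var[fun w => sbMean n z w.1 w.2; sbLaw n ℓ] = (n : ℝ)⁻¹ ^ 2 *
      ∑ i ∈ Finset.range n, ∑ j ∈ Finset.range n,
        (1 - ℓ⁻¹) ^ ((i : ℤ) - j).natAbs * circularMoment n z ((i : ℤ) - j).natAbs := by
  have := isProbabilityMeasure_sbLaw hn ℓ
  have hsum : ∀ J I, ∑ t ∈ Finset.Icc 1 n, sbObs n z J I t =
      ∑ i ∈ Finset.range n, sbObs n z J I (i + 1) := by
    intro J I
    rw [Finset.range_eq_Ico, Finset.sum_Ico_add' (fun i => sbObs n z J I i) 0 n 1]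
    congr 1
  rw [variance_of_integral_eq_zero Measurable.of_discrete.aemeasurable]
  · simp only [sbMean, mul_pow, hsum]
    rw [integral_const_mul]
    congr 1
    simp only [sq, Finset.sum_mul_sum]
    rw [integral_finsetSum _ fun i _ => integrable_finsetSum _ fun j _ =>
      integrable_sbObs_mul hn ℓ z _ _]
    refine Finset.sum_congr rfl fun i hi => ?_
    rw [integral_finsetSum _ fun j _ => integrable_sbObs_mul hn ℓ z _ _]
    refine Finset.sum_congr rfl fun j hj => ?_
    rw [Finset.mem_range] at hi hj
    rcases le_total i j with hij | hij
    · rw [integral_sbObs_mul hn hℓ z hz (by omega) (by omega) (by omega)]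
      have : ((i : ℤ) - j).natAbs = j + 1 - (i + 1) := by omega
      rw [this]
    · simp_rw [mul_comm (sbObs n z _ _ (i + 1))]
      rw [integral_sbObs_mul hn hℓ z hz (by omega) (by omega) (by omega)]
      have : ((i : ℤ) - j).natAbs = i + 1 - (j + 1) := by omega
      rw [this]
  · simp only [sbMean]
    rw [integral_const_mul, integral_finsetSum _ fun t _ => integrable_sbObs hn ℓ z t]
    simp [integral_sbObs hn z hz]

end

/-- Exactly one block indicator is on, so the constant is subtracted exactly once. This is what
reduces the bootstrap variance to data with sample mean zero. -/
lemma sbObs_sub_const {n : ℕ} (x : ℕ → ℝ) (c : ℝ) (J I : Fin n → ℕ) (hJ : ∀ i, 1 ≤ J i) {t : ℕ}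
    (h1 : 1 ≤ t) (ht : t ≤ n) :
    sbObs n (fun i => x i - c) J I t = sbObs n x J I t - c := by
  have h : c = ∑ i : Fin n, (if blockStart J i < t ∧ t ≤ blockStart J i + J i then c else 0) := by
    have := congrArg (c * ·) (sum_ite_blockStart J hJ h1 ht)
    simp only [Finset.mul_sum, mul_ite, mul_one, mul_zero] at this
    exact this.symm
  conv_rhs => rw [h]
  rw [sbObs, sbObs, ← Finset.sum_sub_distrib]
  refine Finset.sum_congr rfl fun i _ => ?_
  split_ifs <;> simp [periodicExt]

lemma variance_sbMean_sub_const {n : ℕ} (hn : 1 ≤ n) {ℓ : ℝ} (hℓ : 1 < ℓ) (x : ℕ → ℝ) (c : ℝ) :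
    Var[fun w => sbMean n (fun i => x i - c) w.1 w.2; sbLaw n ℓ] =
      Var[fun w => sbMean n x w.1 w.2; sbLaw n ℓ] := by
  have := isProbabilityMeasure_sbLaw hn ℓ
  have := isProbabilityMeasure_uniformOn_Icc hn
  rw [← variance_sub_const (X := fun w : (Fin n → ℕ) × (Fin n → ℕ) => sbMean n x w.1 w.2)
    Measurable.of_discrete.aestronglyMeasurable c]
  refine variance_congr ?_
  have h : ∀ᵐ w ∂(sbLaw n ℓ), ∀ i, 1 ≤ w.1 i :=
    Measure.quasiMeasurePreserving_fst.ae (pi_blockLengthLaw_one_le hℓ)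
  filter_upwards [h] with w hw
  have hn0 : (n : ℝ) ≠ 0 := by positivity
  rw [sbMean, sbMean, Finset.sum_congr rfl fun t ht =>
    sbObs_sub_const x c w.1 w.2 hw (Finset.mem_Icc.1 ht).1 (Finset.mem_Icc.1 ht).2]
  simp [Finset.sum_sub_distrib, mul_sub, hn0]

end StationaryBootstrap

namespace StationaryBootstrap

/-! ### Summation by diagonals -/

lemma sum_sum_range_eq_diagonals (n : ℕ) (G : ℕ → ℕ → ℝ) :
    ∑ i ∈ Finset.range n, ∑ j ∈ Finset.range n, G i j =
      ∑ i ∈ Finset.range n, G i i + ∑ k ∈ Finset.range n, ∑ i ∈ Finset.range (n - (k + 1)),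
        (G i (i + (k + 1)) + G (i + (k + 1)) i) := by
  induction n with
  | zero => simp
  | succ n ih =>
    -- Enlarging the square adds a last row and column. The diagonal at distance `k + 1` gains the
    -- pair `(n - (k + 1), n)` and its mirror image, which explains the reflected sum.
    have h1 : ∑ k ∈ Finset.range (n + 1), ∑ i ∈ Finset.range (n + 1 - (k + 1)),
        (G i (i + (k + 1)) + G (i + (k + 1)) i) =
        ∑ k ∈ Finset.range n, ∑ i ∈ Finset.range (n - (k + 1)),
          (G i (i + (k + 1)) + G (i + (k + 1)) i) +
        ∑ i ∈ Finset.range n, (G i n + G n i) := by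
      rw [Finset.sum_range_succ, ← Finset.sum_range_reflect (fun i => G i n + G n i) n,
        ← Finset.sum_add_distrib]
      simp only [Nat.sub_self, Finset.range_zero, Finset.sum_empty, add_zero]
      refine Finset.sum_congr rfl fun k hk => ?_
      rw [Finset.mem_range] at hk
      have h2 : n + 1 - (k + 1) = n - (k + 1) + 1 := by omega
      have h3 : n - 1 - k = n - (k + 1) := by omega
      have h4 : n - (k + 1) + (k + 1) = n := by omega
      rw [h2, Finset.sum_range_succ, h4, h3]
    rw [h1, Finset.sum_range_succ, Finset.sum_congr rfl fun i _ => Finset.sum_range_succ _ _,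
      Finset.sum_add_distrib, ih, Finset.sum_range_succ, Finset.sum_range_succ (fun i => G i i),
      Finset.sum_add_distrib]
    ring

/-- Unnormalized linear sample second moment at lag `k`. -/
noncomputable def lagSum (n : ℕ) (y : ℕ → ℝ) (k : ℕ) : ℝ :=
  ∑ i ∈ Finset.range (n - k), y (i + 1) * y (i + k + 1)

lemma sum_sum_natAbs_mul (n : ℕ) (w : ℕ → ℝ) (y : ℕ → ℝ) :
    ∑ i ∈ Finset.range n, ∑ j ∈ Finset.range n,
        w ((i : ℤ) - j).natAbs * (y (i + 1) * y (j + 1)) =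
      w 0 * lagSum n y 0 + 2 * ∑ k ∈ Finset.range n, w (k + 1) * lagSum n y (k + 1) := by
  rw [sum_sum_range_eq_diagonals]
  simp only [lagSum, Finset.mul_sum]
  congr 1
  · simp
  · refine Finset.sum_congr rfl fun k _ => Finset.sum_congr rfl fun i _ => ?_
    have h1 : ((i : ℤ) - ((i + (k + 1) : ℕ) : ℤ)).natAbs = k + 1 := by omega
    have h2 : (((i + (k + 1) : ℕ) : ℤ) - i).natAbs = k + 1 := by omega
    rw [h1, h2, ← add_assoc]
    ring

lemma sum_sum_natAbs (n : ℕ) (w : ℕ → ℝ) :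
    ∑ i ∈ Finset.range n, ∑ j ∈ Finset.range n, w ((i : ℤ) - j).natAbs =
      n * w 0 + 2 * ∑ k ∈ Finset.range n, ((n : ℝ) - (k + 1 : ℕ)) * w (k + 1) := by
  have h := sum_sum_natAbs_mul n w (fun _ => 1)
  simp only [lagSum, mul_one, Finset.sum_const, Finset.card_range, nsmul_eq_mul] at h
  rw [h]
  congr 1
  · simp [mul_comm]
  · congr 1
    refine Finset.sum_congr rfl fun k hk => ?_
    rw [Nat.cast_sub (Finset.mem_range.1 hk), mul_comm]

/-- The first `n - k` products do not wrap around; the last `k` do, and wrapped pairs are at linear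
distance `n - k`. -/
lemma circularMoment_eq_lagSum {n k : ℕ} (hk : k ≤ n) (y : ℕ → ℝ) :
    circularMoment n y k = (n : ℝ)⁻¹ * (lagSum n y k + lagSum n y (n - k)) := by
  have h : Finset.range n = Finset.range (n - k + k) := by congr 1; omega
  rw [circularMoment, h, Finset.sum_range_add, lagSum, lagSum]
  congr 2
  · refine Finset.sum_congr rfl fun i hi => ?_
    rw [Finset.mem_range] at hi
    rw [Nat.mod_eq_of_lt (by omega)]
  · have h2 : n - (n - k) = k := by omega
    rw [h2]
    refine Finset.sum_congr rfl fun i hi => ?_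
    rw [Finset.mem_range] at hi
    have h3 : n - k + i + k = i + n := by omega
    rw [h3, Nat.add_mod_right, Nat.mod_eq_of_lt (by omega), mul_comm]
    congr 2; omega

lemma circularMoment_sub_mean {n : ℕ} (hn : 1 ≤ n) (y : ℕ → ℝ) (k : ℕ) :
    circularMoment n (fun t => y t - (n : ℝ)⁻¹ * ∑ i ∈ Finset.range n, y (i + 1)) k =
      circularMoment n y k - ((n : ℝ)⁻¹ * ∑ i ∈ Finset.range n, y (i + 1)) ^ 2 := by
  have hn0 : (n : ℝ) ≠ 0 := by positivity
  set c := (n : ℝ)⁻¹ * ∑ i ∈ Finset.range n, y (i + 1) with hc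
  have hs : ∑ i ∈ Finset.range n, y (i + 1) = n * c := by rw [hc]; field_simp
  have hs' : ∑ i ∈ Finset.range n, y ((i + k) % n + 1) = n * c := by
    rw [← hs, ← sum_range_mod_add n k (fun i => y (i + 1))]
  simp only [circularMoment]
  have : ∀ i, (y (i + 1) - c) * (y ((i + k) % n + 1) - c) =
      y (i + 1) * y ((i + k) % n + 1) - c * y (i + 1) - c * y ((i + k) % n + 1) + c ^ 2 := by
    intro i; ring
  simp only [this, Finset.sum_add_distrib, Finset.sum_sub_distrib, ← Finset.mul_sum, hs, hs']
  simp
  field_simp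
  ring

/-! ### The estimators as quadratic forms -/

/-- The circularly symmetrized lag weights of the stationary bootstrap. -/
noncomputable def sbWeight (n : ℕ) (q : ℝ) (k : ℕ) : ℝ :=
  (n : ℝ)⁻¹ * (((n : ℝ) - k) * q ^ k + k * q ^ (n - k))

/-- The average `n⁻¹ ∑_{s,t} q^{|s-t|}` of the lag weights. -/
noncomputable def sbTotal (n : ℕ) (q : ℝ) : ℝ :=
  (n : ℝ)⁻¹ * ∑ i ∈ Finset.range n, ∑ j ∈ Finset.range n, q ^ ((i : ℤ) - j).natAbs

/-- Sum by lags. Lag `k` receives `(n - k) q^k` from its own circular moment and, from the wrapped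
half of the moment at lag `n - k`, the weight `k q^(n-k)`. -/
lemma sum_circularMoment {n : ℕ} (hn : 1 ≤ n) (q : ℝ) (y : ℕ → ℝ) :
    ∑ i ∈ Finset.range n, ∑ j ∈ Finset.range n,
        q ^ ((i : ℤ) - j).natAbs * circularMoment n y ((i : ℤ) - j).natAbs =
      ∑ i ∈ Finset.range n, ∑ j ∈ Finset.range n,
        sbWeight n q ((i : ℤ) - j).natAbs * (y (i + 1) * y (j + 1)) := by
  have hn0 : (n : ℝ) ≠ 0 := by positivity
  rw [sum_sum_natAbs n (fun k => q ^ k * circularMoment n y k), sum_sum_natAbs_mul]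
  have hLn : lagSum n y n = 0 := by simp [lagSum]
  -- Substitute `k ↦ n - k`. The end terms `g 0` and `g n` vanish, so the shift of the summation
  -- range by one is harmless.
  have hrefl : ∑ k ∈ Finset.range n, ((n : ℝ) - (k + 1 : ℕ)) * q ^ (k + 1) *
        lagSum n y (n - (k + 1)) =
      ∑ k ∈ Finset.range n, ((k + 1 : ℕ) : ℝ) * q ^ (n - (k + 1)) * lagSum n y (k + 1) := by
    set g : ℕ → ℝ := fun k => (k : ℝ) * q ^ (n - k) * lagSum n y k with hg
    have h1 := Finset.sum_range_succ g n
    have h2 := Finset.sum_range_succ' g n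
    have h0 : g 0 = 0 := by simp [hg]
    have hgn : g n = 0 := by simp [hg, hLn]
    rw [h1, h0, hgn, add_zero, add_zero] at h2
    rw [← h2, ← Finset.sum_range_reflect g n]
    refine Finset.sum_congr rfl fun k hk => ?_
    rw [Finset.mem_range] at hk
    have h3 : n - 1 - k = n - (k + 1) := by omega
    have h4 : n - (n - (k + 1)) = k + 1 := by omega
    simp only [hg, h3, h4]
    rw [Nat.cast_sub hk]
  congr 1
  · rw [circularMoment_eq_lagSum (Nat.zero_le n)]
    simp only [Nat.sub_zero, hLn, sbWeight]
    simp
    field_simp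
  · congr 1
    have h5 : ∀ k ∈ Finset.range n, ((n : ℝ) - (k + 1 : ℕ)) *
        (q ^ (k + 1) * circularMoment n y (k + 1)) =
        (n : ℝ)⁻¹ * (((n : ℝ) - (k + 1 : ℕ)) * q ^ (k + 1) * lagSum n y (k + 1)) +
        (n : ℝ)⁻¹ * (((n : ℝ) - (k + 1 : ℕ)) * q ^ (k + 1) * lagSum n y (n - (k + 1))) := by
      intro k hk
      rw [circularMoment_eq_lagSum (Finset.mem_range.1 hk)]
      ring
    rw [Finset.sum_congr rfl h5, Finset.sum_add_distrib, ← Finset.mul_sum _ _ (n : ℝ)⁻¹,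
      ← Finset.mul_sum _ _ (n : ℝ)⁻¹, hrefl, ← mul_add, ← Finset.sum_add_distrib, Finset.mul_sum]
    refine Finset.sum_congr rfl fun k _ => ?_
    rw [sbWeight]
    ring

/-- Centring is free, so centre at `m` and then at the remaining sample mean `c`, where the
covariance formula applies. Undoing the second centring costs `sbTotal * c²`, itself a quadratic
form with constant coefficients. The constant `m` is later the true mean. -/
lemma sbEstimator_eq {n : ℕ} (hn : 1 ≤ n) {ℓ : ℝ} (hℓ : 1 < ℓ) (x : ℕ → ℝ) (m : ℝ) :
    sbEstimator n ℓ x = ∑ i ∈ Finset.range n, ∑ j ∈ Finset.range n,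
      (n : ℝ)⁻¹ * (sbWeight n (1 - ℓ⁻¹) ((i : ℤ) - j).natAbs - (n : ℝ)⁻¹ * sbTotal n (1 - ℓ⁻¹)) *
        ((x (i + 1) - m) * (x (j + 1) - m)) := by
  have hn0 : (n : ℝ) ≠ 0 := by positivity
  set y : ℕ → ℝ := fun t => x t - m with hy
  set c := (n : ℝ)⁻¹ * ∑ i ∈ Finset.range n, y (i + 1) with hc
  have h0 : ∑ i ∈ Finset.range n, (y (i + 1) - c) = 0 := by
    rw [Finset.sum_sub_distrib, hc]; simp; field_simp; simp
  rw [sbEstimator, ← variance_sbMean_sub_const hn hℓ x m,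
    ← variance_sbMean_sub_const hn hℓ (fun i => x i - m) c,
    variance_sbMean_of_sum_eq_zero hn hℓ (fun i => y i - c) h0]
  set q := 1 - ℓ⁻¹
  have h1 : ∀ k, circularMoment n (fun i => y i - c) k = circularMoment n y k - c ^ 2 :=
    fun k => circularMoment_sub_mean hn y k
  have h5 : ∀ i j : ℕ, (n : ℝ)⁻¹ * (sbWeight n q ((i : ℤ) - j).natAbs - (n : ℝ)⁻¹ * sbTotal n q) *
      ((x (i + 1) - m) * (x (j + 1) - m)) =
      (n : ℝ)⁻¹ * sbWeight n q ((i : ℤ) - j).natAbs * ((x (i + 1) - m) * (x (j + 1) - m)) -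
      (n : ℝ)⁻¹ * ((n : ℝ)⁻¹ * sbTotal n q) * ((x (i + 1) - m) * (x (j + 1) - m)) := by
    intro i j; ring
  simp only [h5, h1]
  simp only [mul_sub (q ^ _), Finset.sum_sub_distrib, sum_circularMoment hn]
  have h2 : ∑ i ∈ Finset.range n, ∑ j ∈ Finset.range n, q ^ ((i : ℤ) - j).natAbs * c ^ 2 =
      n * sbTotal n q * c ^ 2 := by
    simp only [← Finset.sum_mul, sbTotal]; field_simp
  have h3 : ∑ i ∈ Finset.range n, ∑ j ∈ Finset.range n,
      (n : ℝ)⁻¹ * ((n : ℝ)⁻¹ * sbTotal n q) * ((x (i + 1) - m) * (x (j + 1) - m)) =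
      sbTotal n q * c ^ 2 := by
    simp only [← Finset.mul_sum, ← Finset.sum_mul]
    rw [hc, hy]; ring
  have h4 : ∑ i ∈ Finset.range n, ∑ j ∈ Finset.range n,
      (n : ℝ)⁻¹ * sbWeight n q ((i : ℤ) - j).natAbs * ((x (i + 1) - m) * (x (j + 1) - m)) =
      (n : ℝ)⁻¹ * ∑ i ∈ Finset.range n, ∑ j ∈ Finset.range n,
        sbWeight n q ((i : ℤ) - j).natAbs * (y (i + 1) * y (j + 1)) := by
    simp only [Finset.mul_sum, hy, mul_assoc]
  rw [h2, h3, h4]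
  field_simp

lemma memLp_uniformOn_Icc {b : ℕ} (hb : 1 ≤ b) (g : ℕ → ℝ) :
    MemLp g 2 (uniformOn (Set.Icc 1 b)) := by
  have := isProbabilityMeasure_uniformOn_Icc hb
  rw [memLp_two_iff_integrable_sq Measurable.of_discrete.aestronglyMeasurable]
  -- `g` may be unbounded on `ℕ`; its restriction to the support of the law is not.
  have h : Integrable (fun k => (Set.Icc 1 b).indicator (fun k => g k ^ 2) k)
      (uniformOn (Set.Icc 1 b)) := by
    refine Integrable.of_bound Measurable.of_discrete.aestronglyMeasurable
      (∑ i ∈ Finset.Icc 1 b, g i ^ 2) (ae_of_all _ fun k => ?_)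
    by_cases hk : k ∈ Set.Icc 1 b
    · rw [Set.indicator_of_mem hk, Real.norm_of_nonneg (sq_nonneg _)]
      exact Finset.single_le_sum (f := fun i => g i ^ 2) (fun _ _ => sq_nonneg _) (by simpa using hk)
    · rw [Set.indicator_of_notMem hk, norm_zero]
      exact Finset.sum_nonneg fun _ _ => sq_nonneg _
  refine h.congr ?_
  have h1 : ∀ᵐ k ∂(uniformOn (Set.Icc 1 b) : Measure ℕ), k ∈ Set.Icc 1 b :=
    (prob_compl_eq_zero_iff (by measurability)).2
      (uniformOn_self (Set.finite_Icc 1 b) ⟨1, by simp [hb]⟩)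
  filter_upwards [h1] with k hk
  rw [Set.indicator_of_mem hk]

lemma variance_uniformOn_Icc {b : ℕ} (hb : 1 ≤ b) (g : ℕ → ℝ) :
    Var[g; uniformOn (Set.Icc 1 b)] = (b : ℝ)⁻¹ * ∑ i ∈ Finset.range b, g (i + 1) ^ 2 -
      ((b : ℝ)⁻¹ * ∑ i ∈ Finset.range b, g (i + 1)) ^ 2 := by
  have := isProbabilityMeasure_uniformOn_Icc hb
  rw [variance_eq_sub (memLp_uniformOn_Icc hb g), integral_uniformOn_Icc b g]
  have h := integral_uniformOn_Icc b (g ^ 2)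
  simp only [Pi.pow_apply] at h ⊢
  rw [h]

lemma sum_range_mul_eq (b ℓ : ℕ) (f : ℕ → ℝ) :
    ∑ i ∈ Finset.range (b * ℓ), f i =
      ∑ u ∈ Finset.range b, ∑ v ∈ Finset.range ℓ, f (ℓ * u + v) := by
  induction b with
  | zero => simp
  | succ b ih => rw [Nat.succ_mul, Finset.sum_range_add, ih, Finset.sum_range_succ, mul_comm b ℓ]

/-- The bootstrap mean averages `b` independent draws, so its variance is determined by that of one
uniformly drawn block sum `g`. The mean of `g²` gives the common-block indicator, the squared mean
of `g` the constant `b⁻¹`. -/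
lemma nbbEstimator_eq {n ℓ : ℕ} (hℓ : 1 ≤ ℓ) (hb : 1 ≤ n / ℓ) (x : ℕ → ℝ) (m : ℝ) :
    nbbEstimator n ℓ x = ∑ i ∈ Finset.range (n / ℓ * ℓ), ∑ j ∈ Finset.range (n / ℓ * ℓ),
      ((n / ℓ * ℓ : ℕ) : ℝ)⁻¹ * ((if i / ℓ = j / ℓ then 1 else 0) - ((n / ℓ : ℕ) : ℝ)⁻¹) *
        ((x (i + 1) - m) * (x (j + 1) - m)) := by
  rw [nbbEstimator]
  set b := n / ℓ with hbdef
  have := isProbabilityMeasure_uniformOn_Icc hb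
  have hb0 : (b : ℝ) ≠ 0 := by positivity
  have hℓ0 : (ℓ : ℝ) ≠ 0 := by positivity
  set g : ℕ → ℝ := fun k => ∑ v ∈ Finset.range ℓ, (x (ℓ * (k - 1) + v + 1) - m) with hg
  have h1 : ∀ I : Fin b → ℕ, nbbMean ℓ b x I = ((b * ℓ : ℕ) : ℝ)⁻¹ * ∑ i, g (I i) + m := by
    intro I
    have h2 : ∀ k, ∑ v ∈ Finset.Icc 1 ℓ, x (ℓ * (k - 1) + v) = g k + ℓ * m := by
      intro k
      have : ∑ v ∈ Finset.Icc 1 ℓ, x (ℓ * (k - 1) + v) =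
          ∑ v ∈ Finset.range ℓ, x (ℓ * (k - 1) + v + 1) := by
        have h := Finset.sum_Ico_add' (fun v => x (ℓ * (k - 1) + v)) 0 ℓ 1
        rw [Finset.range_eq_Ico]
        exact h.symm
      rw [this]
      simp [hg, Finset.sum_sub_distrib]
    simp only [nbbMean, h2, Finset.sum_add_distrib]
    simp; field_simp
  have h3 : Var[fun I => nbbMean ℓ b x I; Measure.pi fun _ : Fin b => uniformOn (Set.Icc 1 b)] =
      ((b * ℓ : ℕ) : ℝ)⁻¹ ^ 2 * (b * Var[g; uniformOn (Set.Icc 1 b)]) := by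
    simp only [h1]
    rw [variance_add_const Measurable.of_discrete.aestronglyMeasurable, variance_const_mul]
    congr 1
    have h4 := variance_sum_pi (μ := fun _ : Fin b => (uniformOn (Set.Icc 1 b) : Measure ℕ))
      (X := fun _ => g) (fun _ => memLp_uniformOn_Icc hb g)
    have h5 : (∑ i, fun ω : Fin b → ℕ => g (ω i)) = fun I : Fin b → ℕ => ∑ i, g (I i) := by
      ext I; simp
    rw [h5] at h4
    rw [h4]; simp
  rw [h3, variance_uniformOn_Icc hb]
  have hg1 : ∀ i, g (i + 1) = ∑ v ∈ Finset.range ℓ, (x (ℓ * i + v + 1) - m) := fun i => by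
    simp [hg]
  have hsum : ∑ i ∈ Finset.range (b * ℓ), (x (i + 1) - m) = ∑ u ∈ Finset.range b, g (u + 1) := by
    rw [sum_range_mul_eq]; simp only [hg1]
  have hdiag : ∑ i ∈ Finset.range (b * ℓ), ∑ j ∈ Finset.range (b * ℓ),
      (if i / ℓ = j / ℓ then (1 : ℝ) else 0) * ((x (i + 1) - m) * (x (j + 1) - m)) =
      ∑ u ∈ Finset.range b, g (u + 1) ^ 2 := by
    rw [sum_range_mul_eq]
    have hdiv : ∀ u v, v < ℓ → (ℓ * u + v) / ℓ = u := fun u v hv => by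
      rw [Nat.mul_add_div (by omega), Nat.div_eq_of_lt hv, add_zero]
    refine Finset.sum_congr rfl fun u hu => ?_
    rw [sq, hg1, Finset.sum_mul]
    refine Finset.sum_congr rfl fun v hv => ?_
    rw [sum_range_mul_eq, Finset.sum_eq_single u]
    · rw [Finset.mul_sum]
      refine Finset.sum_congr rfl fun w hw => ?_
      rw [hdiv u v (Finset.mem_range.1 hv), hdiv u w (Finset.mem_range.1 hw)]; simp
    · intro u' _ hne
      refine Finset.sum_eq_zero fun w hw => ?_
      rw [hdiv u v (Finset.mem_range.1 hv), hdiv u' w (Finset.mem_range.1 hw), if_neg hne.symm,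
        zero_mul]
    · intro h; exact absurd hu h
  have h8 : ∀ i j : ℕ, ((b * ℓ : ℕ) : ℝ)⁻¹ * ((if i / ℓ = j / ℓ then 1 else 0) - (b : ℝ)⁻¹) *
      ((x (i + 1) - m) * (x (j + 1) - m)) =
      ((b * ℓ : ℕ) : ℝ)⁻¹ * (if i / ℓ = j / ℓ then 1 else 0) * ((x (i + 1) - m) * (x (j + 1) - m)) -
      ((b * ℓ : ℕ) : ℝ)⁻¹ * (b : ℝ)⁻¹ * ((x (i + 1) - m) * (x (j + 1) - m)) := by
    intro i j; ring
  simp only [h8, Finset.sum_sub_distrib]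
  have h6 : ∑ i ∈ Finset.range (b * ℓ), ∑ j ∈ Finset.range (b * ℓ),
      ((b * ℓ : ℕ) : ℝ)⁻¹ * (if i / ℓ = j / ℓ then 1 else 0) * ((x (i + 1) - m) * (x (j + 1) - m)) =
      ((b * ℓ : ℕ) : ℝ)⁻¹ * ∑ u ∈ Finset.range b, g (u + 1) ^ 2 := by
    rw [← hdiag]; simp only [Finset.mul_sum, mul_assoc]
  have h7 : ∑ i ∈ Finset.range (b * ℓ), ∑ j ∈ Finset.range (b * ℓ),
      ((b * ℓ : ℕ) : ℝ)⁻¹ * (b : ℝ)⁻¹ * ((x (i + 1) - m) * (x (j + 1) - m)) =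
      ((b * ℓ : ℕ) : ℝ)⁻¹ * (b : ℝ)⁻¹ * (∑ u ∈ Finset.range b, g (u + 1)) ^ 2 := by
    rw [← hsum, sq, Finset.sum_mul_sum]; simp only [Finset.mul_sum]
  rw [h6, h7]
  push_cast
  field_simp

end StationaryBootstrap

namespace StationaryBootstrap

/-! ### Fourth-order cumulants -/

/-- The fifteen set partitions of a four-element set. -/
def partitionsFour : List (Finset (Finset (Fin 4))) :=
  [{{0, 1, 2, 3}}, {{0, 1, 2}, {3}}, {{0, 1, 3}, {2}}, {{0, 2, 3}, {1}}, {{1, 2, 3}, {0}},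
    {{0, 1}, {2, 3}}, {{0, 2}, {1, 3}}, {{0, 3}, {1, 2}},
    {{0, 1}, {2}, {3}}, {{0, 2}, {1}, {3}}, {{0, 3}, {1}, {2}}, {{1, 2}, {0}, {3}},
    {{1, 3}, {0}, {2}}, {{2, 3}, {0}, {1}}, {{0}, {1}, {2}, {3}}]

lemma partitionsFour_nodup : partitionsFour.Nodup := by decide

/-- The symmetric reflexive relation on `Fin 4` with prescribed values off the diagonal. -/
def relFour (a b c d e f : Bool) (i j : Fin 4) : Bool :=
  (![![true, a, b, c], ![a, true, d, e], ![b, d, true, f], ![c, e, f, true]] i) j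

/-- A finite check over the 64 symmetric reflexive relations: the transitive ones are equivalences,
and their classes appear in the list. -/
lemma image_relFour_mem (a b c d e f : Bool)
    (h : ∀ i j k, relFour a b c d e f i j = true → relFour a b c d e f j k = true →
      relFour a b c d e f i k = true) :
    (Finset.univ.image fun i => Finset.univ.filter fun j => relFour a b c d e f i j = true) ∈
      partitionsFour := by
  revert a b c d e f
  decide +kernel

/-- Encode the partition by the relation of lying in the same part, which `relFour` recovers from
its six values above the diagonal. -/
lemma parts_mem_partitionsFour (π : Finpartition (Finset.univ : Finset (Fin 4))) :
    π.parts ∈ partitionsFour := by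
  have hr : ∀ i j, j ∈ π.part i ↔ π.part i = π.part j := fun i j => by
    rw [π.mem_part_iff_part_eq_part (Finset.mem_univ _) (Finset.mem_univ _), eq_comm]
  set R : Fin 4 → Fin 4 → Bool := fun i j => decide (π.part i = π.part j) with hR
  have hrel : ∀ i j, relFour (R 0 1) (R 0 2) (R 0 3) (R 1 2) (R 1 3) (R 2 3) i j = R i j := by
    intro i j
    have hs : ∀ i j, R i j = R j i := fun i j => by simp [hR, eq_comm]
    have hd : ∀ i, R i i = true := fun i => by simp [hR]
    fin_cases i <;> fin_cases j <;> simp [relFour, hs, hd] <;> first | rfl | exact hs _ _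
  have h := image_relFour_mem (R 0 1) (R 0 2) (R 0 3) (R 1 2) (R 1 3) (R 2 3) (by
    intro i j k
    simp only [hrel]
    simp only [hR, decide_eq_true_eq]
    exact Eq.trans)
  convert! h using 1
  ext B
  simp only [Finset.mem_image, Finset.mem_univ, true_and, hrel]
  simp only [hR, decide_eq_true_eq]
  have hp : ∀ i, (Finset.univ.filter fun j => π.part i = π.part j) = π.part i := fun i => by
    ext j; simp [hr]
  simp only [hp]
  constructor
  · intro hB
    obtain ⟨i, hi⟩ := π.nonempty_of_mem_parts hB
    exact ⟨i, π.part_eq_of_mem hB hi⟩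
  · rintro ⟨i, rfl⟩
    exact π.part_mem.2 (Finset.mem_univ _)

lemma exists_parts_eq {P : Finset (Finset (Fin 4))} (hP : P ∈ partitionsFour) :
    ∃ π : Finpartition (Finset.univ : Finset (Fin 4)), π.parts = P := by
  have h : ((∀ A ∈ P, ∀ B ∈ P, A ≠ B → A ∩ B = ∅) ∧ ∀ i, ∃ A ∈ P, i ∈ A) ∧ ∅ ∉ P := by
    simp only [partitionsFour, List.mem_cons, List.not_mem_nil, or_false] at hP
    rcases hP with rfl | rfl | rfl | rfl | rfl | rfl | rfl | rfl | rfl | rfl | rfl | rfl | rfl |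
      rfl | rfl <;> decide
  obtain ⟨⟨h1, h2'⟩, h3⟩ := h
  have h2 : P.sup id = Finset.univ :=
    Finset.eq_univ_iff_forall.2 fun i => Finset.mem_sup.2 (h2' i)
  refine ⟨⟨P, ?_, h2, h3⟩, rfl⟩
  rw [Finset.supIndep_iff_pairwiseDisjoint]
  intro A hA B hB hAB
  exact Finset.disjoint_iff_inter_eq_empty.2 (h1 A hA B hB hAB)

lemma sum_finpartition_four (g : Finset (Finset (Fin 4)) → ℝ) :
    ∑ π : Finpartition (Finset.univ : Finset (Fin 4)), g π.parts =
      (partitionsFour.map g).sum := by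
  have hinj : Function.Injective
      (fun π : Finpartition (Finset.univ : Finset (Fin 4)) => π.parts) :=
    fun π π' h => Finpartition.ext h
  rw [← Finset.sum_image (f := g) (g := fun π : Finpartition (Finset.univ : Finset (Fin 4)) =>
    π.parts) (fun _ _ _ _ h => hinj h)]
  have : (Finset.univ.image fun π : Finpartition (Finset.univ : Finset (Fin 4)) => π.parts) =
      partitionsFour.toFinset := by
    ext P
    simp only [Finset.mem_image, Finset.mem_univ, true_and, List.mem_toFinset]
    exact ⟨fun ⟨π, h⟩ => h ▸ parts_mem_partitionsFour π, exists_parts_eq⟩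
  rw [this, List.sum_toFinset _ partitionsFour_nodup]

variable {Ω : Type*} [MeasurableSpace Ω]

lemma jointCumulant_four (Y : Fin 4 → Ω → ℝ) (μ : Measure Ω) (E : Finset (Fin 4) → ℝ)
    (hE : ∀ B, E B = ∫ ω, ∏ i ∈ B, Y i ω ∂μ) :
    jointCumulant Y μ = E {0, 1, 2, 3}
      - (E {0, 1, 2} * E {3} + E {0, 1, 3} * E {2} + E {0, 2, 3} * E {1} + E {1, 2, 3} * E {0})
      - (E {0, 1} * E {2, 3} + E {0, 2} * E {1, 3} + E {0, 3} * E {1, 2})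
      + 2 * (E {0, 1} * E {2} * E {3} + E {0, 2} * E {1} * E {3} + E {0, 3} * E {1} * E {2}
        + E {1, 2} * E {0} * E {3} + E {1, 3} * E {0} * E {2} + E {2, 3} * E {0} * E {1})
      - 6 * (E {0} * E {1} * E {2} * E {3}) := by
  have h := sum_finpartition_four (fun P => (-1 : ℝ) ^ (P.card - 1) * ((P.card - 1).factorial : ℝ) *
      ∏ B ∈ P, E B)
  simp only [hE] at h
  rw [jointCumulant, h]
  simp only [← hE, partitionsFour, List.map_cons, List.map_nil, List.sum_cons, List.sum_nil]
  have hc : ∀ (P : Finset (Finset (Fin 4))) (A B : Finset (Fin 4)), P = {A, B} → A ≠ B →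
      (-1 : ℝ) ^ (P.card - 1) * ((P.card - 1).factorial : ℝ) * ∏ B ∈ P, E B = - (E A * E B) := by
    rintro _ A B rfl h
    rw [Finset.card_pair h, Finset.prod_pair h]; simp
  have hc3 : ∀ (P : Finset (Finset (Fin 4))) (A B C : Finset (Fin 4)), P = {A, B, C} → A ≠ B →
      A ≠ C → B ≠ C →
      (-1 : ℝ) ^ (P.card - 1) * ((P.card - 1).factorial : ℝ) * ∏ B ∈ P, E B =
        2 * (E A * E B * E C) := by
    rintro _ A B C rfl h1 h2 h3
    rw [Finset.card_eq_three.2 ⟨A, B, C, h1, h2, h3, rfl⟩, Finset.prod_insert (by simp [h1, h2]),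
      Finset.prod_pair h3]; simp; ring
  have hc4 : (-1 : ℝ) ^ (({{0}, {1}, {2}, {3}} : Finset (Finset (Fin 4))).card - 1) *
      ((({{0}, {1}, {2}, {3}} : Finset (Finset (Fin 4))).card - 1).factorial : ℝ) *
      ∏ B ∈ ({{0}, {1}, {2}, {3}} : Finset (Finset (Fin 4))), E B =
      - 6 * (E {0} * E {1} * E {2} * E {3}) := by
    rw [Finset.prod_insert (by decide), Finset.prod_insert (by decide),
      Finset.prod_insert (by decide), Finset.prod_singleton]
    have : ({{0}, {1}, {2}, {3}} : Finset (Finset (Fin 4))).card = 4 := by decide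
    rw [this]
    norm_num [Nat.factorial]
    ring
  rw [hc4, hc _ {0, 1, 2} {3} rfl (by decide), hc _ {0, 1, 3} {2} rfl (by decide),
    hc _ {0, 2, 3} {1} rfl (by decide), hc _ {1, 2, 3} {0} rfl (by decide),
    hc _ {0, 1} {2, 3} rfl (by decide), hc _ {0, 2} {1, 3} rfl (by decide),
    hc _ {0, 3} {1, 2} rfl (by decide),
    hc3 _ {0, 1} {2} {3} rfl (by decide) (by decide) (by decide),
    hc3 _ {0, 2} {1} {3} rfl (by decide) (by decide) (by decide),
    hc3 _ {0, 3} {1} {2} rfl (by decide) (by decide) (by decide),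
    hc3 _ {1, 2} {0} {3} rfl (by decide) (by decide) (by decide),
    hc3 _ {1, 3} {0} {2} rfl (by decide) (by decide) (by decide),
    hc3 _ {2, 3} {0} {1} rfl (by decide) (by decide) (by decide)]
  simp only [Finset.card_singleton, Finset.prod_singleton]
  simp
  ring

lemma MemLp.mul_four {μ : Measure Ω} {f g : Ω → ℝ} (hf : MemLp f 4 μ) (hg : MemLp g 4 μ) :
    MemLp (fun ω => f ω * g ω) 2 μ := by
  have : ENNReal.HolderTriple 4 4 2 := ⟨by
    have : (4 : ENNReal) = 2 * 2 := by norm_num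
    rw [this, ENNReal.mul_inv (by simp) (by simp), ← mul_add, ENNReal.inv_two_add_inv_two, mul_one]⟩
  exact hg.mul' hf

/-- Both sides are expanded into raw mixed moments, where they agree as polynomials. A common mean
`m` is enough here, because the process is stationary. -/
lemma jointCumulant_four_eq {μ : Measure Ω} [IsProbabilityMeasure μ] {A B C D : Ω → ℝ}
    (hA : MemLp A 4 μ) (hB : MemLp B 4 μ) (hC : MemLp C 4 μ) (hD : MemLp D 4 μ) {m : ℝ}
    (mA : ∫ ω, A ω ∂μ = m) (mB : ∫ ω, B ω ∂μ = m) (mC : ∫ ω, C ω ∂μ = m)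
    (mD : ∫ ω, D ω ∂μ = m) :
    jointCumulant ![A, B, C, D] μ =
      ∫ ω, (A ω - m) * (B ω - m) * ((C ω - m) * (D ω - m)) ∂μ
      - (∫ ω, (A ω - m) * (B ω - m) ∂μ) * (∫ ω, (C ω - m) * (D ω - m) ∂μ)
      - (∫ ω, (A ω - m) * (C ω - m) ∂μ) * (∫ ω, (B ω - m) * (D ω - m) ∂μ)
      - (∫ ω, (A ω - m) * (D ω - m) ∂μ) * (∫ ω, (B ω - m) * (C ω - m) ∂μ) := by
  have h42 : ∀ {f : Ω → ℝ}, MemLp f 4 μ → MemLp f 2 μ := fun h => h.mono_exponent (by norm_num)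
  have h1 : ∀ {f : Ω → ℝ}, MemLp f 4 μ → Integrable f μ := fun h =>
    h.integrable (by norm_num)
  have h2 : ∀ {f g : Ω → ℝ}, MemLp f 4 μ → MemLp g 4 μ → Integrable (fun ω => f ω * g ω) μ :=
    fun hf hg => (MemLp.mul_four hf hg).integrable (by norm_num)
  have h3 : ∀ {f g h : Ω → ℝ}, MemLp f 4 μ → MemLp g 4 μ → MemLp h 4 μ →
      Integrable (fun ω => f ω * g ω * h ω) μ :=
    fun hf hg hh => (MemLp.mul_four hf hg).integrable_mul (h42 hh)
  have h4 : Integrable (fun ω => A ω * B ω * (C ω * D ω)) μ :=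
    (MemLp.mul_four hA hB).integrable_mul (MemLp.mul_four hC hD)
  -- These rules carry integrability along with the value, so a long linear combination is
  -- integrated by a single term.
  have iadd : ∀ {f g : Ω → ℝ} {a b : ℝ}, (Integrable f μ ∧ ∫ ω, f ω ∂μ = a) →
      (Integrable g μ ∧ ∫ ω, g ω ∂μ = b) →
      (Integrable (fun ω => f ω + g ω) μ ∧ ∫ ω, (f ω + g ω) ∂μ = a + b) := by
    rintro f g _ _ ⟨hf, rfl⟩ ⟨hg, rfl⟩
    exact ⟨hf.add hg, integral_add hf hg⟩
  have isub : ∀ {f g : Ω → ℝ} {a b : ℝ}, (Integrable f μ ∧ ∫ ω, f ω ∂μ = a) →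
      (Integrable g μ ∧ ∫ ω, g ω ∂μ = b) →
      (Integrable (fun ω => f ω - g ω) μ ∧ ∫ ω, (f ω - g ω) ∂μ = a - b) := by
    rintro f g _ _ ⟨hf, rfl⟩ ⟨hg, rfl⟩
    exact ⟨hf.sub hg, integral_sub hf hg⟩
  have imul : ∀ (c : ℝ) {f : Ω → ℝ} {a : ℝ}, (Integrable f μ ∧ ∫ ω, f ω ∂μ = a) →
      (Integrable (fun ω => c * f ω) μ ∧ ∫ ω, c * f ω ∂μ = c * a) := by
    rintro c f _ ⟨hf, rfl⟩
    exact ⟨hf.const_mul c, integral_const_mul c f⟩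
  have iconst : ∀ c : ℝ, Integrable (fun _ : Ω => c) μ ∧ ∫ _, c ∂μ = c := fun c =>
    ⟨integrable_const c, by simp⟩
  have hcov : ∀ {f g : Ω → ℝ}, MemLp f 4 μ → MemLp g 4 μ → ∫ ω, f ω ∂μ = m → ∫ ω, g ω ∂μ = m →
      ∫ ω, (f ω - m) * (g ω - m) ∂μ = ∫ ω, f ω * g ω ∂μ - m ^ 2 := by
    intro f g hf hg mf mg
    have : ∀ ω, (f ω - m) * (g ω - m) = f ω * g ω - m * f ω - m * g ω + m ^ 2 := fun ω => by ring
    simp only [this]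
    refine (iadd (isub (isub ⟨h2 hf hg, rfl⟩ (imul m ⟨h1 hf, mf⟩)) (imul m ⟨h1 hg, mg⟩))
      (iconst _)).2.trans ?_
    ring
  have hfour : ∫ ω, (A ω - m) * (B ω - m) * ((C ω - m) * (D ω - m)) ∂μ =
      ∫ ω, A ω * B ω * (C ω * D ω) ∂μ
      - m * (∫ ω, A ω * B ω * C ω ∂μ + ∫ ω, A ω * B ω * D ω ∂μ + ∫ ω, A ω * C ω * D ω ∂μ
        + ∫ ω, B ω * C ω * D ω ∂μ)
      + m ^ 2 * (∫ ω, A ω * B ω ∂μ + ∫ ω, A ω * C ω ∂μ + ∫ ω, A ω * D ω ∂μ + ∫ ω, B ω * C ω ∂μ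
        + ∫ ω, B ω * D ω ∂μ + ∫ ω, C ω * D ω ∂μ)
      - m ^ 3 * (m + m + m + m) + m ^ 4 := by
    have : ∀ ω, (A ω - m) * (B ω - m) * ((C ω - m) * (D ω - m)) =
      A ω * B ω * (C ω * D ω)
      - m * (A ω * B ω * C ω + A ω * B ω * D ω + A ω * C ω * D ω + B ω * C ω * D ω)
      + m ^ 2 * (A ω * B ω + A ω * C ω + A ω * D ω + B ω * C ω + B ω * D ω + C ω * D ω)
      - m ^ 3 * (A ω + B ω + C ω + D ω) + m ^ 4 := fun ω => by ring
    simp only [this]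
    exact (iadd (isub (iadd (isub ⟨h4, rfl⟩ (imul m (iadd (iadd (iadd ⟨h3 hA hB hC, rfl⟩
      ⟨h3 hA hB hD, rfl⟩) ⟨h3 hA hC hD, rfl⟩) ⟨h3 hB hC hD, rfl⟩))) (imul (m ^ 2) (iadd (iadd (iadd
      (iadd (iadd ⟨h2 hA hB, rfl⟩ ⟨h2 hA hC, rfl⟩) ⟨h2 hA hD, rfl⟩) ⟨h2 hB hC, rfl⟩)
      ⟨h2 hB hD, rfl⟩) ⟨h2 hC hD, rfl⟩))) (imul (m ^ 3) (iadd (iadd (iadd ⟨h1 hA, mA⟩ ⟨h1 hB, mB⟩)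
      ⟨h1 hC, mC⟩) ⟨h1 hD, mD⟩))) (iconst (m ^ 4))).2
  rw [jointCumulant_four _ μ _ (fun _ => rfl), hfour, hcov hA hB mA mB, hcov hC hD mC mD,
    hcov hA hC mA mC, hcov hB hD mB mD, hcov hA hD mA mD, hcov hB hC mB mC]
  have p4 : ∀ ω, ∏ i ∈ ({0, 1, 2, 3} : Finset (Fin 4)), ![A, B, C, D] i ω =
      A ω * B ω * (C ω * D ω) := fun ω => by
    rw [Finset.prod_insert (by decide), Finset.prod_insert (by decide),
      Finset.prod_insert (by decide), Finset.prod_singleton]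
    simp; ring
  have p3 : ∀ i j k : Fin 4, i ≠ j → i ≠ k → j ≠ k → ∀ ω,
      ∏ l ∈ ({i, j, k} : Finset (Fin 4)), ![A, B, C, D] l ω =
      ![A, B, C, D] i ω * ![A, B, C, D] j ω * ![A, B, C, D] k ω := fun i j k h1 h2 h3 ω => by
    rw [Finset.prod_insert (by simp [h1, h2]), Finset.prod_pair h3, mul_assoc]
  have p2 : ∀ i j : Fin 4, i ≠ j → ∀ ω, ∏ l ∈ ({i, j} : Finset (Fin 4)), ![A, B, C, D] l ω =
      ![A, B, C, D] i ω * ![A, B, C, D] j ω := fun i j h1 ω => Finset.prod_pair h1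
  have v0 : ![A, B, C, D] 0 = A := rfl
  have v1 : ![A, B, C, D] 1 = B := rfl
  have v2 : ![A, B, C, D] 2 = C := rfl
  have v3 : ![A, B, C, D] 3 = D := rfl
  simp only [p4, p3 0 1 2 (by decide) (by decide) (by decide),
    p3 0 1 3 (by decide) (by decide) (by decide), p3 0 2 3 (by decide) (by decide) (by decide),
    p3 1 2 3 (by decide) (by decide) (by decide), p2 0 1 (by decide), p2 0 2 (by decide),
    p2 0 3 (by decide), p2 1 2 (by decide), p2 1 3 (by decide), p2 2 3 (by decide),
    Finset.prod_singleton, v0, v1, v2, v3, mA, mB, mC, mD]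
  ring

end StationaryBootstrap

namespace StationaryBootstrap

/-! ### Square sums of finitely supported arrays -/

section SquareSum

variable {G : Type*}

/-- The squared `ℓ²` norm. -/
noncomputable def sqSum (f : G → ℝ) : ℝ := ∑' x, f x ^ 2

lemma summable_of_support_finite {f g : G → ℝ} (hf : f.support.Finite)
    (h : ∀ x, f x = 0 → g x = 0) : Summable g :=
  summable_of_hasFiniteSupport (hf.subset fun x hx => fun h0 => hx (h x h0))

lemma support_sub_finite {f g : G → ℝ} (hf : f.support.Finite) (hg : g.support.Finite) :
    (fun x => f x - g x).support.Finite :=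
  (hf.union hg).subset (Function.support_sub f g)

lemma summable_sq {f : G → ℝ} (hf : f.support.Finite) : Summable fun x => f x ^ 2 :=
  summable_of_support_finite hf fun x h => by simp [h]

lemma sqSum_nonneg (f : G → ℝ) : 0 ≤ sqSum f := tsum_nonneg fun _ => sq_nonneg _

lemma sqSum_sub_comm (f g : G → ℝ) :
    sqSum (fun x => f x - g x) = sqSum fun x => g x - f x := by
  simp only [sqSum]; congr 1; ext x; ring

lemma sqSum_sub_le {f g h : G → ℝ} (hf : f.support.Finite) (hg : g.support.Finite)
    (hh : h.support.Finite) :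
    sqSum (fun x => f x - h x) ≤
      2 * sqSum (fun x => f x - g x) + 2 * sqSum (fun x => g x - h x) := by
  have h1 := summable_sq (support_sub_finite hf hg)
  have h2 := summable_sq (support_sub_finite hg hh)
  simp only [sqSum]
  rw [← tsum_mul_left, ← tsum_mul_left, ← (h1.mul_left 2).tsum_add (h2.mul_left 2)]
  refine (summable_sq (support_sub_finite hf hh)).tsum_le_tsum (fun x => ?_)
    ((h1.mul_left 2).add (h2.mul_left 2))
  nlinarith [sq_nonneg (f x - g x - (g x - h x))]

lemma sqSum_sub_le' {f g : G → ℝ} (hf : f.support.Finite) (hg : g.support.Finite) :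
    sqSum (fun x => f x - g x) ≤ 2 * sqSum f + 2 * sqSum g := by
  have h := sqSum_sub_le (f := f) (g := fun _ => 0) (h := g) hf (by simp) hg
  simpa [sqSum] using h

variable {c : ℕ → ℝ} {a : ℕ → G → ℝ}

/-- Expand the square of `a' + (a - a')`; Cauchy–Schwarz bounds the cross term by the geometric mean
of a bounded and a vanishing quantity. -/
lemma tendsto_sqSum_of_sub {a' : ℕ → G → ℝ} (hf : ∀ᶠ n in atTop, (a n).support.Finite)
    (hf' : ∀ᶠ n in atTop, (a' n).support.Finite)
    (hN : Tendsto (fun n => c n * sqSum (a' n)) atTop (𝓝 1))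
    (he : Tendsto (fun n => c n * sqSum (fun x => a n x - a' n x)) atTop (𝓝 0)) :
    Tendsto (fun n => c n * sqSum (a n)) atTop (𝓝 1) := by
  have hcs : ∀ᶠ n in atTop, (c n * ∑' x, a' n x * (a n x - a' n x)) ^ 2 ≤
      (c n * sqSum (a' n)) * (c n * sqSum (fun x => a n x - a' n x)) := by
    filter_upwards [hf, hf'] with n h h'
    classical
    have hcs := Finset.sum_mul_sq_le_sq_mul_sq (h'.toFinset ∪ h.toFinset) (a' n)
      (fun x => a n x - a' n x)
    have h0 : ∀ x ∉ h'.toFinset ∪ h.toFinset, a' n x = 0 ∧ a n x = 0 := fun x hx => by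
      simpa [not_or] using hx
    have e1 : ∑' x, a' n x * (a n x - a' n x) = _ :=
      tsum_eq_sum (s := h'.toFinset ∪ h.toFinset) fun x hx => by simp [h0 x hx]
    have e2 : ∑' x, a' n x ^ 2 = _ :=
      tsum_eq_sum (s := h'.toFinset ∪ h.toFinset) fun x hx => by simp [h0 x hx]
    have e3 : ∑' x, (a n x - a' n x) ^ 2 = _ :=
      tsum_eq_sum (s := h'.toFinset ∪ h.toFinset) fun x hx => by simp [h0 x hx]
    rw [← e1, ← e2, ← e3] at hcs
    have := mul_le_mul_of_nonneg_left hcs (sq_nonneg (c n))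
    simp only [sqSum]
    nlinarith
  have hcross : Tendsto (fun n => c n * ∑' x, a' n x * (a n x - a' n x)) atTop (𝓝 0) := by
    have h1 := hN.mul he
    rw [mul_zero] at h1
    have h2 : Tendsto (fun n => (c n * ∑' x, a' n x * (a n x - a' n x)) ^ 2) atTop (𝓝 0) :=
      tendsto_of_tendsto_of_tendsto_of_le_of_le' tendsto_const_nhds h1
        (Eventually.of_forall fun _ => sq_nonneg _) hcs
    have h3 := h2.sqrt
    simp only [Real.sqrt_sq_eq_abs, Real.sqrt_zero] at h3
    exact (tendsto_zero_iff_abs_tendsto_zero _).2 h3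
  have h := (hN.add (hcross.const_mul 2)).add he
  rw [mul_zero, add_zero, add_zero] at h
  refine h.congr' ?_
  filter_upwards [hf, hf'] with n h h'
  have s1 := summable_sq h'
  have s2 : Summable fun x => a' n x * (a n x - a' n x) :=
    summable_of_support_finite h' fun x hx => by simp [hx]
  have s3 := summable_sq (support_sub_finite h h')
  have : sqSum (a n) = sqSum (a' n) + 2 * ∑' x, a' n x * (a n x - a' n x) +
      sqSum (fun x => a n x - a' n x) := by
    simp only [sqSum]
    rw [← tsum_mul_left, ← s1.tsum_add (s2.mul_left 2), ← (s1.add (s2.mul_left 2)).tsum_add s3]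
    congr 1; ext x; ring
  rw [this]; ring

variable [AddCommGroup G]

lemma support_shift_finite {f : G → ℝ} (hf : f.support.Finite) (w : G) :
    (fun x => f (x + w)).support.Finite :=
  hf.preimage (f := fun x => x + w) (add_left_injective w).injOn

lemma sqSum_shift (f : G → ℝ) (w : G) : sqSum (fun x => f (x + w)) = sqSum f :=
  (Equiv.addRight w).tsum_eq fun x => f x ^ 2

/-- Polarisation, with the shift preserving the norm. Near invariance under `w` thus means that the
autocorrelation at `w` is nearly the full squared norm. -/
lemma tsum_mul_shift {f : G → ℝ} (hf : f.support.Finite) (w : G) :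
    ∑' x, f x * f (x + w) = sqSum f - sqSum (fun x => f x - f (x + w)) / 2 := by
  have h1 := summable_sq hf
  have h2 := summable_sq (support_shift_finite hf w)
  have h3 : Summable fun x => f x * f (x + w) :=
    summable_of_support_finite hf fun x h => by simp [h]
  have h4 : sqSum (fun x => f x - f (x + w)) =
      sqSum f + sqSum (fun x => f (x + w)) - 2 * ∑' x, f x * f (x + w) := by
    simp only [sqSum]
    rw [← tsum_mul_left, ← h1.tsum_add h2, ← (h1.add h2).tsum_sub (h3.mul_left 2)]
    congr 1; ext x; ring
  rw [h4, sqSum_shift]; ring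

lemma abs_tsum_mul_shift_le {f : G → ℝ} (hf : f.support.Finite) (w : G) :
    |∑' x, f x * f (x + w)| ≤ sqSum f := by
  have h1 := sqSum_nonneg fun x => f x - f (x + w)
  have h2 := sqSum_sub_le' hf (support_shift_finite hf w)
  rw [sqSum_shift] at h2
  rw [tsum_mul_shift hf, abs_le]
  constructor <;> linarith

/-- Group the pairs by their difference `w = y - x`. -/
lemma sum_sum_mul_eq_tsum {f ρ : G → ℝ} {B : Finset G}
    (hB : ∀ x ∉ B, f x = 0) :
    ∑ x ∈ B, ∑ y ∈ B, f x * f y * ρ (y - x) = ∑' w, ρ w * ∑' x, f x * f (x + w) := by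
  have hf : f.support.Finite := B.finite_toSet.subset fun x hx => by
    by_contra h; exact hx (hB x h)
  have h1 : ∀ x, ∑ y ∈ B, f x * f y * ρ (y - x) = ∑' w, f x * f (x + w) * ρ w := by
    intro x
    have e : ∑' y, f x * f y * ρ (y - x) = _ :=
      tsum_eq_sum (s := B) (fun y hy => by rw [hB y hy]; ring)
    rw [← e, ← (Equiv.addLeft x).tsum_eq]
    simp
  have h2 : ∀ x, Summable fun w => f x * f (x + w) * ρ w := by
    intro x
    refine summable_of_support_finite (f := fun w => f (w + x)) (support_shift_finite hf x)
      fun w hw => ?_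
    rw [add_comm] at hw; simp [hw]
  simp only [h1]
  rw [← Summable.tsum_finsetSum fun x _ => h2 x]
  congr 1; ext w
  rw [tsum_eq_sum (s := B) fun x hx => by rw [hB x hx]; ring, Finset.mul_sum]
  exact Finset.sum_congr rfl fun x _ => by ring

/-- After grouping by differences, the factor of `ρ w` is a normalised autocorrelation. It tends to
1 for each fixed `w` by `tsum_mul_shift`, and its modulus is eventually at most 2 for all `w` at
once, so dominated convergence applies. -/
lemma tendsto_sum_sum_mul {ρ : G → ℝ} (hρ : Summable ρ) {B : ℕ → Finset G}
    (hB : ∀ᶠ n in atTop, ∀ x ∉ B n, a n x = 0) (hc : ∀ᶠ n in atTop, 0 ≤ c n)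
    (hN : Tendsto (fun n => c n * sqSum (a n)) atTop (𝓝 1))
    (hS : ∀ w, Tendsto (fun n => c n * sqSum (fun x => a n x - a n (x + w))) atTop (𝓝 0)) :
    Tendsto (fun n => c n * ∑ x ∈ B n, ∑ y ∈ B n, a n x * a n y * ρ (y - x)) atTop
      (𝓝 (∑' w, ρ w)) := by
  have hf : ∀ᶠ n in atTop, (a n).support.Finite := hB.mono fun n h =>
    (B n).finite_toSet.subset fun x hx => by by_contra h'; exact hx (h x h')
  have key : Tendsto (fun n => ∑' w, c n * (ρ w * ∑' x, a n x * a n (x + w))) atTop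
      (𝓝 (∑' w, ρ w)) := by
    refine tendsto_tsum_of_dominated_convergence (bound := fun w => 2 * |ρ w|)
      (hρ.abs.mul_left 2) (fun w => ?_) ?_
    · have h := ((hN.sub ((hS w).div_const 2)).const_mul (ρ w))
      rw [zero_div, sub_zero, mul_one] at h
      refine h.congr' ?_
      filter_upwards [hf] with n hn
      rw [tsum_mul_shift hn]; ring
    · filter_upwards [hf, hc, hN.eventually (eventually_le_nhds (show (1 : ℝ) < 2 by norm_num))]
        with n h1 h2 h3 w
      rw [Real.norm_eq_abs, abs_mul, abs_mul, abs_of_nonneg h2]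
      have := mul_le_mul_of_nonneg_left (abs_tsum_mul_shift_le h1 w) h2
      calc c n * (|ρ w| * |∑' x, a n x * a n (x + w)|)
          = (c n * |∑' x, a n x * a n (x + w)|) * |ρ w| := by ring
        _ ≤ 2 * |ρ w| := by gcongr; linarith
  refine key.congr' ?_
  filter_upwards [hB] with n hn
  rw [tsum_mul_left, ← sum_sum_mul_eq_tsum hn]

lemma tendsto_sqSum_shift_of_sub {a' : ℕ → G → ℝ} (hc : ∀ᶠ n in atTop, 0 ≤ c n)
    (hf : ∀ᶠ n in atTop, (a n).support.Finite)
    (hf' : ∀ᶠ n in atTop, (a' n).support.Finite) (w : G)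
    (hS : Tendsto (fun n => c n * sqSum (fun x => a' n x - a' n (x + w))) atTop (𝓝 0))
    (he : Tendsto (fun n => c n * sqSum (fun x => a n x - a' n x)) atTop (𝓝 0)) :
    Tendsto (fun n => c n * sqSum (fun x => a n x - a n (x + w))) atTop (𝓝 0) := by
  -- Replace `a` by `a'` on both sides of the difference. Two uses of `sqSum_sub_le` give `2 e + 2
  -- (2 S + 2 e) = 6 e + 4 S`.
  have h := (he.const_mul 6).add (hS.const_mul 4)
  rw [mul_zero, mul_zero, add_zero] at h
  refine tendsto_of_tendsto_of_tendsto_of_le_of_le' tendsto_const_nhds h ?_ ?_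
  · filter_upwards [hc] with n hn using mul_nonneg hn (sqSum_nonneg _)
  · filter_upwards [hc, hf, hf'] with n hn h h'
    have h1 := sqSum_sub_le h h' (support_shift_finite h w)
    have h2 := sqSum_sub_le h' (support_shift_finite h' w) (support_shift_finite h w)
    have h3 := sqSum_shift (fun x => a' n x - a n x) w
    rw [sqSum_sub_comm (a' n) (a n)] at h3
    rw [h3] at h2
    nlinarith

lemma tendsto_sqSum_shift_add (hc : ∀ᶠ n in atTop, 0 ≤ c n)
    (hf : ∀ᶠ n in atTop, (a n).support.Finite) {v w : G}
    (hv : Tendsto (fun n => c n * sqSum (fun x => a n x - a n (x + v))) atTop (𝓝 0))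
    (hw : Tendsto (fun n => c n * sqSum (fun x => a n x - a n (x + w))) atTop (𝓝 0)) :
    Tendsto (fun n => c n * sqSum (fun x => a n x - a n (x + (v + w)))) atTop (𝓝 0) := by
  have h := (hv.const_mul 2).add (hw.const_mul 2)
  rw [mul_zero, add_zero] at h
  refine tendsto_of_tendsto_of_tendsto_of_le_of_le' tendsto_const_nhds h ?_ ?_
  · filter_upwards [hc] with n hn using mul_nonneg hn (sqSum_nonneg _)
  · filter_upwards [hc, hf] with n hn h
    have h1 := sqSum_sub_le h (support_shift_finite h v) (support_shift_finite h (v + w))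
    have h3 := sqSum_shift (fun x => a n x - a n (x + w)) v
    simp only [add_assoc] at h3
    rw [h3] at h1
    nlinarith

lemma tendsto_sqSum_shift_neg {v : G}
    (hv : Tendsto (fun n => c n * sqSum (fun x => a n x - a n (x + v))) atTop (𝓝 0)) :
    Tendsto (fun n => c n * sqSum (fun x => a n x - a n (x + -v))) atTop (𝓝 0) := by
  refine hv.congr fun n => ?_
  rw [← sqSum_shift (fun x => a n x - a n (x + -v)) v, sqSum_sub_comm]
  simp

end SquareSum

/-- The shifts under which the arrays are asymptotically invariant form a subgroup of `ℤ²`. It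
contains `(1, 0)`, hence `(0, 1)` by symmetry of the arrays, and these two generate. -/
lemma tendsto_sqSum_shift {c : ℕ → ℝ} {a : ℕ → ℤ × ℤ → ℝ} (hc : ∀ᶠ n in atTop, 0 ≤ c n)
    (hf : ∀ᶠ n in atTop, (a n).support.Finite)
    (hsymm : ∀ n i j, a n (i, j) = a n (j, i))
    (h1 : Tendsto (fun n => c n * sqSum (fun x => a n x - a n (x + (1, 0)))) atTop (𝓝 0))
    (w : ℤ × ℤ) :
    Tendsto (fun n => c n * sqSum (fun x => a n x - a n (x + w))) atTop (𝓝 0) := by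
  let H : AddSubgroup (ℤ × ℤ) :=
    { carrier := {w | Tendsto (fun n => c n * sqSum (fun x => a n x - a n (x + w))) atTop (𝓝 0)}
      add_mem' := tendsto_sqSum_shift_add hc hf
      zero_mem' := by simp [sqSum]
      neg_mem' := tendsto_sqSum_shift_neg }
  have h10 : ((1, 0) : ℤ × ℤ) ∈ H := h1
  have h01 : ((0, 1) : ℤ × ℤ) ∈ H := by
    refine h1.congr fun n => ?_
    congr 1
    rw [sqSum, ← (Equiv.prodComm ℤ ℤ).tsum_eq]
    congr 1; ext ⟨i, j⟩
    simp [hsymm n j, hsymm n (j + 1)]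
  have : w = w.1 • ((1, 0) : ℤ × ℤ) + w.2 • ((0, 1) : ℤ × ℤ) := by
    ext <;> simp
  rw [this]
  exact H.add_mem (H.zsmul_mem h10 _) (H.zsmul_mem h01 _)

end StationaryBootstrap

namespace StationaryBootstrap

/-! ### Moments of a stationary process -/

variable {Ω : Type*} [MeasurableSpace Ω] {X : ℤ → Ω → ℝ} {μ : Measure Ω}

namespace IsStrictlyStationary

lemma identDistrib_eval (hX : IsStrictlyStationary X μ) (i : ℤ) :
    IdentDistrib (X 0) (X i) μ μ := by
  have h := (hX i).comp (u := fun p : ℤ → ℝ => p 0) (by fun_prop)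
  simpa [Function.comp_def] using h

lemma memLp (hX : IsStrictlyStationary X μ) {p : ENNReal} (h : MemLp (X 0) p μ) (i : ℤ) :
    MemLp (X i) p μ :=
  (hX.identDistrib_eval i).memLp_iff.1 h

lemma integral_eq (hX : IsStrictlyStationary X μ) (i : ℤ) :
    ∫ ω, X i ω ∂μ = ∫ ω, X 0 ω ∂μ :=
  (hX.identDistrib_eval i).integral_eq.symm

lemma integral_comp_eq (hX : IsStrictlyStationary X μ) (h : ℤ) {F : (ℤ → ℝ) → ℝ}
    (hF : Measurable F) :
    ∫ ω, F (fun t => X (t + h) ω) ∂μ = ∫ ω, F (fun t => X t ω) ∂μ :=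
  ((hX h).comp hF).integral_eq.symm

lemma cov_eq (hX : IsStrictlyStationary X μ) (i j : ℤ) :
    cov[X i, X j; μ] = autocov X μ (j - i) := by
  simp only [autocov, covariance, hX.integral_eq]
  have := hX.integral_comp_eq i
    (F := fun p => (p 0 - ∫ ω, X 0 ω ∂μ) * (p (j - i) - ∫ ω, X 0 ω ∂μ)) (by fun_prop)
  simpa using this

lemma integral_mul_eq (hX : IsStrictlyStationary X μ) (i j : ℤ) :
    ∫ ω, (X i ω - ∫ ω, X 0 ω ∂μ) * (X j ω - ∫ ω, X 0 ω ∂μ) ∂μ = autocov X μ (j - i) := by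
  rw [← hX.cov_eq, covariance, hX.integral_eq i, hX.integral_eq j]

lemma autocov_neg (hX : IsStrictlyStationary X μ) (k : ℤ) :
    autocov X μ (-k) = autocov X μ k := by
  have h := hX.cov_eq k 0
  rw [covariance_comm] at h
  rw [← zero_sub, ← h, autocov]

lemma autocov_natAbs (hX : IsStrictlyStationary X μ) (k : ℤ) :
    autocov X μ k.natAbs = autocov X μ k := by
  rcases Int.natAbs_eq k with h | h
  · rw [← h]
  · conv_rhs => rw [h, hX.autocov_neg]

lemma summable_abs_mul_autocov (hX : IsStrictlyStationary X μ) (hA : CondA1 X μ) :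
    Summable fun k : ℤ => |(k : ℝ)| * |autocov X μ k| := by
  refine Summable.of_nat_of_neg ?_ ?_
  · simpa using hA.2
  · simpa [hX.autocov_neg] using hA.2

lemma summable_autocov (hX : IsStrictlyStationary X μ) (hA : CondA1 X μ) :
    Summable (autocov X μ) := by
  have h := (hX.summable_abs_mul_autocov hA)
  refine Summable.of_norm_bounded_eventually h ?_
  have : {k : ℤ | ¬ ‖autocov X μ k‖ ≤ |(k : ℝ)| * |autocov X μ k|} ⊆ {0} := by
    intro k hk
    by_contra h0
    apply hk
    have : (1 : ℝ) ≤ |(k : ℝ)| := by exact_mod_cast Int.one_le_abs h0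
    rw [Real.norm_eq_abs]
    nlinarith [abs_nonneg (autocov X μ k)]
  exact (Set.finite_singleton 0).subset this

variable [IsProbabilityMeasure μ]

lemma integral_mul_four_eq (hX : IsStrictlyStationary X μ) (h4 : MemLp (X 0) 4 μ)
    (i j k l : ℤ) :
    ∫ ω, (X i ω - ∫ ω, X 0 ω ∂μ) * (X j ω - ∫ ω, X 0 ω ∂μ) *
        ((X k ω - ∫ ω, X 0 ω ∂μ) * (X l ω - ∫ ω, X 0 ω ∂μ)) ∂μ =
      jointCumulant ![X 0, X (j - i), X (k - i), X (l - i)] μ +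
      autocov X μ (j - i) * autocov X μ (l - k) + autocov X μ (k - i) * autocov X μ (l - j) +
      autocov X μ (l - i) * autocov X μ (k - j) := by
  rw [jointCumulant_four_eq h4 (hX.memLp h4 _) (hX.memLp h4 _) (hX.memLp h4 _) rfl
    (hX.integral_eq _) (hX.integral_eq _) (hX.integral_eq _)]
  simp only [hX.integral_mul_eq]
  have := hX.integral_comp_eq i (F := fun p => (p 0 - ∫ ω, X 0 ω ∂μ) *
    (p (j - i) - ∫ ω, X 0 ω ∂μ) * ((p (k - i) - ∫ ω, X 0 ω ∂μ) * (p (l - i) - ∫ ω, X 0 ω ∂μ)))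
    (by fun_prop)
  simp only [zero_add, sub_add_cancel] at this
  rw [this]
  simp only [sub_zero, sub_sub_sub_cancel_right]
  ring

lemma memLp_sub (hX : IsStrictlyStationary X μ) {p : ENNReal} (h : MemLp (X 0) p μ) (i : ℤ) :
    MemLp (fun ω => X i ω - ∫ ω, X 0 ω ∂μ) p μ :=
  (hX.memLp h i).sub (memLp_const _)

/-- Of the three pairings in the fourth moment, `(ij)(kl)` is cancelled by the product of the means.
-/
lemma cov_mul_mul (hX : IsStrictlyStationary X μ) (h4 : MemLp (X 0) 4 μ) (i j k l : ℤ) :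
    cov[fun ω => (X i ω - ∫ ω, X 0 ω ∂μ) * (X j ω - ∫ ω, X 0 ω ∂μ),
      fun ω => (X k ω - ∫ ω, X 0 ω ∂μ) * (X l ω - ∫ ω, X 0 ω ∂μ); μ] =
      jointCumulant ![X 0, X (j - i), X (k - i), X (l - i)] μ +
      autocov X μ (k - i) * autocov X μ (l - j) + autocov X μ (l - i) * autocov X μ (k - j) := by
  rw [covariance_eq_sub (MemLp.mul_four (hX.memLp_sub h4 i) (hX.memLp_sub h4 j))
    (MemLp.mul_four (hX.memLp_sub h4 k) (hX.memLp_sub h4 l))]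
  simp only [Pi.mul_apply]
  rw [hX.integral_mul_four_eq h4, hX.integral_mul_eq, hX.integral_mul_eq]
  ring

/-! ### Quadratic forms -/

variable (X μ) in
/-- The quadratic form `∑ a(i,j) (X_{i+1} - m) (X_{j+1} - m)` in the centered data. -/
noncomputable def _root_.StationaryBootstrap.quadForm (a : ℤ × ℤ → ℝ) (n : ℕ) (ω : Ω) : ℝ :=
  ∑ i ∈ Finset.range n, ∑ j ∈ Finset.range n, a (i, j) *
    ((X (i + 1) ω - ∫ ω, X 0 ω ∂μ) * (X (j + 1) ω - ∫ ω, X 0 ω ∂μ))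

lemma memLp_quadForm (hX : IsStrictlyStationary X μ) (h4 : MemLp (X 0) 4 μ) (a : ℤ × ℤ → ℝ)
    (n : ℕ) : MemLp (quadForm X μ a n) 2 μ :=
  memLp_finsetSum _ fun _ _ => memLp_finsetSum _ fun _ _ =>
    (MemLp.mul_four (hX.memLp_sub h4 _) (hX.memLp_sub h4 _)).const_mul _

lemma integrable_mul (hX : IsStrictlyStationary X μ) (h2 : MemLp (X 0) 2 μ) (i j : ℤ) :
    Integrable (fun ω => (X i ω - ∫ ω, X 0 ω ∂μ) * (X j ω - ∫ ω, X 0 ω ∂μ)) μ :=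
  (hX.memLp_sub h2 i).integrable_mul (hX.memLp_sub h2 j)

lemma integrable_quadForm (hX : IsStrictlyStationary X μ) (h2 : MemLp (X 0) 2 μ) (a : ℤ × ℤ → ℝ)
    (n : ℕ) : Integrable (quadForm X μ a n) μ :=
  integrable_finsetSum _ fun _ _ => integrable_finsetSum _ fun _ _ =>
    (hX.integrable_mul h2 _ _).const_mul _

lemma integral_quadForm (hX : IsStrictlyStationary X μ) (h2 : MemLp (X 0) 2 μ) (a : ℤ × ℤ → ℝ)
    (n : ℕ) : ∫ ω, quadForm X μ a n ω ∂μ = ∑ i ∈ Finset.range n, ∑ j ∈ Finset.range n,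
      a (i, j) * autocov X μ ((j : ℤ) - i) := by
  simp only [quadForm]
  rw [integral_finsetSum _ fun i _ => integrable_finsetSum _ fun j _ =>
    (hX.integrable_mul h2 _ _).const_mul _]
  refine Finset.sum_congr rfl fun i _ => ?_
  rw [integral_finsetSum _ fun j _ => (hX.integrable_mul h2 _ _).const_mul _]
  refine Finset.sum_congr rfl fun j _ => ?_
  rw [integral_const_mul, hX.integral_mul_eq, add_sub_add_right_eq_sub]

variable (X μ) in
/-- The contribution of the fourth cumulants to the variance of a quadratic form. -/
noncomputable def _root_.StationaryBootstrap.cumulantPart (a : ℤ × ℤ → ℝ) (n : ℕ) : ℝ :=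
  ∑ i ∈ Finset.range n, ∑ j ∈ Finset.range n, ∑ k ∈ Finset.range n, ∑ l ∈ Finset.range n,
    a (i, j) * a (k, l) *
      jointCumulant ![X 0, X ((j : ℤ) - i), X ((k : ℤ) - i), X ((l : ℤ) - i)] μ

/-- Exchanging `k` and `l` turns one remaining pairing into the other, and symmetry of `a` leaves
the coefficients unchanged; hence the factor 2. -/
lemma variance_quadForm (hX : IsStrictlyStationary X μ) (h4 : MemLp (X 0) 4 μ) {a : ℤ × ℤ → ℝ}
    (ha : ∀ i j, a (i, j) = a (j, i)) (n : ℕ) :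
    Var[quadForm X μ a n; μ] = cumulantPart X μ a n +
      2 * ∑ i ∈ Finset.range n, ∑ j ∈ Finset.range n, ∑ k ∈ Finset.range n, ∑ l ∈ Finset.range n,
        a (i, j) * a (k, l) * (autocov X μ ((k : ℤ) - i) * autocov X μ ((l : ℤ) - j)) := by
  have hm : ∀ i j : ℕ, MemLp (fun ω => a (i, j) *
      ((X (i + 1) ω - ∫ ω, X 0 ω ∂μ) * (X (j + 1) ω - ∫ ω, X 0 ω ∂μ))) 2 μ := fun i j =>
    (MemLp.mul_four (hX.memLp_sub h4 _) (hX.memLp_sub h4 _)).const_mul _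
  have hs : ∀ i : ℕ, MemLp (fun ω => ∑ j ∈ Finset.range n, a (i, j) *
      ((X (i + 1) ω - ∫ ω, X 0 ω ∂μ) * (X (j + 1) ω - ∫ ω, X 0 ω ∂μ))) 2 μ := fun i =>
    memLp_finsetSum _ fun j _ => hm i j
  have hvar : Var[quadForm X μ a n; μ] = ∑ i ∈ Finset.range n, ∑ j ∈ Finset.range n,
      ∑ k ∈ Finset.range n, ∑ l ∈ Finset.range n, a (i, j) * a (k, l) *
      (jointCumulant ![X 0, X ((j : ℤ) - i), X ((k : ℤ) - i), X ((l : ℤ) - i)] μ +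
      autocov X μ ((k : ℤ) - i) * autocov X μ ((l : ℤ) - j) +
      autocov X μ ((l : ℤ) - i) * autocov X μ ((k : ℤ) - j)) := by
    unfold quadForm
    rw [variance_fun_sum' fun i _ => hs i]
    refine Finset.sum_congr rfl fun i _ => ?_
    rw [Finset.sum_congr rfl fun k _ => covariance_fun_sum_fun_sum' (fun j _ => hm i j)
      fun l _ => hm k l, Finset.sum_comm]
    refine Finset.sum_congr rfl fun j _ => Finset.sum_congr rfl fun k _ =>
      Finset.sum_congr rfl fun l _ => ?_
    rw [covariance_const_mul_left, covariance_const_mul_right, hX.cov_mul_mul h4]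
    simp only [add_sub_add_right_eq_sub]
    ring
  have hswap : ∑ i ∈ Finset.range n, ∑ j ∈ Finset.range n, ∑ k ∈ Finset.range n,
      ∑ l ∈ Finset.range n,
        a (i, j) * a (k, l) * (autocov X μ ((l : ℤ) - i) * autocov X μ ((k : ℤ) - j)) =
      ∑ i ∈ Finset.range n, ∑ j ∈ Finset.range n, ∑ k ∈ Finset.range n, ∑ l ∈ Finset.range n,
        a (i, j) * a (k, l) * (autocov X μ ((k : ℤ) - i) * autocov X μ ((l : ℤ) - j)) := by
    refine Finset.sum_congr rfl fun i _ => Finset.sum_congr rfl fun j _ => ?_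
    rw [Finset.sum_comm]
    refine Finset.sum_congr rfl fun k _ => Finset.sum_congr rfl fun l _ => ?_
    rw [ha l k]
  rw [hvar, two_mul]
  nth_rw 1 [← hswap]
  simp only [mul_add, Finset.sum_add_distrib, cumulantPart]
  ring

omit [IsProbabilityMeasure μ] in
-- For fixed `i` the three differences determine `j, k, l`, so the inner sums are bounded by the
-- full cumulant series; the free index `i` contributes the factor `n`.
lemma abs_cumulantPart_le (hA : CondA2 X μ) {a : ℤ × ℤ → ℝ} {M : ℝ} (ha : ∀ x, |a x| ≤ M)
    (n : ℕ) : |cumulantPart X μ a n| ≤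
      M ^ 2 * n * ∑' t : ℤ × ℤ × ℤ, |jointCumulant ![X 0, X t.1, X t.2.1, X t.2.2] μ| := by
  set κ : ℤ × ℤ × ℤ → ℝ := fun t => |jointCumulant ![X 0, X t.1, X t.2.1, X t.2.2] μ|
  have hM : 0 ≤ M := (abs_nonneg _).trans (ha (0, 0))
  have hi : ∀ i : ℕ, ∑ j ∈ Finset.range n, ∑ k ∈ Finset.range n, ∑ l ∈ Finset.range n,
      κ ((j : ℤ) - i, (k : ℤ) - i, (l : ℤ) - i) ≤ ∑' t, κ t := by
    intro i
    set e : ℕ × ℕ × ℕ → ℤ × ℤ × ℤ := fun t => ((t.1 : ℤ) - i, (t.2.1 : ℤ) - i, (t.2.2 : ℤ) - i)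
    have he : Function.Injective e := by
      rintro ⟨a, b, c⟩ ⟨a', b', c'⟩ h
      simp only [e, Prod.mk.injEq] at h ⊢
      omega
    have h1 : ∑ j ∈ Finset.range n, ∑ k ∈ Finset.range n, ∑ l ∈ Finset.range n,
        κ ((j : ℤ) - i, (k : ℤ) - i, (l : ℤ) - i) =
        ∑ t ∈ Finset.range n ×ˢ (Finset.range n ×ˢ Finset.range n), κ (e t) := by
      simp only [Finset.sum_product, e]
    rw [h1]
    exact ((hA.2.comp_injective he).sum_le_tsum _ fun _ _ => abs_nonneg _).trans
      (tsum_comp_le_tsum_of_inj hA.2 (fun _ => abs_nonneg _) he)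
  calc |cumulantPart X μ a n|
      ≤ ∑ i ∈ Finset.range n, ∑ j ∈ Finset.range n, ∑ k ∈ Finset.range n, ∑ l ∈ Finset.range n,
        M ^ 2 * κ ((j : ℤ) - i, (k : ℤ) - i, (l : ℤ) - i) := by
        unfold cumulantPart
        refine (Finset.abs_sum_le_sum_abs _ _).trans (Finset.sum_le_sum fun i _ => ?_)
        refine (Finset.abs_sum_le_sum_abs _ _).trans (Finset.sum_le_sum fun j _ => ?_)
        refine (Finset.abs_sum_le_sum_abs _ _).trans (Finset.sum_le_sum fun k _ => ?_)
        refine (Finset.abs_sum_le_sum_abs _ _).trans (Finset.sum_le_sum fun l _ => ?_)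
        rw [abs_mul, abs_mul, sq]
        exact mul_le_mul_of_nonneg_right (mul_le_mul (ha _) (ha _) (abs_nonneg _) hM)
          (abs_nonneg _)
    _ ≤ ∑ i ∈ Finset.range n, M ^ 2 * ∑' t, κ t := by
        refine Finset.sum_le_sum fun i _ => ?_
        simp only [← Finset.mul_sum]
        exact mul_le_mul_of_nonneg_left (hi i) (sq_nonneg M)
    _ = _ := by simp; ring

/-- The variance of quadratic forms whose coefficient arrays are asymptotically shift invariant. -/
theorem tendsto_variance_quadForm (hX : IsStrictlyStationary X μ) (hA1 : CondA1 X μ)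
    (hA2 : CondA2 X μ) {c M : ℕ → ℝ} {N : ℕ → ℕ} {a a' : ℕ → ℤ × ℤ → ℝ}
    (hc : ∀ᶠ n in atTop, 0 ≤ c n)
    (hsymm : ∀ n i j, a n (i, j) = a n (j, i)) (hsymm' : ∀ n i j, a' n (i, j) = a' n (j, i))
    (hs : ∀ n x, ¬ (x.1 ∈ Set.Ico 0 (N n : ℤ) ∧ x.2 ∈ Set.Ico 0 (N n : ℤ)) → a n x = 0)
    (hs' : ∀ n x, ¬ (x.1 ∈ Set.Ico 0 (N n : ℤ) ∧ x.2 ∈ Set.Ico 0 (N n : ℤ)) → a' n x = 0)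
    (hM : ∀ᶠ n in atTop, ∀ x, |a n x| ≤ M n)
    (hcM : Tendsto (fun n => c n * (M n ^ 2 * N n)) atTop (𝓝 0))
    (hN : Tendsto (fun n => c n * sqSum (a' n)) atTop (𝓝 1))
    (hS : Tendsto (fun n => c n * sqSum (fun x => a' n x - a' n (x + (1, 0)))) atTop (𝓝 0))
    (he : Tendsto (fun n => c n * sqSum (fun x => a n x - a' n x)) atTop (𝓝 0)) :
    Tendsto (fun n => c n * Var[quadForm X μ (a n) (N n); μ]) atTop
      (𝓝 (2 * (∑' k, autocov X μ k) ^ 2)) := by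
  set I : ℕ → Finset ℤ := fun n => (Finset.range n).map Nat.castEmbedding with hI
  have hmem : ∀ n x, x ∉ I (N n) ×ˢ I (N n) →
      ¬ (x.1 ∈ Set.Ico 0 (N n : ℤ) ∧ x.2 ∈ Set.Ico 0 (N n : ℤ)) := by
    rintro n ⟨i, j⟩ hx ⟨⟨h1, h2⟩, h3, h4⟩
    apply hx
    simp only [hI, Finset.mem_product, Finset.mem_map, Finset.mem_range, Nat.castEmbedding_apply]
    exact ⟨⟨i.toNat, by omega, by omega⟩, ⟨j.toNat, by omega, by omega⟩⟩
  have hfin : ∀ {b : ℕ → ℤ × ℤ → ℝ}, (∀ n x, ¬ (x.1 ∈ Set.Ico 0 (N n : ℤ) ∧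
      x.2 ∈ Set.Ico 0 (N n : ℤ)) → b n x = 0) → ∀ n, (b n).support.Finite := fun hb n =>
    (I (N n) ×ˢ I (N n)).finite_toSet.subset fun x hx => by
      by_contra h; exact hx (hb n x (hmem n x h))
  have hf := Eventually.of_forall (f := atTop) (hfin hs)
  have hf' := Eventually.of_forall (f := atTop) (hfin hs')
  have hr := hX.summable_autocov hA1
  have hρ : Summable fun w : ℤ × ℤ => autocov X μ w.1 * autocov X μ w.2 :=
    summable_mul_of_summable_norm hr.norm hr.norm
  -- Norm and shift invariance are known for the simple array `a'` and pass to `a` because `a - a'`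
  -- is negligible.
  have hmain := tendsto_sum_sum_mul hρ (B := fun n => I (N n) ×ˢ I (N n))
    (Eventually.of_forall fun n x hx => hs n x (hmem n x hx)) hc (tendsto_sqSum_of_sub hf hf' hN he)
    (fun w => tendsto_sqSum_shift_of_sub hc hf hf' w (tendsto_sqSum_shift hc hf' hsymm' hS w) he)
  have hρsum : ∑' w : ℤ × ℤ, autocov X μ w.1 * autocov X μ w.2 = (∑' k, autocov X μ k) ^ 2 := by
    rw [sq, tsum_mul_tsum_of_summable_norm hr.norm hr.norm]
  rw [hρsum] at hmain
  have hcum : Tendsto (fun n => c n * cumulantPart X μ (a n) (N n)) atTop (𝓝 0) := by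
    have h0 := hcM.mul_const
      (∑' t : ℤ × ℤ × ℤ, |jointCumulant ![X 0, X t.1, X t.2.1, X t.2.2] μ|)
    rw [zero_mul] at h0
    refine squeeze_zero_norm' ?_ h0
    filter_upwards [hc, hM] with n hn hMn
    rw [Real.norm_eq_abs, abs_mul, abs_of_nonneg hn, mul_assoc]
    exact mul_le_mul_of_nonneg_left (abs_cumulantPart_le hA2 hMn _) hn
  have h := hcum.add (hmain.const_mul 2)
  rw [zero_add] at h
  refine h.congr fun n => ?_
  rw [hX.variance_quadForm hA2.1 (hsymm n)]
  simp only [hI, Finset.sum_product, Finset.sum_map, Nat.castEmbedding_apply, Prod.fst_sub,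
    Prod.snd_sub]
  ring

end IsStrictlyStationary

end StationaryBootstrap

namespace StationaryBootstrap

variable {Ω : Type*} [MeasurableSpace Ω] {X : ℤ → Ω → ℝ} {μ : Measure Ω}

/-! ### Spectral density at zero, normalisation and sums over a box -/

lemma two_pi_mul_spectralDensity_zero (X : ℤ → Ω → ℝ) (μ : Measure Ω) :
    2 * Real.pi * spectralDensity X μ 0 = ∑' k, autocov X μ k := by
  have h : ∑' k : ℤ, (autocov X μ k : ℂ) *
      Complex.exp (-(Complex.I * (k : ℂ) * ((0 : ℝ) : ℂ))) =
      ((∑' k, autocov X μ k : ℝ) : ℂ) := by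
    simp [Complex.ofReal_tsum]
  rw [spectralDensity, h]
  have h2 : (2 * (Real.pi : ℂ))⁻¹ * ((∑' k, autocov X μ k : ℝ) : ℂ) =
      (((2 * Real.pi)⁻¹ * ∑' k, autocov X μ k : ℝ) : ℂ) := by push_cast; ring
  rw [h2, Complex.ofReal_re]
  field_simp

/-- The logarithm is at least 1 from `n = 3 > e` on. Beyond `ℓ → ∞`, this consequence is all that
the variance proofs take from A.3. -/
lemma tendsto_div_of_log {ℓ : ℕ → ℝ} (h : Tendsto (fun n : ℕ => ℓ n * Real.log n / n) atTop (𝓝 0)) :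
    Tendsto (fun n : ℕ => ℓ n / n) atTop (𝓝 0) := by
  refine squeeze_zero_norm' ?_ (tendsto_zero_iff_abs_tendsto_zero _ |>.1 h)
  filter_upwards [eventually_ge_atTop 3] with n hn
  have h1 : 1 ≤ Real.log n := by
    rw [Real.le_log_iff_exp_le (by positivity)]
    have : (3 : ℝ) ≤ n := by exact_mod_cast hn
    linarith [Real.exp_one_lt_d9]
  simp only [Function.comp, Real.norm_eq_abs, abs_div, abs_mul]
  rw [abs_of_nonneg (zero_le_one.trans h1)]
  gcongr
  exact le_mul_of_one_le_right (abs_nonneg _) h1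

lemma isLittleO_of_tendsto_mul {v ℓ : ℕ → ℝ} {σ : ℝ} (hℓ : ∀ᶠ n in atTop, 0 < ℓ n)
    (h : Tendsto (fun n : ℕ => n / ℓ n * v n) atTop (𝓝 σ)) :
    (fun n : ℕ => v n - ℓ n / n * σ) =o[atTop] (fun n : ℕ => ℓ n / n) := by
  rw [isLittleO_iff_tendsto']
  · have h0 := h.sub_const σ
    rw [sub_self] at h0
    refine h0.congr' ?_
    filter_upwards [hℓ, eventually_gt_atTop 0] with n h1 h2
    have : (0 : ℝ) < n := by exact_mod_cast h2
    field_simp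
  · filter_upwards [hℓ, eventually_gt_atTop 0] with n h1 h2 h3
    have : (0 : ℝ) < n := by exact_mod_cast h2
    exact absurd h3 (by positivity)

lemma sqSum_eq_sum_range {f : ℤ × ℤ → ℝ} {n : ℕ}
    (h : ∀ x, ¬ (x.1 ∈ Set.Ico 0 (n : ℤ) ∧ x.2 ∈ Set.Ico 0 (n : ℤ)) → f x = 0) :
    sqSum f = ∑ i ∈ Finset.range n, ∑ j ∈ Finset.range n, f (i, j) ^ 2 := by
  set I : Finset ℤ := (Finset.range n).map Nat.castEmbedding with hI
  rw [sqSum, tsum_eq_sum (s := I ×ˢ I)]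
  · simp only [hI, Finset.sum_product, Finset.sum_map, Nat.castEmbedding_apply]
  · rintro ⟨i, j⟩ hx
    rw [h, zero_pow two_ne_zero]
    rintro ⟨⟨h1, h2⟩, h3, h4⟩
    apply hx
    simp only [hI, Finset.mem_product, Finset.mem_map, Finset.mem_range, Nat.castEmbedding_apply]
    exact ⟨⟨i.toNat, by omega, by omega⟩, ⟨j.toNat, by omega, by omega⟩⟩

lemma natCast_mem_box {n i j : ℕ} (hi : i < n) (hj : j < n) :
    ((i : ℤ), (j : ℤ)).1 ∈ Set.Ico 0 (n : ℤ) ∧ ((i : ℤ), (j : ℤ)).2 ∈ Set.Ico 0 (n : ℤ) :=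
  ⟨⟨Int.natCast_nonneg _, Int.ofNat_lt.2 hi⟩, Int.natCast_nonneg _, Int.ofNat_lt.2 hj⟩

/-! ### The array of the nonoverlapping block bootstrap -/

open Classical in
/-- The block indicator array `(bℓ)⁻¹ 1(i, j lie in a common block)`. -/
noncomputable def blockArray (b ℓ : ℕ) (x : ℤ × ℤ) : ℝ :=
  if x.1 ∈ Set.Ico 0 ((b * ℓ : ℕ) : ℤ) ∧ x.2 ∈ Set.Ico 0 ((b * ℓ : ℕ) : ℤ) then
    ((b * ℓ : ℕ) : ℝ)⁻¹ * (if x.1 / ℓ = x.2 / ℓ then 1 else 0) else 0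

open Classical in
/-- The coefficient array of the nonoverlapping block bootstrap estimator. -/
noncomputable def nbbArray (b ℓ : ℕ) (x : ℤ × ℤ) : ℝ :=
  if x.1 ∈ Set.Ico 0 ((b * ℓ : ℕ) : ℤ) ∧ x.2 ∈ Set.Ico 0 ((b * ℓ : ℕ) : ℤ) then
    ((b * ℓ : ℕ) : ℝ)⁻¹ * ((if x.1 / ℓ = x.2 / ℓ then 1 else 0) - (b : ℝ)⁻¹) else 0

lemma nbbEstimator_eq_quadForm {n ℓ : ℕ} (hℓ : 1 ≤ ℓ) (hb : 1 ≤ n / ℓ) (ω : Ω) :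
    nbbEstimator n ℓ (data X ω) = quadForm X μ (nbbArray (n / ℓ) ℓ) (n / ℓ * ℓ) ω := by
  rw [nbbEstimator_eq hℓ hb _ (∫ ω, X 0 ω ∂μ), quadForm]
  refine Finset.sum_congr rfl fun i hi => Finset.sum_congr rfl fun j hj => ?_
  rw [Finset.mem_range] at hi hj
  rw [nbbArray, if_pos (natCast_mem_box hi hj)]
  have h2 : ((i : ℤ) / ℓ = j / ℓ) ↔ i / ℓ = j / ℓ := by norm_cast
  simp only [h2, data]
  push_cast
  rfl

lemma sum_range_block {b ℓ : ℕ} (u : ℕ) (hu : u < b) :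
    ∑ j ∈ Finset.range (b * ℓ), (if u = j / ℓ then (1 : ℝ) else 0) = ℓ := by
  rw [sum_range_mul_eq, Finset.sum_eq_single u]
  · rw [Finset.sum_congr rfl (g := fun _ => (1 : ℝ))]
    · simp
    · intro v hv
      rw [Finset.mem_range] at hv
      rw [Nat.mul_add_div (by omega), Nat.div_eq_of_lt hv, add_zero, if_pos rfl]
  · intro u' _ hne
    refine Finset.sum_eq_zero fun v hv => ?_
    rw [Finset.mem_range] at hv
    rw [Nat.mul_add_div (by omega), Nat.div_eq_of_lt hv, add_zero, if_neg hne.symm]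
  · simp [hu]

lemma blockArray_of_not_mem {b ℓ : ℕ} (x : ℤ × ℤ)
    (h : ¬ (x.1 ∈ Set.Ico 0 ((b * ℓ : ℕ) : ℤ) ∧ x.2 ∈ Set.Ico 0 ((b * ℓ : ℕ) : ℤ))) :
    blockArray b ℓ x = 0 := if_neg h

lemma nbbArray_of_not_mem {b ℓ : ℕ} (x : ℤ × ℤ)
    (h : ¬ (x.1 ∈ Set.Ico 0 ((b * ℓ : ℕ) : ℤ) ∧ x.2 ∈ Set.Ico 0 ((b * ℓ : ℕ) : ℤ))) :
    nbbArray b ℓ x = 0 := if_neg h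

lemma blockArray_natCast {b ℓ i j : ℕ} (hi : i < b * ℓ) (hj : j < b * ℓ) :
    blockArray b ℓ (i, j) = ((b * ℓ : ℕ) : ℝ)⁻¹ * (if i / ℓ = j / ℓ then 1 else 0) := by
  have h2 : ((i : ℤ) / ℓ = j / ℓ) ↔ i / ℓ = j / ℓ := by norm_cast
  rw [blockArray, if_pos (natCast_mem_box hi hj)]
  simp only [h2]

lemma blockArray_nonneg (b ℓ : ℕ) (x : ℤ × ℤ) : 0 ≤ blockArray b ℓ x := by
  unfold blockArray
  split_ifs <;> positivity

lemma support_finite_of_box {f : ℤ × ℤ → ℝ} {n : ℕ}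
    (h : ∀ x, ¬ (x.1 ∈ Set.Ico 0 (n : ℤ) ∧ x.2 ∈ Set.Ico 0 (n : ℤ)) → f x = 0) :
    f.support.Finite := by
  refine ((Set.finite_Ico 0 (n : ℤ)).prod (Set.finite_Ico 0 (n : ℤ))).subset fun x hx => ?_
  by_contra h'
  exact hx (h x h')

lemma sqSum_blockArray {b ℓ : ℕ} (hb : 1 ≤ b) (hℓ : 1 ≤ ℓ) :
    sqSum (blockArray b ℓ) = (b : ℝ)⁻¹ := by
  rw [sqSum_eq_sum_range blockArray_of_not_mem]
  have h : ∀ i ∈ Finset.range (b * ℓ), ∑ j ∈ Finset.range (b * ℓ), blockArray b ℓ (i, j) ^ 2 =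
      ((b * ℓ : ℕ) : ℝ)⁻¹ ^ 2 * ℓ := by
    intro i hi
    rw [Finset.mem_range] at hi
    have hrow := sum_range_block (b := b) (ℓ := ℓ) (i / ℓ) (Nat.div_lt_of_lt_mul (by rwa [mul_comm]))
    conv_rhs => rw [← hrow, Finset.mul_sum]
    refine Finset.sum_congr rfl fun j hj => ?_
    rw [blockArray_natCast hi (Finset.mem_range.1 hj), mul_pow]
    split_ifs <;> simp
  rw [Finset.sum_congr rfl h]
  simp only [Finset.sum_const, Finset.card_range, nsmul_eq_mul]
  push_cast
  field_simp

/-- All but the last row of each block stay in the block when the row index grows by one. These rows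
alone give an autocorrelation of at least `b⁻¹ (1 - ℓ⁻¹)`, and `tsum_mul_shift` doubles its gap to
the squared norm `b⁻¹`. -/
lemma sqSum_blockArray_shift_le {b ℓ : ℕ} (hb : 1 ≤ b) (hℓ : 1 ≤ ℓ) :
    sqSum (fun x => blockArray b ℓ x - blockArray b ℓ (x + (1, 0))) ≤
      2 * ((b : ℝ)⁻¹ * (ℓ : ℝ)⁻¹) := by
  have hfin := support_finite_of_box (blockArray_of_not_mem (b := b) (ℓ := ℓ))
  have h1 := tsum_mul_shift hfin (1, 0)
  have h2 : ((b * ℓ : ℕ) : ℝ)⁻¹ ^ 2 * (b * ((ℓ - 1 : ℕ) * ℓ)) ≤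
      ∑' x, blockArray b ℓ x * blockArray b ℓ (x + (1, 0)) := by
    set I : Finset ℤ := (Finset.range (b * ℓ)).map Nat.castEmbedding with hI
    have hsum : Summable fun x => blockArray b ℓ x * blockArray b ℓ (x + (1, 0)) :=
      summable_of_support_finite hfin fun x h => by simp [h]
    refine le_trans ?_ (hsum.sum_le_tsum (I ×ˢ I) fun x _ =>
      mul_nonneg (blockArray_nonneg _ _ _) (blockArray_nonneg _ _ _))
    simp only [hI, Finset.sum_product, Finset.sum_map, Nat.castEmbedding_apply]
    rw [sum_range_mul_eq b ℓ (fun i => ∑ j ∈ Finset.range (b * ℓ),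
      blockArray b ℓ ((i : ℤ), (j : ℤ)) * blockArray b ℓ (((i : ℤ), (j : ℤ)) + (1, 0)))]
    have hnn : ∀ x, 0 ≤ blockArray b ℓ x * blockArray b ℓ (x + (1, 0)) := fun x =>
      mul_nonneg (blockArray_nonneg _ _ _) (blockArray_nonneg _ _ _)
    calc ((b * ℓ : ℕ) : ℝ)⁻¹ ^ 2 * (b * ((ℓ - 1 : ℕ) * ℓ))
        = ∑ u ∈ Finset.range b, ∑ v ∈ Finset.range (ℓ - 1), ((b * ℓ : ℕ) : ℝ)⁻¹ ^ 2 * ℓ := by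
          simp only [Finset.sum_const, Finset.card_range, nsmul_eq_mul]; ring
      _ ≤ ∑ u ∈ Finset.range b, ∑ v ∈ Finset.range (ℓ - 1), ∑ j ∈ Finset.range (b * ℓ),
          blockArray b ℓ (((ℓ * u + v : ℕ) : ℤ), (j : ℤ)) *
            blockArray b ℓ ((((ℓ * u + v : ℕ) : ℤ), (j : ℤ)) + (1, 0)) := by
          refine Finset.sum_le_sum fun u hu => Finset.sum_le_sum fun v hv => le_of_eq ?_
          rw [Finset.mem_range] at hu hv
          have hlt : ℓ * u + ℓ ≤ b * ℓ := by
            calc ℓ * u + ℓ = (u + 1) * ℓ := by ring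
              _ ≤ b * ℓ := Nat.mul_le_mul_right _ hu
          conv_lhs => rw [← sum_range_block (b := b) (ℓ := ℓ) u hu, Finset.mul_sum]
          refine Finset.sum_congr rfl fun j hj => ?_
          rw [Finset.mem_range] at hj
          have he : (((ℓ * u + v : ℕ) : ℤ), (j : ℤ)) + (1, 0) =
              (((ℓ * u + (v + 1) : ℕ) : ℤ), (j : ℤ)) := by
            ext <;> simp [add_assoc]
          rw [he, blockArray_natCast (by omega) hj, blockArray_natCast (by omega) hj,
            Nat.mul_add_div (by omega), Nat.div_eq_of_lt (by omega : v < ℓ),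
            Nat.mul_add_div (by omega), Nat.div_eq_of_lt (by omega : v + 1 < ℓ), add_zero]
          split_ifs <;> ring
      _ ≤ _ := by
          refine Finset.sum_le_sum fun u _ => ?_
          refine Finset.sum_le_sum_of_subset_of_nonneg
            (Finset.range_subset_range.2 (Nat.sub_le ℓ 1)) fun v _ _ =>
            Finset.sum_nonneg fun j _ => hnn _
  rw [h1, sqSum_blockArray hb hℓ] at h2
  push_cast [Nat.cast_sub hℓ] at h2
  have hb0 : (b : ℝ) ≠ 0 := by positivity
  have hℓ0 : (ℓ : ℝ) ≠ 0 := by positivity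
  have : ((b : ℝ) * ℓ)⁻¹ ^ 2 * (b * ((ℓ - 1) * ℓ)) = (b : ℝ)⁻¹ - (b : ℝ)⁻¹ * (ℓ : ℝ)⁻¹ := by
    field_simp
  rw [this] at h2
  linarith

lemma abs_nbbArray_le {b ℓ : ℕ} (hb : 1 ≤ b) (x : ℤ × ℤ) :
    |nbbArray b ℓ x| ≤ ((b * ℓ : ℕ) : ℝ)⁻¹ := by
  unfold nbbArray
  have hb1 : (b : ℝ)⁻¹ ≤ 1 := inv_le_one_of_one_le₀ (by exact_mod_cast hb)
  have hb0 : 0 ≤ (b : ℝ)⁻¹ := by positivity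
  split_ifs
  · rw [abs_mul, abs_of_nonneg (by positivity)]
    refine mul_le_of_le_one_right (by positivity) ?_
    rw [abs_le]; constructor <;> linarith
  · rw [abs_mul, abs_of_nonneg (by positivity)]
    refine mul_le_of_le_one_right (by positivity) ?_
    rw [abs_le]; constructor <;> linarith
  · rw [abs_zero]; positivity

/-- The centring constant is spread evenly over `(bℓ)²` cells, and its squared norm is smaller than
that of the block array by the factor `b⁻¹`. -/
lemma sqSum_nbbArray_sub {b ℓ : ℕ} (hb : 1 ≤ b) (hℓ : 1 ≤ ℓ) :
    sqSum (fun x => nbbArray b ℓ x - blockArray b ℓ x) = (b : ℝ)⁻¹ ^ 2 := by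
  rw [sqSum_eq_sum_range (n := b * ℓ) fun x hx => by
    rw [blockArray_of_not_mem x hx, nbbArray_of_not_mem x hx, sub_zero]]
  have h : ∀ i ∈ Finset.range (b * ℓ), ∀ j ∈ Finset.range (b * ℓ),
      (nbbArray b ℓ (i, j) - blockArray b ℓ (i, j)) ^ 2 =
      (((b * ℓ : ℕ) : ℝ)⁻¹ * (b : ℝ)⁻¹) ^ 2 := by
    intro i hi j hj
    rw [Finset.mem_range] at hi hj
    rw [nbbArray, blockArray, if_pos (natCast_mem_box hi hj), if_pos (natCast_mem_box hi hj)]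
    ring
  rw [Finset.sum_congr rfl fun i hi => Finset.sum_congr rfl fun j hj => h i hi j hj]
  simp only [Finset.sum_const, Finset.card_range, nsmul_eq_mul]
  push_cast
  field_simp

/-- The first-order variance of the nonoverlapping block bootstrap estimator. -/
theorem nbb_variance [IsProbabilityMeasure μ] (hX : IsStrictlyStationary X μ) (hA1 : CondA1 X μ)
    (hA2 : CondA2 X μ) {ℓ : ℕ → ℕ} (hA3 : CondA3 fun n => (ℓ n : ℝ)) :
    (∀ᶠ n : ℕ in atTop, MemLp (fun ω => nbbEstimator n (ℓ n) (data X ω)) 2 μ) ∧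
    (fun n : ℕ => Var[fun ω => nbbEstimator n (ℓ n) (data X ω); μ]
      - (ℓ n : ℝ) / n * (2 * (2 * Real.pi * spectralDensity X μ 0) ^ 2))
      =o[atTop] (fun n : ℕ => (ℓ n : ℝ) / n) := by
  have hℓ1 : ∀ᶠ n in atTop, 1 ≤ ℓ n := by
    filter_upwards [hA3.1.eventually_ge_atTop 1] with n hn using by exact_mod_cast hn
  have hdiv := tendsto_div_of_log hA3.2
  have hc : Tendsto (fun n : ℕ => (n : ℝ) / ℓ n) atTop atTop := by
    have h : Tendsto (fun n : ℕ => (ℓ n : ℝ) / n) atTop (𝓝[>] 0) := by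
      rw [tendsto_nhdsWithin_iff]
      refine ⟨hdiv, ?_⟩
      filter_upwards [hℓ1, eventually_gt_atTop 0] with n h1 h2
      exact div_pos (G₀ := ℝ) (Nat.cast_pos.2 h1) (Nat.cast_pos.2 h2)
    simpa [Function.comp_def] using tendsto_inv_nhdsGT_zero.comp h
  have hfl : ∀ n, ((n / ℓ n : ℕ) : ℝ) = ((⌊(n : ℝ) / ℓ n⌋₊ : ℕ) : ℝ) := fun n => by
    rw [Nat.floor_div_eq_div]
  have hbtop : Tendsto (fun n => ((n / ℓ n : ℕ) : ℝ)) atTop atTop := by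
    simp only [hfl]
    exact tendsto_natCast_atTop_atTop.comp (tendsto_nat_floor_atTop.comp hc)
  have hb1 : ∀ᶠ n in atTop, 1 ≤ n / ℓ n := by
    filter_upwards [hbtop.eventually_ge_atTop 1] with n hn using by exact_mod_cast hn
  -- Rounding `n/ℓ` down to `b` does not matter in the limit, because `n/ℓ → ∞`.
  have hratio : Tendsto (fun n : ℕ => (n : ℝ) / ℓ n * ((n / ℓ n : ℕ) : ℝ)⁻¹) atTop (𝓝 1) := by
    have h := (tendsto_nat_floor_div_atTop (R := ℝ)).comp hc
    have h' := h.inv₀ one_ne_zero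
    rw [inv_one] at h'
    refine h'.congr fun n => ?_
    simp only [Function.comp, hfl, inv_div]
    rw [div_eq_mul_inv ((n : ℝ) / ℓ n)]
  have hbinv : Tendsto (fun n => ((n / ℓ n : ℕ) : ℝ)⁻¹) atTop (𝓝 0) :=
    tendsto_inv_atTop_zero.comp hbtop
  have hℓinv : Tendsto (fun n => (ℓ n : ℝ)⁻¹) atTop (𝓝 0) := tendsto_inv_atTop_zero.comp hA3.1
  have hev : ∀ᶠ n in atTop, (fun ω => nbbEstimator n (ℓ n) (data X ω)) =
      quadForm X μ (nbbArray (n / ℓ n) (ℓ n)) (n / ℓ n * ℓ n) := by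
    filter_upwards [hℓ1, hb1] with n h1 h2
    ext ω
    exact nbbEstimator_eq_quadForm h1 h2 ω
  refine ⟨hev.mono fun n h => h ▸ hX.memLp_quadForm hA2.1 _ _, ?_⟩
  rw [two_pi_mul_spectralDensity_zero]
  refine isLittleO_of_tendsto_mul (hℓ1.mono fun n h => by exact_mod_cast h) ?_
  -- With this normalisation the four limits to check are `hratio` times, respectively, `ℓ⁻¹`
  -- (cumulants), `1` (norm), at most `2 ℓ⁻¹` (shift) and `b⁻¹` (centring).
  have key := hX.tendsto_variance_quadForm hA1 hA2 (c := fun n => (n : ℝ) / ℓ n)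
    (M := fun n => ((n / ℓ n * ℓ n : ℕ) : ℝ)⁻¹) (N := fun n => n / ℓ n * ℓ n)
    (a := fun n => nbbArray (n / ℓ n) (ℓ n)) (a' := fun n => blockArray (n / ℓ n) (ℓ n))
    (Eventually.of_forall fun n => by positivity)
    (fun n i j => by simp only [nbbArray, and_comm, eq_comm])
    (fun n i j => by simp only [blockArray, and_comm, eq_comm])
    (fun n x hx => nbbArray_of_not_mem x hx) (fun n x hx => blockArray_of_not_mem x hx)
    (hb1.mono fun n h x => abs_nbbArray_le h x) ?_ ?_ ?_ ?_
  · refine key.congr' ?_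
    filter_upwards [hev] with n hn
    rw [hn]
  · have h := hratio.mul hℓinv
    rw [mul_zero] at h
    refine h.congr' ?_
    filter_upwards [hℓ1, hb1] with n h1 h2
    have h3 : ((n / ℓ n : ℕ) : ℝ) ≠ 0 := by positivity
    push_cast
    field_simp
  · refine hratio.congr' ?_
    filter_upwards [hℓ1, hb1] with n h1 h2
    rw [sqSum_blockArray h2 h1]
  · have h := (hratio.mul hℓinv).const_mul 2
    rw [mul_zero, mul_zero] at h
    refine squeeze_zero' (Eventually.of_forall fun n => mul_nonneg (by positivity) (sqSum_nonneg _))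
      ?_ h
    filter_upwards [hℓ1, hb1] with n h1 h2
    refine (mul_le_mul_of_nonneg_left (sqSum_blockArray_shift_le h2 h1) (by positivity)).trans
      (le_of_eq (by ring))
  · have h := hratio.mul hbinv
    rw [mul_zero] at h
    refine h.congr' ?_
    filter_upwards [hℓ1, hb1] with n h1 h2
    rw [sqSum_nbbArray_sub h2 h1]; ring

end StationaryBootstrap

namespace StationaryBootstrap

variable {Ω : Type*} [MeasurableSpace Ω] {X : ℤ → Ω → ℝ} {μ : Measure Ω}

/-! ### The array of the stationary bootstrap -/

open Classical in
/-- The array `n⁻¹ q^{|i-j|}` on the box `[0, n)²`. -/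
noncomputable def expArray (n : ℕ) (q : ℝ) (x : ℤ × ℤ) : ℝ :=
  if x.1 ∈ Set.Ico 0 (n : ℤ) ∧ x.2 ∈ Set.Ico 0 (n : ℤ) then
    (n : ℝ)⁻¹ * q ^ (x.1 - x.2).natAbs else 0

open Classical in
/-- The coefficient array of the stationary bootstrap estimator. -/
noncomputable def sbArray (n : ℕ) (q : ℝ) (x : ℤ × ℤ) : ℝ :=
  if x.1 ∈ Set.Ico 0 (n : ℤ) ∧ x.2 ∈ Set.Ico 0 (n : ℤ) then
    (n : ℝ)⁻¹ * (sbWeight n q (x.1 - x.2).natAbs - (n : ℝ)⁻¹ * sbTotal n q) else 0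

lemma expArray_of_not_mem {n : ℕ} {q : ℝ} (x : ℤ × ℤ)
    (h : ¬ (x.1 ∈ Set.Ico 0 (n : ℤ) ∧ x.2 ∈ Set.Ico 0 (n : ℤ))) : expArray n q x = 0 := if_neg h

lemma sbArray_of_not_mem {n : ℕ} {q : ℝ} (x : ℤ × ℤ)
    (h : ¬ (x.1 ∈ Set.Ico 0 (n : ℤ) ∧ x.2 ∈ Set.Ico 0 (n : ℤ))) : sbArray n q x = 0 := if_neg h

lemma natAbs_sub_comm' (i j : ℤ) : (i - j).natAbs = (j - i).natAbs := by omega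

lemma expArray_symm (n : ℕ) (q : ℝ) (i j : ℤ) : expArray n q (i, j) = expArray n q (j, i) := by
  simp only [expArray, and_comm, natAbs_sub_comm' i j]

lemma sbArray_symm (n : ℕ) (q : ℝ) (i j : ℤ) : sbArray n q (i, j) = sbArray n q (j, i) := by
  simp only [sbArray, and_comm, natAbs_sub_comm' i j]

lemma sbArray_natCast {n i j : ℕ} (q : ℝ) (hi : i < n) (hj : j < n) :
    sbArray n q (i, j) =
      (n : ℝ)⁻¹ * (sbWeight n q ((i : ℤ) - j).natAbs - (n : ℝ)⁻¹ * sbTotal n q) :=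
  if_pos (natCast_mem_box hi hj)

lemma expArray_natCast {n i j : ℕ} (q : ℝ) (hi : i < n) (hj : j < n) :
    expArray n q (i, j) = (n : ℝ)⁻¹ * q ^ ((i : ℤ) - j).natAbs :=
  if_pos (natCast_mem_box hi hj)

lemma sbEstimator_eq_quadForm {n : ℕ} (hn : 1 ≤ n) {ℓ : ℝ} (hℓ : 1 < ℓ) (ω : Ω) :
    sbEstimator n ℓ (data X ω) = quadForm X μ (sbArray n (1 - ℓ⁻¹)) n ω := by
  rw [sbEstimator_eq hn hℓ _ (∫ ω, X 0 ω ∂μ), quadForm]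
  refine Finset.sum_congr rfl fun i hi => Finset.sum_congr rfl fun j hj => ?_
  rw [sbArray_natCast _ (Finset.mem_range.1 hi) (Finset.mem_range.1 hj)]
  simp [data]

/-! ### Geometric sums and the norms of the stationary bootstrap arrays -/

section Geometric

variable {q : ℝ} (h0 : 0 ≤ q) (h1 : q < 1)
include h0 h1

lemma sum_range_pow_le (n : ℕ) : ∑ i ∈ Finset.range n, q ^ i ≤ (1 - q)⁻¹ := by
  rw [← tsum_geometric_of_lt_one h0 h1]
  exact (summable_geometric_of_lt_one h0 h1).sum_le_tsum _ fun _ _ => pow_nonneg h0 _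

lemma mul_pow_le (k : ℕ) : k * q ^ k ≤ (1 - q)⁻¹ := by
  refine le_trans ?_ (sum_range_pow_le h0 h1 k)
  calc (k : ℝ) * q ^ k = ∑ _i ∈ Finset.range k, q ^ k := by simp
    _ ≤ _ := Finset.sum_le_sum fun i hi =>
      pow_le_pow_of_le_one h0 h1.le (Finset.mem_range.1 hi).le

/-- Any row is part of the two-sided geometric series, whose sum is `(1 + q)/(1 - q)`. -/
lemma sum_range_pow_natAbs_le (n : ℕ) (i : ℤ) :
    ∑ j ∈ Finset.range n, q ^ (i - j).natAbs ≤ 2 * (1 - q)⁻¹ := by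
  have hs := hasSum_geometric_of_lt_one h0 h1
  have h := HasSum.of_nat_of_neg_add_one (f := fun k : ℤ => q ^ k.natAbs) (m := (1 - q)⁻¹)
    (m' := q * (1 - q)⁻¹) (by simpa using hs) (by
      have e : (fun k : ℕ => q ^ (-((k : ℤ) + 1)).natAbs) = fun k => q * q ^ k := by
        ext k
        rw [← pow_succ']; congr 1
      rw [e]; exact hs.mul_left q)
  have hinj : Function.Injective fun j : ℕ => i - (j : ℤ) := fun a b hab => by
    simp only at hab; omega
  have h2 := (h.summable.comp_injective hinj).sum_le_tsum (Finset.range n)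
    fun _ _ => pow_nonneg h0 _
  have h3 := tsum_comp_le_tsum_of_inj h.summable (fun _ => pow_nonneg h0 _) hinj
  rw [h.tsum_eq] at h3
  have h4 : q * (1 - q)⁻¹ ≤ (1 - q)⁻¹ :=
    mul_le_of_le_one_left (inv_nonneg.2 (by linarith)) h1.le
  simp only [Function.comp_def] at h2 h3
  linarith

lemma sum_sum_pow_natAbs_le (n : ℕ) :
    ∑ i ∈ Finset.range n, ∑ j ∈ Finset.range n, q ^ ((i : ℤ) - j).natAbs ≤
      n * (2 * (1 - q)⁻¹) := by
  refine (Finset.sum_le_sum fun (i : ℕ) _ => sum_range_pow_natAbs_le h0 h1 n (i : ℤ)).trans ?_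
  simp

omit h1 in
lemma sbTotal_nonneg (n : ℕ) : 0 ≤ sbTotal n q :=
  mul_nonneg (by positivity)
    (Finset.sum_nonneg fun _ _ => Finset.sum_nonneg fun _ _ => pow_nonneg h0 _)

lemma sbTotal_le {n : ℕ} (hn : 1 ≤ n) : sbTotal n q ≤ 2 * (1 - q)⁻¹ := by
  have hn' : (0 : ℝ) < n := by exact_mod_cast hn
  rw [sbTotal, inv_mul_le_iff₀ hn']
  exact sum_sum_pow_natAbs_le h0 h1 n

lemma inv_mul_sbTotal_le_one {n : ℕ} (hn : 1 ≤ n) : (n : ℝ)⁻¹ * sbTotal n q ≤ 1 := by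
  have hn' : (0 : ℝ) < n := by exact_mod_cast hn
  rw [sbTotal, inv_mul_le_iff₀ hn', inv_mul_le_iff₀ hn']
  calc _ ≤ ∑ _i ∈ Finset.range n, ∑ _j ∈ Finset.range n, (1 : ℝ) :=
        Finset.sum_le_sum fun _ _ => Finset.sum_le_sum fun _ _ => pow_le_one₀ h0 h1.le
    _ = _ := by simp

/-- The weight is a convex combination of `q^k` and `q^(n-k)`. -/
lemma sbWeight_mem {n k : ℕ} (hn : 1 ≤ n) (hk : k ≤ n) : sbWeight n q k ∈ Set.Icc 0 1 := by
  have hn' : (0 : ℝ) < n := by exact_mod_cast hn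
  have hk' : (k : ℝ) ≤ n := by exact_mod_cast hk
  have e1 := pow_nonneg h0 k
  have e2 := pow_nonneg h0 (n - k)
  have e3 : q ^ k ≤ 1 := pow_le_one₀ h0 h1.le
  have e4 : q ^ (n - k) ≤ 1 := pow_le_one₀ h0 h1.le
  have hk0 : (0 : ℝ) ≤ k := by positivity
  constructor
  · exact mul_nonneg (by positivity)
      (add_nonneg (mul_nonneg (by linarith) e1) (mul_nonneg hk0 e2))
  · rw [sbWeight, inv_mul_le_iff₀ hn']
    nlinarith [mul_le_mul_of_nonneg_left e3 (sub_nonneg.2 hk'), mul_le_mul_of_nonneg_left e4 hk0]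

lemma abs_sbArray_le {n : ℕ} (hn : 1 ≤ n) (x : ℤ × ℤ) : |sbArray n q x| ≤ (n : ℝ)⁻¹ := by
  have hn' : (0 : ℝ) < n := by exact_mod_cast hn
  unfold sbArray
  split_ifs with h
  · obtain ⟨⟨a1, a2⟩, a3, a4⟩ := h
    obtain ⟨b1, b2⟩ := sbWeight_mem h0 h1 hn (k := (x.1 - x.2).natAbs) (by omega)
    have c1 := inv_mul_sbTotal_le_one h0 h1 hn
    have c2 : 0 ≤ (n : ℝ)⁻¹ * sbTotal n q := mul_nonneg (by positivity) (sbTotal_nonneg h0 n)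
    rw [abs_mul, abs_of_nonneg (by positivity)]
    refine mul_le_of_le_one_right (by positivity) ?_
    rw [abs_le]; constructor <;> linarith
  · rw [abs_zero]; positivity

/-- With `L = (1 - q)⁻¹`, which is `ℓ` in the application, each entry differs by `n⁻¹ (-A + B - C)`:
`A = (k/n) q^k` from tapering, `B = (k/n) q^(n-k)` from wrapping, `C` from the sample mean. Their
sums of squares are at most `2L²`, `2L²` and `4L²`, so the constant is `24 = 3 (2 + 2 + 4)`. The
order `ℓ²/n²` is negligible against `ℓ/n`. -/
lemma sqSum_sbArray_sub_le {n : ℕ} (hn : 1 ≤ n) :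
    sqSum (fun x => sbArray n q x - expArray n q x) ≤
      24 * ((1 - q)⁻¹ ^ 2 * (n : ℝ)⁻¹ ^ 2) := by
  have hn' : (0 : ℝ) < n := by exact_mod_cast hn
  set L := (1 - q)⁻¹ with hL
  have hL0 : 0 ≤ L := inv_nonneg.2 (by linarith)
  rw [sqSum_eq_sum_range (n := n) fun x hx => by
    rw [sbArray_of_not_mem x hx, expArray_of_not_mem x hx, sub_zero]]
  have hterm : ∀ i ∈ Finset.range n, ∀ j ∈ Finset.range n,
      (sbArray n q (i, j) - expArray n q (i, j)) ^ 2 ≤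
      3 * (n : ℝ)⁻¹ ^ 2 * (L * (n : ℝ)⁻¹ * q ^ ((i : ℤ) - j).natAbs +
        (fun k : ℕ => ((k : ℝ) * (n : ℝ)⁻¹ * q ^ (n - k)) ^ 2) ((i : ℤ) - j).natAbs +
        ((n : ℝ)⁻¹ * sbTotal n q) ^ 2) := by
    intro i hi j hj
    rw [Finset.mem_range] at hi hj
    rw [sbArray_natCast q hi hj, expArray_natCast q hi hj, sbWeight]
    set k := ((i : ℤ) - j).natAbs
    have hk : k ≤ n := by omega
    have hk1 : (k : ℝ) * (n : ℝ)⁻¹ ≤ 1 := by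
      rw [mul_inv_le_iff₀ hn', one_mul]; exact_mod_cast hk
    set A := (k : ℝ) * (n : ℝ)⁻¹ * q ^ k with hA
    set B := (k : ℝ) * (n : ℝ)⁻¹ * q ^ (n - k) with hB
    set C := (n : ℝ)⁻¹ * sbTotal n q
    have e : (n : ℝ)⁻¹ * ((n : ℝ)⁻¹ * (((n : ℝ) - k) * q ^ k + k * q ^ (n - k)) - C) -
        (n : ℝ)⁻¹ * q ^ k = (n : ℝ)⁻¹ * (- A + B - C) := by
      rw [hA, hB]; field_simp; ring
    -- One factor is bounded through `k q^k ≤ L`, the other through `k/n ≤ 1`; the surviving power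
    -- of `q` makes the double sum only `O(nL)`.
    have hAle : A ^ 2 ≤ L * (n : ℝ)⁻¹ * q ^ k := by
      have hp := pow_nonneg h0 k
      have hA1 : A ≤ L * (n : ℝ)⁻¹ := by
        have := mul_le_mul_of_nonneg_right (mul_pow_le h0 h1 k) (inv_nonneg.2 hn'.le)
        calc A = k * q ^ k * (n : ℝ)⁻¹ := by rw [hA]; ring
          _ ≤ _ := this
      have hA2 : A ≤ q ^ k := mul_le_of_le_one_left hp hk1
      have hA0 : 0 ≤ A := by positivity
      rw [sq]
      exact mul_le_mul hA1 hA2 hA0 (by positivity)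
    rw [e, mul_pow]
    have h3 : (-A + B - C) ^ 2 ≤ 3 * (A ^ 2 + B ^ 2 + C ^ 2) := by
      nlinarith [sq_nonneg (A + B), sq_nonneg (A - C), sq_nonneg (B + C)]
    have hn2 : 0 ≤ (n : ℝ)⁻¹ ^ 2 := by positivity
    calc (n : ℝ)⁻¹ ^ 2 * (-A + B - C) ^ 2
        ≤ (n : ℝ)⁻¹ ^ 2 * (3 * (A ^ 2 + B ^ 2 + C ^ 2)) := mul_le_mul_of_nonneg_left h3 hn2
      _ ≤ (n : ℝ)⁻¹ ^ 2 * (3 * (L * (n : ℝ)⁻¹ * q ^ k + B ^ 2 + C ^ 2)) := by gcongr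
      _ = _ := by ring
  refine (Finset.sum_le_sum fun i hi => Finset.sum_le_sum fun j hj => hterm i hi j hj).trans ?_
  simp only [← Finset.mul_sum, Finset.sum_add_distrib]
  have s1 : L * (n : ℝ)⁻¹ * ∑ i ∈ Finset.range n, ∑ j ∈ Finset.range n,
      q ^ ((i : ℤ) - j).natAbs ≤ 2 * L ^ 2 := by
    have := mul_le_mul_of_nonneg_left (sum_sum_pow_natAbs_le h0 h1 n)
      (show 0 ≤ L * (n : ℝ)⁻¹ by positivity)
    refine this.trans (le_of_eq ?_)
    rw [← hL]; field_simp
  have s2 : ∑ i ∈ Finset.range n, ∑ j ∈ Finset.range n,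
      ((((i : ℤ) - j).natAbs : ℝ) * (n : ℝ)⁻¹ * q ^ (n - ((i : ℤ) - j).natAbs)) ^ 2 ≤
      2 * L ^ 2 := by
    rw [sum_sum_natAbs n (fun k : ℕ => ((k : ℝ) * (n : ℝ)⁻¹ * q ^ (n - k)) ^ 2)]
    -- Wrapping is visible only near the corners: the diagonal with `r` cells carries at most `r
    -- q^(2r) ≤ L q^r`.
    have : ∑ k ∈ Finset.range n, ((n : ℝ) - (k + 1 : ℕ)) *
        (((k + 1 : ℕ) : ℝ) * (n : ℝ)⁻¹ * q ^ (n - (k + 1))) ^ 2 ≤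
        ∑ k ∈ Finset.range n, L * q ^ (n - 1 - k) := by
      refine Finset.sum_le_sum fun k hk => ?_
      rw [Finset.mem_range] at hk
      have hm : n - 1 - k = n - (k + 1) := by omega
      rw [hm, ← Nat.cast_sub hk]
      set r := n - (k + 1)
      have hk1 : ((k + 1 : ℕ) : ℝ) * (n : ℝ)⁻¹ ≤ 1 := by
        rw [mul_inv_le_iff₀ hn', one_mul]; exact_mod_cast hk
      have hr := pow_nonneg h0 r
      have hsq : (((k + 1 : ℕ) : ℝ) * (n : ℝ)⁻¹) ^ 2 ≤ 1 := pow_le_one₀ (by positivity) hk1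
      calc (r : ℝ) * (((k + 1 : ℕ) : ℝ) * (n : ℝ)⁻¹ * q ^ r) ^ 2
          = (((k + 1 : ℕ) : ℝ) * (n : ℝ)⁻¹) ^ 2 * ((r * q ^ r) * q ^ r) := by ring
        _ ≤ 1 * ((r * q ^ r) * q ^ r) := mul_le_mul_of_nonneg_right hsq (by positivity)
        _ ≤ L * q ^ r := by
          rw [one_mul]; exact mul_le_mul_of_nonneg_right (mul_pow_le h0 h1 r) hr
    rw [Finset.sum_range_reflect (fun k => L * q ^ k), ← Finset.mul_sum] at this
    have h4 := mul_le_mul_of_nonneg_left (sum_range_pow_le h0 h1 n) hL0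
    rw [← hL] at h4
    simp only [Nat.cast_zero, zero_mul, ne_eq, OfNat.ofNat_ne_zero, not_false_eq_true, zero_pow,
      mul_zero, zero_add]
    nlinarith
  have s3 : ∑ i ∈ Finset.range n, ∑ j ∈ Finset.range n, ((n : ℝ)⁻¹ * sbTotal n q) ^ 2 ≤
      4 * L ^ 2 := by
    simp only [Finset.sum_const, Finset.card_range, nsmul_eq_mul]
    have h5 := sbTotal_le h0 h1 hn
    have h6 := sbTotal_nonneg h0 n
    rw [← hL] at h5
    have : (n : ℝ) * (n * ((n : ℝ)⁻¹ * sbTotal n q) ^ 2) = sbTotal n q ^ 2 := by field_simp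
    rw [this]; nlinarith
  calc _ ≤ 3 * (n : ℝ)⁻¹ ^ 2 * (2 * L ^ 2 + 2 * L ^ 2 + 4 * L ^ 2) := by
        refine mul_le_mul_of_nonneg_left (add_le_add (add_le_add s1 s2) s3) (by positivity)
    _ = _ := by ring

/-- Inside the box `|i - j|` changes by one, so entries change by the factor `q` and the squares
carry `(1 - q)²`; summed, this is the first term. The two boundary rows lose whole entries and give
the term `4 (1 - q)⁻¹`. -/
lemma sqSum_expArray_shift_le {n : ℕ} (hn : 1 ≤ n) :
    sqSum (fun x => expArray n q x - expArray n q (x + (1, 0))) ≤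
      (n : ℝ)⁻¹ ^ 2 * (4 * ((1 - q) * (n + 1)) + 4 * (1 - q)⁻¹) := by
  have hn' : (0 : ℝ) < n := by exact_mod_cast hn
  set L := (1 - q)⁻¹ with hL
  -- The difference lives on rows `-1, …, n - 1`; moving it by one puts it into the box of side `n +
  -- 1`.
  rw [← sqSum_shift _ (-1, 0), sqSum_eq_sum_range (n := n + 1)]
  · have hterm : ∀ i ∈ Finset.range (n + 1), ∀ j ∈ Finset.range (n + 1),
        (expArray n q (((i : ℤ), (j : ℤ)) + (-1, 0)) -
          expArray n q (((i : ℤ), (j : ℤ)) + (-1, 0) + (1, 0))) ^ 2 ≤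
        (n : ℝ)⁻¹ ^ 2 * ((1 - q) ^ 2 * (q ^ (((i : ℤ) - 1) - j).natAbs + q ^ ((i : ℤ) - j).natAbs) +
          ((if i = 0 then q ^ ((0 : ℤ) - j).natAbs else 0) +
          (if i = n then q ^ (((n : ℤ) - 1) - j).natAbs else 0))) := by
      intro i hi j hj
      rw [Finset.mem_range] at hi hj
      have e1 : ((i : ℤ), (j : ℤ)) + (-1, 0) = ((i : ℤ) - 1, (j : ℤ)) := by
        ext <;> simp [sub_eq_add_neg]
      have e2 : ((i : ℤ) - 1, (j : ℤ)) + (1, 0) = ((i : ℤ), (j : ℤ)) := by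
        ext <;> simp
      rw [e1, e2]
      have hn2 : 0 ≤ (n : ℝ)⁻¹ ^ 2 := by positivity
      have hpow : ∀ k : ℕ, 0 ≤ q ^ k := fun k => pow_nonneg h0 k
      have hpow1 : ∀ k : ℕ, (q ^ k) ^ 2 ≤ q ^ k := fun k => by
        rw [sq]; exact mul_le_of_le_one_left (hpow k) (pow_le_one₀ h0 h1.le)
      have hnn : 0 ≤ (1 - q) ^ 2 * (q ^ (((i : ℤ) - 1) - j).natAbs + q ^ ((i : ℤ) - j).natAbs) :=
        mul_nonneg (sq_nonneg _) (add_nonneg (hpow _) (hpow _))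
      by_cases hjn : j < n
      · rcases Nat.eq_zero_or_pos i with rfl | hi0
        · have z : expArray n q (((0 : ℕ) : ℤ) - 1, (j : ℤ)) = 0 :=
            expArray_of_not_mem _ (by simp)
          rw [z, expArray_natCast q hn hjn, if_pos rfl, if_neg (by omega)]
          have := hpow1 (((0 : ℕ) : ℤ) - j).natAbs
          simp only [Nat.cast_zero] at this hnn ⊢
          rw [zero_sub, neg_sq, mul_pow]
          refine mul_le_mul_of_nonneg_left ?_ hn2
          linarith
        · have hc : ((i : ℤ) - 1) = ((i - 1 : ℕ) : ℤ) := by omega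
          rcases (Nat.lt_succ_iff.1 hi).lt_or_eq with hlt | rfl
          · rw [hc, expArray_natCast q (by omega) hjn, expArray_natCast q hlt hjn, if_neg (by omega),
              if_neg (by omega), ← mul_sub, mul_pow, add_zero, add_zero]
            refine mul_le_mul_of_nonneg_left ?_ hn2
            rw [← hc]
            rcases (show (((i : ℤ) - 1) - j).natAbs = ((i : ℤ) - j).natAbs + 1 ∨
              ((i : ℤ) - j).natAbs = (((i : ℤ) - 1) - j).natAbs + 1 by omega) with h | h
            · rw [h, pow_succ]
              set z := q ^ ((i : ℤ) - j).natAbs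
              have hz : 0 ≤ z := hpow _
              have hz2 : z ^ 2 ≤ z := hpow1 _
              calc (z * q - z) ^ 2 = (1 - q) ^ 2 * z ^ 2 := by ring
                _ ≤ (1 - q) ^ 2 * (z * q + z) := mul_le_mul_of_nonneg_left
                  (by nlinarith [mul_nonneg hz h0]) (sq_nonneg _)
            · rw [h, pow_succ]
              set z := q ^ (((i : ℤ) - 1) - j).natAbs
              have hz : 0 ≤ z := hpow _
              have hz2 : z ^ 2 ≤ z := hpow1 _
              calc (z - z * q) ^ 2 = (1 - q) ^ 2 * z ^ 2 := by ring
                _ ≤ (1 - q) ^ 2 * (z + z * q) := mul_le_mul_of_nonneg_left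
                  (by nlinarith [mul_nonneg hz h0]) (sq_nonneg _)
          · have z : expArray i q ((i : ℤ), (j : ℤ)) = 0 := expArray_of_not_mem _ (by simp)
            rw [z, hc, expArray_natCast q (by omega) hjn, if_pos rfl, if_neg (by omega), sub_zero,
              mul_pow]
            refine mul_le_mul_of_nonneg_left ?_ hn2
            rw [hc] at hnn
            have := hpow1 (((i - 1 : ℕ) : ℤ) - j).natAbs
            linarith
      · have z : ∀ i : ℤ, expArray n q (i, (j : ℤ)) = 0 := fun i =>
          expArray_of_not_mem _ (by simp; omega)
        rw [z, z, sub_zero, zero_pow two_ne_zero]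
        refine mul_nonneg hn2 (add_nonneg hnn (add_nonneg ?_ ?_))
        · split_ifs
          · exact hpow _
          · exact le_rfl
        · split_ifs
          · exact hpow _
          · exact le_rfl
    refine (Finset.sum_le_sum fun i hi => Finset.sum_le_sum fun j hj => hterm i hi j hj).trans ?_
    simp only [← Finset.mul_sum]
    refine mul_le_mul_of_nonneg_left ?_ (by positivity)
    simp only [Finset.sum_add_distrib, ← Finset.mul_sum]
    have r := sum_range_pow_natAbs_le h0 h1 (n + 1)
    have t1 : ∑ i ∈ Finset.range (n + 1), ∑ j ∈ Finset.range (n + 1),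
        q ^ (((i : ℤ) - 1) - j).natAbs ≤ (n + 1) * (2 * L) := by
      refine (Finset.sum_le_sum fun i _ => r _).trans ?_
      simp [hL]
    have t2 : ∑ i ∈ Finset.range (n + 1), ∑ j ∈ Finset.range (n + 1),
        q ^ ((i : ℤ) - j).natAbs ≤ (n + 1) * (2 * L) := by
      refine (Finset.sum_le_sum fun i _ => r _).trans ?_
      simp [hL]
    have t3 : ∑ i ∈ Finset.range (n + 1), ∑ j ∈ Finset.range (n + 1),
        (if i = 0 then q ^ ((0 : ℤ) - j).natAbs else 0) ≤ 2 * L := by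
      rw [Finset.sum_eq_single 0]
      · simpa using r 0
      · intro b _ hb; simp [hb]
      · simp
    have t4 : ∑ i ∈ Finset.range (n + 1), ∑ j ∈ Finset.range (n + 1),
        (if i = n then q ^ (((n : ℤ) - 1) - j).natAbs else 0) ≤ 2 * L := by
      rw [Finset.sum_eq_single n]
      · simpa using r ((n : ℤ) - 1)
      · intro b _ hb; simp [hb]
      · simp
    have hq : (1 - q) ^ 2 * (2 * ((n + 1) * (2 * L))) = 4 * ((1 - q) * (n + 1)) := by
      have : (1 - q) ≠ 0 := by linarith
      rw [hL]; field_simp; ring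
    have h5 := mul_le_mul_of_nonneg_left (add_le_add t1 t2) (sq_nonneg (1 - q))
    linarith
  · rintro ⟨i, j⟩ hx
    have z1 : expArray n q ((i, j) + (-1, 0)) = 0 := expArray_of_not_mem _ fun h => hx (by
      simp only [Prod.mk_add_mk, Set.mem_Ico] at h ⊢
      push_cast; omega)
    have z2 : expArray n q ((i, j) + (-1, 0) + (1, 0)) = 0 := expArray_of_not_mem _ fun h => hx (by
      simp only [Prod.mk_add_mk, Set.mem_Ico] at h ⊢
      push_cast; omega)
    rw [z1, z2, sub_zero]

/-- By diagonals, `n ‖a‖² = 1 + 2 ∑ (1 - k/n) q^(2k)`. Dropping `k/n` gives the upper bound;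
completing the series adds only nonpositive terms and gives the lower one. The main value is `(1 -
q)(1 + 2q²/(1 - q²)) = (1 + q²)/(1 + q)`. -/
lemma sqSum_expArray_mem {n : ℕ} (hn : 1 ≤ n) :
    n * (1 - q) * sqSum (expArray n q) ∈
      Set.Icc ((1 + q ^ 2) / (1 + q) - 2 * ((1 - q)⁻¹ * (n : ℝ)⁻¹)) ((1 + q ^ 2) / (1 + q)) := by
  have hn' : (0 : ℝ) < n := by exact_mod_cast hn
  have hq2 : q ^ 2 < 1 := by nlinarith
  have hq20 : 0 ≤ q ^ 2 := sq_nonneg q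
  set Q := q ^ 2 with hQ
  have hval : sqSum (expArray n q) = (n : ℝ)⁻¹ * (1 + 2 * ∑ k ∈ Finset.range n,
      (1 - ((k + 1 : ℕ) : ℝ) * (n : ℝ)⁻¹) * Q ^ (k + 1)) := by
    rw [sqSum_eq_sum_range expArray_of_not_mem]
    have : ∀ i ∈ Finset.range n, ∀ j ∈ Finset.range n, expArray n q (i, j) ^ 2 =
        (n : ℝ)⁻¹ ^ 2 * (fun k : ℕ => Q ^ k) ((i : ℤ) - j).natAbs := by
      intro i hi j hj
      rw [expArray_natCast q (Finset.mem_range.1 hi) (Finset.mem_range.1 hj), mul_pow, hQ]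
      congr 1
      simp only
      rw [← pow_mul, ← pow_mul, mul_comm]
    rw [Finset.sum_congr rfl fun i hi => Finset.sum_congr rfl fun j hj => this i hi j hj]
    simp only [← Finset.mul_sum]
    rw [sum_sum_natAbs n (fun k => Q ^ k), pow_zero, mul_one]
    have e : ∑ k ∈ Finset.range n, ((n : ℝ) - (k + 1 : ℕ)) * Q ^ (k + 1) =
        n * ∑ k ∈ Finset.range n, (1 - ((k + 1 : ℕ) : ℝ) * (n : ℝ)⁻¹) * Q ^ (k + 1) := by
      rw [Finset.mul_sum]
      refine Finset.sum_congr rfl fun k _ => ?_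
      field_simp
    rw [e]; field_simp
  have hs1 : HasSum (fun k : ℕ => Q ^ (k + 1)) (Q * (1 - Q)⁻¹) := by
    simpa [pow_succ'] using (hasSum_geometric_of_lt_one hq20 hq2).mul_left Q
  have hs2 : HasSum (fun k : ℕ => ((k + 1 : ℕ) : ℝ) * Q ^ (k + 1)) (Q / (1 - Q) ^ 2) := by
    have h := hasSum_coe_mul_geometric_of_norm_lt_one (r := Q)
      (by rwa [Real.norm_of_nonneg hq20])
    rw [← hasSum_nat_add_iff' 1] at h
    simpa using h
  have hs : HasSum (fun k : ℕ => (1 - ((k + 1 : ℕ) : ℝ) * (n : ℝ)⁻¹) * Q ^ (k + 1))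
      (Q * (1 - Q)⁻¹ - Q / (1 - Q) ^ 2 * (n : ℝ)⁻¹) := by
    have e : (fun k : ℕ => (1 - ((k + 1 : ℕ) : ℝ) * (n : ℝ)⁻¹) * Q ^ (k + 1)) =
        fun k => Q ^ (k + 1) - ((k + 1 : ℕ) : ℝ) * Q ^ (k + 1) * (n : ℝ)⁻¹ := by
      ext k; ring
    rw [e]; exact hs1.sub (hs2.mul_right (n : ℝ)⁻¹)
  set S := ∑ k ∈ Finset.range n, (1 - ((k + 1 : ℕ) : ℝ) * (n : ℝ)⁻¹) * Q ^ (k + 1) with hS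
  have hlow : Q * (1 - Q)⁻¹ - Q / (1 - Q) ^ 2 * (n : ℝ)⁻¹ ≤ S := by
    rw [← hs.tsum_eq, ← hs.summable.sum_add_tsum_nat_add n]
    have : ∑' k : ℕ, (1 - ((k + n + 1 : ℕ) : ℝ) * (n : ℝ)⁻¹) * Q ^ (k + n + 1) ≤ 0 := by
      refine tsum_nonpos fun k => mul_nonpos_of_nonpos_of_nonneg ?_ (pow_nonneg hq20 _)
      rw [sub_nonpos, ← div_eq_mul_inv, one_le_div hn']
      push_cast
      linarith [(Nat.cast_nonneg k : (0 : ℝ) ≤ k)]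
    linarith
  have hup : S ≤ Q * (1 - Q)⁻¹ := by
    rw [← hs1.tsum_eq]
    refine le_trans (Finset.sum_le_sum fun k _ => ?_)
      (hs1.summable.sum_le_tsum (Finset.range n) fun _ _ => pow_nonneg hq20 _)
    refine mul_le_of_le_one_left (pow_nonneg hq20 _) ?_
    have : 0 ≤ ((k + 1 : ℕ) : ℝ) * (n : ℝ)⁻¹ := by positivity
    linarith
  have hp : 0 < 1 - q := by linarith
  have hp' : 0 < 1 + q := by linarith
  have hfac : 1 - Q = (1 - q) * (1 + q) := by rw [hQ]; ring
  have hmain : (1 - q) * (1 + 2 * (Q * (1 - Q)⁻¹)) = (1 + Q) / (1 + q) := by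
    rw [hfac, hQ]; field_simp; ring
  rw [hval]
  have e : n * (1 - q) * ((n : ℝ)⁻¹ * (1 + 2 * S)) = (1 - q) * (1 + 2 * S) := by field_simp
  rw [e]
  constructor
  · have h3 : (1 - q) * (2 * (Q / (1 - Q) ^ 2 * (n : ℝ)⁻¹)) ≤ 2 * ((1 - q)⁻¹ * (n : ℝ)⁻¹) := by
      have : (1 - q) * (2 * (Q / (1 - Q) ^ 2 * (n : ℝ)⁻¹)) =
          (Q / (1 + q) ^ 2) * (2 * ((1 - q)⁻¹ * (n : ℝ)⁻¹)) := by
        rw [hfac]; field_simp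
      rw [this]
      refine mul_le_of_le_one_left (by positivity) ?_
      rw [div_le_one (by positivity), hQ]
      nlinarith
    have h4 := mul_le_mul_of_nonneg_left hlow hp.le
    nlinarith
  · have h4 := mul_le_mul_of_nonneg_left hup hp.le
    nlinarith

end Geometric

end StationaryBootstrap

namespace StationaryBootstrap

variable {Ω : Type*} [MeasurableSpace Ω] {X : ℤ → Ω → ℝ} {μ : Measure Ω}
  [IsProbabilityMeasure μ]

/-! ### Variance of the stationary bootstrap estimator -/

lemma one_sub_one_sub_inv (ℓ : ℝ) : (1 - (1 - ℓ⁻¹))⁻¹ = ℓ := by simp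

lemma one_sub_inv_mem {ℓ : ℝ} (hℓ : 1 < ℓ) : 0 ≤ 1 - ℓ⁻¹ ∧ 1 - ℓ⁻¹ < 1 := by
  have h1 : ℓ⁻¹ ≤ 1 := inv_le_one_of_one_le₀ hℓ.le
  have h2 : 0 < ℓ⁻¹ := by positivity
  constructor <;> linarith

/-- The first-order variance of the stationary bootstrap estimator. -/
theorem sb_variance (hX : IsStrictlyStationary X μ) (hA1 : CondA1 X μ)
    (hA2 : CondA2 X μ) {ℓ : ℕ → ℝ} (hℓ : ∀ᶠ n in atTop, 1 < ℓ n) (hA3 : CondA3 ℓ) :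
    (∀ᶠ n : ℕ in atTop, MemLp (fun ω => sbEstimator n (ℓ n) (data X ω)) 2 μ) ∧
    (fun n : ℕ => Var[fun ω => sbEstimator n (ℓ n) (data X ω); μ]
      - ℓ n / n * (2 * (2 * Real.pi * spectralDensity X μ 0) ^ 2))
      =o[atTop] (fun n : ℕ => ℓ n / n) := by
  have hdiv := tendsto_div_of_log hA3.2
  have hinv : Tendsto (fun n => (ℓ n)⁻¹) atTop (𝓝 0) := tendsto_inv_atTop_zero.comp hA3.1
  have hninv : Tendsto (fun n : ℕ => (n : ℝ)⁻¹) atTop (𝓝 0) := tendsto_inv_atTop_nhds_zero_nat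
  have hq : Tendsto (fun n => 1 - (ℓ n)⁻¹) atTop (𝓝 1) := by
    simpa using hinv.const_sub 1
  have hev : ∀ᶠ n in atTop, (fun ω => sbEstimator n (ℓ n) (data X ω)) =
      quadForm X μ (sbArray n (1 - (ℓ n)⁻¹)) n := by
    filter_upwards [hℓ, eventually_ge_atTop 1] with n h1 h2
    ext ω
    exact sbEstimator_eq_quadForm h2 h1 ω
  -- Four moments put the quadratic form in `L²`, so the variance below is not a default value.
  refine ⟨hev.mono fun n h => h ▸ hX.memLp_quadForm hA2.1 _ _, ?_⟩
  rw [two_pi_mul_spectralDensity_zero]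
  refine isLittleO_of_tendsto_mul (hℓ.mono fun n h => by linarith) ?_
  have hc : ∀ᶠ n : ℕ in atTop, 0 ≤ (n : ℝ) / ℓ n := hℓ.mono fun n h =>
    div_nonneg (Nat.cast_nonneg n) (by linarith)
  have key := hX.tendsto_variance_quadForm hA1 hA2 (c := fun n => (n : ℝ) / ℓ n)
    (M := fun n => (n : ℝ)⁻¹) (N := fun n => n)
    (a := fun n => sbArray n (1 - (ℓ n)⁻¹)) (a' := fun n => expArray n (1 - (ℓ n)⁻¹))
    hc (fun n i j => sbArray_symm _ _ i j) (fun n i j => expArray_symm _ _ i j)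
    (fun n x hx => sbArray_of_not_mem x hx) (fun n x hx => expArray_of_not_mem x hx)
    ?_ ?_ ?_ ?_ ?_
  · refine key.congr' ?_
    filter_upwards [hev] with n hn
    rw [hn]
  · filter_upwards [hℓ, eventually_ge_atTop 1] with n h1 h2 x
    exact abs_sbArray_le (one_sub_inv_mem h1).1 (one_sub_inv_mem h1).2 h2 x
  · refine hinv.congr' ?_
    filter_upwards [hℓ, eventually_ge_atTop 1] with n h1 h2
    have : (n : ℝ) ≠ 0 := by positivity
    field_simp
  · have hu : Tendsto (fun n => (1 + (1 - (ℓ n)⁻¹) ^ 2) / (1 + (1 - (ℓ n)⁻¹))) atTop (𝓝 1) := by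
      have h := ((hq.pow 2).const_add 1).div (hq.const_add 1) (by norm_num)
      have e : ((1 + 1 ^ 2) / (1 + 1) : ℝ) = 1 := by norm_num
      rw [e] at h
      exact h
    have hl := hu.sub (hdiv.const_mul 2)
    rw [mul_zero, sub_zero] at hl
    refine tendsto_of_tendsto_of_tendsto_of_le_of_le' hl hu ?_ ?_
    all_goals
      filter_upwards [hℓ, eventually_ge_atTop 1] with n h1 h2
      have h := sqSum_expArray_mem (one_sub_inv_mem h1).1 (one_sub_inv_mem h1).2 h2
      rw [one_sub_one_sub_inv, sub_sub_cancel, ← div_eq_mul_inv, ← div_eq_mul_inv] at h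
    · exact h.1
    · exact h.2
  -- Multiplying the shift bound by `n/ℓ` gives exactly `4 (1 + 1/n) ℓ⁻² + 4/n`.
  · have h := ((hninv.const_add 1).mul (hinv.pow 2)).const_mul 4 |>.add (hninv.const_mul 4)
    simp only [ne_eq, OfNat.ofNat_ne_zero, not_false_eq_true, zero_pow, mul_zero, add_zero] at h
    refine squeeze_zero' (hc.mono fun n h => mul_nonneg h (sqSum_nonneg _)) ?_ h
    filter_upwards [hℓ, hc, eventually_ge_atTop 1] with n h1 hcn h2
    have h3 := sqSum_expArray_shift_le (one_sub_inv_mem h1).1 (one_sub_inv_mem h1).2 h2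
    rw [one_sub_one_sub_inv, sub_sub_cancel] at h3
    refine (mul_le_mul_of_nonneg_left h3 hcn).trans (le_of_eq ?_)
    have : (n : ℝ) ≠ 0 := by positivity
    have : ℓ n ≠ 0 := by positivity
    field_simp
  · have h := hdiv.const_mul 24
    rw [mul_zero] at h
    refine squeeze_zero' (hc.mono fun n h => mul_nonneg h (sqSum_nonneg _)) ?_ h
    filter_upwards [hℓ, hc, eventually_ge_atTop 1] with n h1 hcn h2
    have h3 := sqSum_sbArray_sub_le (one_sub_inv_mem h1).1 (one_sub_inv_mem h1).2 h2
    rw [one_sub_one_sub_inv] at h3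
    refine (mul_le_mul_of_nonneg_left h3 hcn).trans (le_of_eq ?_)
    have : (n : ℝ) ≠ 0 := by positivity
    have : ℓ n ≠ 0 := by positivity
    field_simp

/-! ### The bias of the stationary bootstrap estimator -/

lemma sigmaSq_eq (hX : IsStrictlyStationary X μ) (h2 : MemLp (X 0) 2 μ) (n : ℕ) :
    sigmaSq X μ n = (n : ℝ)⁻¹ * ∑ i ∈ Finset.range n, ∑ j ∈ Finset.range n,
      autocov X μ ((j : ℤ) - i) := by
  have hsum : ∀ ω, ∑ t ∈ Finset.Icc 1 n, X (t : ℤ) ω = ∑ i ∈ Finset.range n, X ((i : ℤ) + 1) ω := by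
    intro ω
    have h := Finset.sum_Ico_add' (fun t : ℕ => X (t : ℤ) ω) 0 n 1
    simp only [Nat.cast_add, Nat.cast_one] at h
    rw [Finset.range_eq_Ico, h]
    congr 1
  simp only [sigmaSq, hsum]
  rw [variance_const_mul, variance_fun_sum' fun i _ => hX.memLp h2 _]
  simp only [hX.cov_eq, add_sub_add_right_eq_sub]
  rcases Nat.eq_zero_or_pos n with rfl | hn
  · simp
  · have : (n : ℝ) ≠ 0 := by positivity
    field_simp

omit [IsProbabilityMeasure μ] in
lemma abs_sum_sum_autocov_le (hX : IsStrictlyStationary X μ) (hA1 : CondA1 X μ) (n : ℕ) :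
    |∑ i ∈ Finset.range n, ∑ j ∈ Finset.range n, autocov X μ ((j : ℤ) - i)| ≤
      n * ∑' k, |autocov X μ k| := by
  have hs := (hX.summable_autocov hA1).abs
  calc _ ≤ ∑ i ∈ Finset.range n, ∑ j ∈ Finset.range n, |autocov X μ ((j : ℤ) - i)| :=
        (Finset.abs_sum_le_sum_abs _ _).trans
          (Finset.sum_le_sum fun i _ => Finset.abs_sum_le_sum_abs _ _)
    _ ≤ ∑ _i ∈ Finset.range n, ∑' k, |autocov X μ k| := by
        refine Finset.sum_le_sum fun i _ => ?_
        have hinj : Function.Injective fun j : ℕ => (j : ℤ) - i := fun a b hab => by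
          simp only at hab; omega
        exact ((hs.comp_injective hinj).sum_le_tsum (Finset.range n)
          fun _ _ => abs_nonneg _).trans (tsum_comp_le_tsum_of_inj hs (fun _ => abs_nonneg _) hinj)
    _ = _ := by simp

/-- Both quantities are sums of `r(j - i)` over the square, `σ_n²` with all weights equal to one.
Collecting by lags leaves the weight error, which is zero at lag 0, and the sample-mean correction.
-/
lemma integral_sbEstimator_sub (hX : IsStrictlyStationary X μ) (hA1 : CondA1 X μ) {n : ℕ}
    (hn : 1 ≤ n) {ℓ : ℝ} (hℓ : 1 < ℓ) :
    (∫ ω, sbEstimator n ℓ (data X ω) ∂μ) - sigmaSq X μ n =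
      2 * ∑ k ∈ Finset.range n, (1 - ((k + 1 : ℕ) : ℝ) * (n : ℝ)⁻¹) *
        ((sbWeight n (1 - ℓ⁻¹) (k + 1) - 1) * autocov X μ (k + 1 : ℕ)) -
      (n : ℝ)⁻¹ * ((n : ℝ)⁻¹ * sbTotal n (1 - ℓ⁻¹)) *
        ∑ i ∈ Finset.range n, ∑ j ∈ Finset.range n, autocov X μ ((j : ℤ) - i) := by
  have hn' : (n : ℝ) ≠ 0 := by positivity
  simp only [sbEstimator_eq_quadForm (μ := μ) hn hℓ]
  rw [hX.integral_quadForm hA1.1, sigmaSq_eq hX hA1.1]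
  set q := 1 - ℓ⁻¹
  set v := (n : ℝ)⁻¹ * sbTotal n q
  have h1 : ∀ i ∈ Finset.range n, ∀ j ∈ Finset.range n,
      sbArray n q (i, j) * autocov X μ ((j : ℤ) - i) =
      (n : ℝ)⁻¹ * (fun k : ℕ => (sbWeight n q k - 1) * autocov X μ k) ((i : ℤ) - j).natAbs +
      (n : ℝ)⁻¹ * autocov X μ ((j : ℤ) - i) - (n : ℝ)⁻¹ * v * autocov X μ ((j : ℤ) - i) := by
    intro i hi j hj
    rw [sbArray_natCast q (Finset.mem_range.1 hi) (Finset.mem_range.1 hj)]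
    simp only
    rw [natAbs_sub_comm', hX.autocov_natAbs]
    ring
  rw [Finset.sum_congr rfl fun i hi => Finset.sum_congr rfl fun j hj => h1 i hi j hj]
  simp only [Finset.sum_add_distrib, Finset.sum_sub_distrib, ← Finset.mul_sum]
  rw [sum_sum_natAbs n (fun k : ℕ => (sbWeight n q k - 1) * autocov X μ k)]
  have hW : sbWeight n q 0 = 1 := by simp [sbWeight, hn']
  have e : ∑ k ∈ Finset.range n, ((n : ℝ) - (k + 1 : ℕ)) *
      ((sbWeight n q (k + 1) - 1) * autocov X μ (k + 1 : ℕ)) =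
      n * ∑ k ∈ Finset.range n, (1 - ((k + 1 : ℕ) : ℝ) * (n : ℝ)⁻¹) *
        ((sbWeight n q (k + 1) - 1) * autocov X μ (k + 1 : ℕ)) := by
    rw [Finset.mul_sum]
    refine Finset.sum_congr rfl fun k _ => ?_
    field_simp
  rw [e, hW]
  field_simp
  ring

omit [IsProbabilityMeasure μ] in
lemma tsum_abs_mul_autocov (hX : IsStrictlyStationary X μ) (hA1 : CondA1 X μ) :
    ∑' k : ℤ, |(k : ℝ)| * autocov X μ k =
      2 * ∑' k : ℕ, ((k + 1 : ℕ) : ℝ) * autocov X μ (k + 1 : ℕ) := by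
  have hs : Summable fun k : ℕ => ((k + 1 : ℕ) : ℝ) * autocov X μ (k + 1 : ℕ) := by
    have h : Summable fun k : ℕ => (k : ℝ) * autocov X μ k :=
      Summable.of_abs (by simpa [abs_mul] using hA1.2)
    exact (summable_nat_add_iff 1).2 h
  have h0 : HasSum (fun k : ℕ => |((k : ℤ) : ℝ)| * autocov X μ (k : ℤ))
      (∑' k : ℕ, ((k + 1 : ℕ) : ℝ) * autocov X μ (k + 1 : ℕ)) := by
    rw [← hasSum_nat_add_iff' 1]
    have e : ∀ k : ℕ, |(((k + 1 : ℕ) : ℤ) : ℝ)| = ((k + 1 : ℕ) : ℝ) := fun k => by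
      simp [abs_of_nonneg, add_nonneg]
    simp only [e]
    simpa using hs.hasSum
  have h1 : HasSum (fun k : ℕ => |((-((k : ℤ) + 1) : ℤ) : ℝ)| * autocov X μ (-((k : ℤ) + 1)))
      (∑' k : ℕ, ((k + 1 : ℕ) : ℝ) * autocov X μ (k + 1 : ℕ)) := by
    convert! hs.hasSum using 2 with k
    rw [hX.autocov_neg]
    push_cast
    rw [abs_neg, abs_of_nonneg (by positivity)]
  rw [(HasSum.of_nat_of_neg_add_one (f := fun k : ℤ => |(k : ℝ)| * autocov X μ k) h0 h1).tsum_eq]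
  ring

/-- The error is `(q^k - 1) + (k/n)(q^(n-k) - q^k)`; Bernoulli's inequality bounds the first part.
Times `ℓ` the bound is `k (1 + ℓ/n)`, the domination matching A.1. -/
lemma abs_sbWeight_sub_one_le {q : ℝ} (h0 : 0 ≤ q) (h1 : q < 1) {n k : ℕ} (hn : 1 ≤ n) :
    |sbWeight n q k - 1| ≤ k * (1 - q) + k * (n : ℝ)⁻¹ := by
  have hn' : (0 : ℝ) < n := by exact_mod_cast hn
  have e : sbWeight n q k - 1 = (q ^ k - 1) + k * (n : ℝ)⁻¹ * (q ^ (n - k) - q ^ k) := by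
    rw [sbWeight]; field_simp; ring
  have b1 : 1 - k * (1 - q) ≤ q ^ k := by
    have := one_add_mul_le_pow (a := q - 1) (by linarith) k
    simp only [add_sub_cancel] at this
    linarith
  have e1 := pow_nonneg h0 k
  have e2 := pow_nonneg h0 (n - k)
  have e3 : q ^ k ≤ 1 := pow_le_one₀ h0 h1.le
  have e4 : q ^ (n - k) ≤ 1 := pow_le_one₀ h0 h1.le
  have b2 : |q ^ (n - k) - q ^ k| ≤ 1 := abs_le.2 ⟨by linarith, by linarith⟩
  have b3 : |q ^ k - 1| ≤ k * (1 - q) := abs_le.2 ⟨by linarith, by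
    have : 0 ≤ (k : ℝ) * (1 - q) := mul_nonneg (by positivity) (by linarith)
    linarith⟩
  have hk0 : 0 ≤ (k : ℝ) * (n : ℝ)⁻¹ := by positivity
  rw [e]
  refine (abs_add_le _ _).trans (add_le_add b3 ?_)
  rw [abs_mul, abs_of_nonneg hk0]
  exact mul_le_of_le_one_right hk0 b2

/-- The first-order bias of the stationary bootstrap estimator. -/
theorem sb_bias (hX : IsStrictlyStationary X μ) (hA1 : CondA1 X μ) {ℓ : ℕ → ℝ}
    (hℓ : ∀ᶠ n in atTop, 1 < ℓ n)
    (hlim : Tendsto (fun n : ℕ => (ℓ n)⁻¹ + ℓ n ^ 2 / n) atTop (𝓝 0)) :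
    (∀ᶠ n : ℕ in atTop, Integrable (fun ω => sbEstimator n (ℓ n) (data X ω)) μ) ∧
    (fun n : ℕ => (∫ ω, sbEstimator n (ℓ n) (data X ω) ∂μ) - sigmaSq X μ n
      - (-(∑' k : ℤ, |(k : ℝ)| * autocov X μ k) / ℓ n)) =o[atTop] (fun n : ℕ => 1 / ℓ n) := by
  have hinv : Tendsto (fun n => (ℓ n)⁻¹) atTop (𝓝 0) := by
    refine squeeze_zero' (hℓ.mono fun n h => inv_nonneg.2 (by linarith)) ?_ hlim
    exact Eventually.of_forall fun n => le_add_of_nonneg_right (by positivity)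
  have hsq : Tendsto (fun n : ℕ => ℓ n ^ 2 / n) atTop (𝓝 0) := by
    simpa using hlim.sub hinv
  have hdiv : Tendsto (fun n : ℕ => ℓ n / n) atTop (𝓝 0) := by
    refine squeeze_zero' (hℓ.mono fun n h => div_nonneg (by linarith) (by positivity)) ?_ hsq
    filter_upwards [hℓ] with n h
    gcongr
    nlinarith
  have hninv : Tendsto (fun n : ℕ => (n : ℝ)⁻¹) atTop (𝓝 0) := tendsto_inv_atTop_nhds_zero_nat
  have hq : Tendsto (fun n => 1 - (ℓ n)⁻¹) atTop (𝓝 1) := by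
    simpa using hinv.const_sub 1
  refine ⟨?_, ?_⟩
  · filter_upwards [hℓ, eventually_ge_atTop 1] with n h1 h2
    simp only [sbEstimator_eq_quadForm (μ := μ) h2 h1]
    exact hX.integrable_quadForm hA1.1 _ _
  set R := ∑' k, |autocov X μ k|
  have hR : 0 ≤ R := tsum_nonneg fun _ => abs_nonneg _
  set D : ℕ → ℝ := fun n => ∑ i ∈ Finset.range n, ∑ j ∈ Finset.range n, autocov X μ ((j : ℤ) - i)
  -- Since `sbTotal ≤ 2ℓ` and `|D n| ≤ n R`, this is `O(ℓ²/n)`. Only here is the full rate `ℓ²/n →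
  -- 0` needed; elsewhere `ℓ/n → 0` suffices.
  have hmean : Tendsto (fun n : ℕ => ℓ n * ((n : ℝ)⁻¹ * ((n : ℝ)⁻¹ * sbTotal n (1 - (ℓ n)⁻¹)) *
      D n)) atTop (𝓝 0) := by
    have h := hsq.const_mul (2 * R)
    rw [mul_zero] at h
    refine squeeze_zero_norm' ?_ h
    filter_upwards [hℓ, eventually_ge_atTop 1] with n h1 h2
    have hn : (0 : ℝ) < n := by exact_mod_cast h2
    have hV0 := sbTotal_nonneg (one_sub_inv_mem h1).1 n
    have hV := sbTotal_le (one_sub_inv_mem h1).1 (one_sub_inv_mem h1).2 h2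
    rw [one_sub_one_sub_inv] at hV
    have hD : |D n| ≤ n * R := abs_sum_sum_autocov_le hX hA1 n
    have hl0 : 0 < ℓ n := by linarith
    rw [Real.norm_eq_abs, abs_mul, abs_mul, abs_of_pos hl0, abs_of_nonneg (by positivity)]
    calc ℓ n * ((n : ℝ)⁻¹ * ((n : ℝ)⁻¹ * sbTotal n (1 - (ℓ n)⁻¹)) * |D n|)
        ≤ ℓ n * ((n : ℝ)⁻¹ * ((n : ℝ)⁻¹ * (2 * ℓ n)) * (n * R)) := by gcongr
      _ = 2 * R * (ℓ n ^ 2 / n) := by field_simp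
  -- Extension by zero turns sums of growing length into series over a fixed index set; the index
  -- `k` stands for lag `k + 1`.
  set f : ℕ → ℕ → ℝ := fun n k => if k < n then (1 - ((k + 1 : ℕ) : ℝ) * (n : ℝ)⁻¹) *
    (ℓ n * (sbWeight n (1 - (ℓ n)⁻¹) (k + 1) - 1) * autocov X μ (k + 1 : ℕ)) else 0 with hf
  have hmain : Tendsto (fun n => ∑' k, f n k) atTop
      (𝓝 (∑' k : ℕ, -(((k + 1 : ℕ) : ℝ) * autocov X μ (k + 1 : ℕ)))) := by
    refine tendsto_tsum_of_dominated_convergence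
      (bound := fun k => 2 * (((k + 1 : ℕ) : ℝ) * |autocov X μ (k + 1 : ℕ)|)) ?_ ?_ ?_
    · exact ((summable_nat_add_iff (f := fun k : ℕ => (k : ℝ) * |autocov X μ k|) 1).2
        hA1.2).mul_left 2
    · intro k
      have t1 : Tendsto (fun n : ℕ => 1 - ((k + 1 : ℕ) : ℝ) * (n : ℝ)⁻¹) atTop (𝓝 1) := by
        simpa using (hninv.const_mul ((k + 1 : ℕ) : ℝ)).const_sub 1
      -- Because `1 - q = ℓ⁻¹`, this geometric sum is `ℓ (q^(k+1) - 1)`, and each of its `k + 1`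
      -- powers tends to 1.
      have t2 : Tendsto (fun n : ℕ => -∑ i ∈ Finset.range (k + 1), (1 - (ℓ n)⁻¹) ^ i) atTop
          (𝓝 (-((k + 1 : ℕ) : ℝ))) := by
        have := (tendsto_finsetSum (Finset.range (k + 1)) fun i _ => hq.pow i).neg
        simpa using this
      have t3 : Tendsto (fun n : ℕ => ((k + 1 : ℕ) : ℝ) * (ℓ n / n) *
          ((1 - (ℓ n)⁻¹) ^ (n - (k + 1)) - (1 - (ℓ n)⁻¹) ^ (k + 1))) atTop (𝓝 0) := by
        have h := hdiv.const_mul ((k + 1 : ℕ) : ℝ)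
        rw [mul_zero] at h
        refine squeeze_zero_norm' ?_ h
        filter_upwards [hℓ] with n h1
        obtain ⟨h3, h4⟩ := one_sub_inv_mem h1
        have e1 := pow_nonneg h3 (k + 1)
        have e2 := pow_nonneg h3 (n - (k + 1))
        have e3 : (1 - (ℓ n)⁻¹) ^ (k + 1) ≤ 1 := pow_le_one₀ h3 h4.le
        have e4 : (1 - (ℓ n)⁻¹) ^ (n - (k + 1)) ≤ 1 := pow_le_one₀ h3 h4.le
        have hl : 0 ≤ ℓ n := by linarith
        have hpos : 0 ≤ ((k + 1 : ℕ) : ℝ) * (ℓ n / n) := by positivity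
        rw [Real.norm_eq_abs, abs_mul, abs_of_nonneg hpos]
        exact mul_le_of_le_one_right hpos (abs_le.2 ⟨by linarith, by linarith⟩)
      have h := t1.mul ((t2.add t3).mul_const (autocov X μ (k + 1 : ℕ)))
      rw [add_zero, one_mul, neg_mul] at h
      refine h.congr' ?_
      filter_upwards [hℓ, eventually_gt_atTop k] with n h1 h2
      rw [hf]
      simp only
      rw [if_pos h2]
      have hn : (n : ℝ) ≠ 0 := by
        have : 0 < n := by omega
        positivity
      have hl : ℓ n ≠ 0 := by positivity
      set q := 1 - (ℓ n)⁻¹ with hq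
      have hg := mul_neg_geom_sum q (k + 1)
      have hpq : 1 - q = (ℓ n)⁻¹ := by rw [hq]; ring
      have hgs : ∑ i ∈ Finset.range (k + 1), q ^ i = ℓ n * (1 - q ^ (k + 1)) := by
        rw [← hg, hpq]; field_simp
      rw [hgs, sbWeight]
      field_simp
      ring
    -- Eventually `ℓ/n ≤ 1`, so `1 + ℓ/n ≤ 2`; this is the factor 2 in the dominating series.
    · filter_upwards [hℓ, hdiv.eventually (eventually_le_nhds one_pos)] with n h1 h2 k
      rw [hf]
      simp only
      split_ifs with hk
      · obtain ⟨h3, h4⟩ := one_sub_inv_mem h1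
        have hn : (0 : ℝ) < n := by
          have : 0 < n := by omega
          exact_mod_cast this
        have hl : 0 < ℓ n := by linarith
        have hw := abs_sbWeight_sub_one_le h3 h4 (n := n) (k := k + 1) (by omega)
        rw [sub_sub_cancel] at hw
        have hk1 : ((k + 1 : ℕ) : ℝ) * (n : ℝ)⁻¹ ≤ 1 := by
          rw [mul_inv_le_iff₀ hn, one_mul]; exact_mod_cast hk
        have hk0 : 0 ≤ ((k + 1 : ℕ) : ℝ) * (n : ℝ)⁻¹ := by positivity
        have ha : |1 - ((k + 1 : ℕ) : ℝ) * (n : ℝ)⁻¹| ≤ 1 := abs_le.2 ⟨by linarith, by linarith⟩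
        have hb : ℓ n * |sbWeight n (1 - (ℓ n)⁻¹) (k + 1) - 1| ≤ 2 * ((k + 1 : ℕ) : ℝ) := by
          calc _ ≤ ℓ n * (((k + 1 : ℕ) : ℝ) * (ℓ n)⁻¹ + ((k + 1 : ℕ) : ℝ) * (n : ℝ)⁻¹) := by gcongr
            _ = ((k + 1 : ℕ) : ℝ) * (1 + ℓ n / n) := by field_simp
            _ ≤ ((k + 1 : ℕ) : ℝ) * 2 := by gcongr; linarith
            _ = _ := mul_comm _ _
        rw [Real.norm_eq_abs, abs_mul, abs_mul, abs_mul, abs_of_pos hl]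
        calc _ ≤ 1 * (2 * ((k + 1 : ℕ) : ℝ) * |autocov X μ (k + 1 : ℕ)|) := by gcongr
          _ = _ := by ring
      · simp only [norm_zero]; positivity
  have hfsum : ∀ n, ∑' k, f n k = ∑ k ∈ Finset.range n, (1 - ((k + 1 : ℕ) : ℝ) * (n : ℝ)⁻¹) *
      (ℓ n * (sbWeight n (1 - (ℓ n)⁻¹) (k + 1) - 1) * autocov X μ (k + 1 : ℕ)) := by
    intro n
    rw [tsum_eq_sum (s := Finset.range n)]
    · exact Finset.sum_congr rfl fun k hk => if_pos (Finset.mem_range.1 hk)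
    · intro k hk
      exact if_neg (by simpa using hk)
  have hG := tsum_abs_mul_autocov hX hA1
  have hfinal := ((hmain.const_mul 2).sub hmean).add_const (∑' k : ℤ, |(k : ℝ)| * autocov X μ k)
  rw [tsum_neg, hG] at hfinal
  have hz : 2 * -(∑' k : ℕ, ((k + 1 : ℕ) : ℝ) * autocov X μ (k + 1 : ℕ)) - 0 +
      2 * ∑' k : ℕ, ((k + 1 : ℕ) : ℝ) * autocov X μ (k + 1 : ℕ) = 0 := by ring
  rw [hz] at hfinal
  rw [isLittleO_iff_tendsto']
  · refine hfinal.congr' ?_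
    filter_upwards [hℓ, eventually_ge_atTop 1] with n h1 h2
    have hl : ℓ n ≠ 0 := by positivity
    rw [integral_sbEstimator_sub hX hA1 h2 h1, hfsum, hG]
    have e : ∑ k ∈ Finset.range n, (1 - ((k + 1 : ℕ) : ℝ) * (n : ℝ)⁻¹) *
      (ℓ n * (sbWeight n (1 - (ℓ n)⁻¹) (k + 1) - 1) * autocov X μ (k + 1 : ℕ)) =
      ℓ n * ∑ k ∈ Finset.range n, (1 - ((k + 1 : ℕ) : ℝ) * (n : ℝ)⁻¹) *
        ((sbWeight n (1 - (ℓ n)⁻¹) (k + 1) - 1) * autocov X μ (k + 1 : ℕ)) := by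
      rw [Finset.mul_sum]
      exact Finset.sum_congr rfl fun k _ => by ring
    rw [e]
    field_simp
    ring
  · filter_upwards [hℓ] with n h1 h2
    exact absurd h2 (by positivity)

end StationaryBootstrap

/-! ### Main theorem -/

theorem theorem1 {Ω : Type*} [MeasurableSpace Ω] (μ : Measure Ω) [IsProbabilityMeasure μ]
    (X : ℤ → Ω → ℝ) (hX : StationaryBootstrap.IsStrictlyStationary X μ)
    (hA1 : StationaryBootstrap.CondA1 X μ) :
    -- variance of the stationary bootstrap estimator
    (StationaryBootstrap.CondA2 X μ →
      ∀ ℓ : ℕ → ℝ, (∀ᶠ n in atTop, 1 < ℓ n) → StationaryBootstrap.CondA3 ℓ →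
        (∀ᶠ n : ℕ in atTop, MemLp (fun ω => StationaryBootstrap.sbEstimator n (ℓ n)
          (StationaryBootstrap.data X ω)) 2 μ) ∧
        (fun n : ℕ => Var[fun ω => StationaryBootstrap.sbEstimator n (ℓ n)
            (StationaryBootstrap.data X ω); μ]
          - ℓ n / n * (2 * (2 * Real.pi * StationaryBootstrap.spectralDensity X μ 0) ^ 2))
          =o[atTop] (fun n : ℕ => ℓ n / n)) ∧
    -- the nonoverlapping block bootstrap estimator has the same first-order variance
    (StationaryBootstrap.CondA2 X μ →
      ∀ ℓ : ℕ → ℕ, StationaryBootstrap.CondA3 (fun n => (ℓ n : ℝ)) →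
        (∀ᶠ n : ℕ in atTop, MemLp (fun ω => StationaryBootstrap.nbbEstimator n (ℓ n)
          (StationaryBootstrap.data X ω)) 2 μ) ∧
        (fun n : ℕ => Var[fun ω => StationaryBootstrap.nbbEstimator n (ℓ n)
            (StationaryBootstrap.data X ω); μ]
          - (ℓ n : ℝ) / n * (2 * (2 * Real.pi * StationaryBootstrap.spectralDensity X μ 0) ^ 2))
          =o[atTop] (fun n : ℕ => (ℓ n : ℝ) / n)) ∧
    -- bias of the stationary bootstrap estimator
    (∀ ℓ : ℕ → ℝ, (∀ᶠ n in atTop, 1 < ℓ n) →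
      Tendsto (fun n : ℕ => (ℓ n)⁻¹ + ℓ n ^ 2 / n) atTop (𝓝 0) →
        (∀ᶠ n : ℕ in atTop, Integrable (fun ω => StationaryBootstrap.sbEstimator n (ℓ n)
          (StationaryBootstrap.data X ω)) μ) ∧
        (fun n : ℕ => (∫ ω, StationaryBootstrap.sbEstimator n (ℓ n)
            (StationaryBootstrap.data X ω) ∂μ) - StationaryBootstrap.sigmaSq X μ n
          - (-(∑' k : ℤ, |(k : ℝ)| * StationaryBootstrap.autocov X μ k) / ℓ n))
          =o[atTop] (fun n : ℕ => 1 / ℓ n)) := by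
  exact ⟨fun hA2 _ hℓ hA3 => StationaryBootstrap.sb_variance hX hA1 hA2 hℓ hA3,
    fun hA2 _ hA3 => StationaryBootstrap.nbb_variance hX hA1 hA2 hA3,
    fun _ hℓ hlim => StationaryBootstrap.sb_bias hX hA1 hℓ hlim⟩
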